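/- **Setting.** A *rational $G^1$ polygonal surface $\mathcal M$ made up of rectangles and triangles* consists of the following data. * A finite non-empty family $(\Omega_\ell)_{\ell\in K_0}$ of non-degenerate triangles and rectangles in $\mathbb R^2$. A *standard coordinate system* attached to an edge $\tau$ of $\Omega$ at an endpoint $P$ of $\tau$ is the pair $(u,v)$ of affine functions such that $u=v=0$ at $P$, $(u,v)=(1,0)$ at the other endpoint of $\tau$, and $(u,v)=(0,1)$ at the other endpoint of the second edge of $\Omega$ at $P$. * A finite family, indexed by $K_1$, of gluings $\lambda:\tau_1\to\tau_2$ (affine bijections) between edges of the polygons; each polygon edge is glued at most once and not to itself, and the polygons form a connected surface. The glued pairs $\mathcal E=\tau_1\sim\tau_2$ are the *interior edges*, the unglued polygon edges are the *boundary edges*, and the *vertices* of $\mathcal M$ are the classes of polygon vertices identified by the gluings. A vertex is a *boundary vertex* if it lies on a boundary edge, and an *interior vertex* otherwise. The *valency* of a vertex is the number of polygon vertices in its class. * For each interior edge $\tau_1\sim\tau_2$, with standard coordinates $(u_1,v_1)$, $(u_2,v_2)$ attached to $\tau_1,\tau_2$ such that $\lambda$ is $u_2=u_1$, an identification of tangent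 spaces $$\frac{\partial}{\partial u_1}\mapsto\frac{\partial}{\partial u_2},\qquad \frac{\partial}{\partial v_1}\mapsto\beta(u_1)\frac{\partial}{\partial u_2}+\gamma(u_1)\frac{\partial}{\partial v_2},\qquad \beta=\frac ba,\quad \gamma=\frac ca,$$ with $a,b,c\in\mathbb R[u_1]$ without a common factor, $a\ne0$ and $\gamma<0$ on $[0,1]$. The same identification is also written in the other standard coordinates $u_1=1$, $u_2=1$ at the origin, and read in the opposite direction $\tau_2\to\tau_1$, by the induced change of $(\beta,\gamma)$. These data satisfy the following conditions. Let $P_1,\dots,P_n$ be the consecutive polygon vertices around a vertex of $\mathcal M$, with standard coordinates $(u_k,v_k)$ at $P_k$, where the edge $v_k=0$ is glued to the edge $u_{k-1}=0$ with data $(\beta_k,\gamma_k)$, that is, $\partial/\partial u_k\mapsto\partial/\partial v_{k-1}$ and $\partial/\partial v_k\mapsto\beta_k\,\partial/\partial v_{k-1}+\gamma_k\,\partial/\partial u_{k-1}$ (cyclically, $k=1,\dots,n$ and $P_0=P_n$, for an interior vertex; $k=2,\dots,n$ for a boundary vertex). Put $T_k=\begin{pmatrix}0&1\\ \gamma_k(0)&\beta_k(0)\end{pmatrix}$.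 The gluing is *joining* at this vertex if $\beta_k(0)=0$. An interior vertex is a *crossing vertex* if $n=4$ and all four gluings are joining at it. * At an interior vertex, $T_n\cdots T_1=I$, and each $T_k\cdots T_1$ with $1\le k<n$ has a non-positive entry in each row and on the main diagonal. * At a crossing vertex, $$\beta_1'(0)+\frac{\gamma_2'(0)}{\gamma_2(0)}=-\gamma_1(0)\Big(\beta_3'(0)+\frac{\gamma_4'(0)}{\gamma_4(0)}\Big),\qquad \beta_2'(0)+\frac{\gamma_3'(0)}{\gamma_3(0)}=-\gamma_2(0)\Big(\beta_4'(0)+\frac{\gamma_1'(0)}{\gamma_1(0)}\Big).$$ * At a boundary vertex, each $T_k\cdots T_2$ with $2\le k\le n$ has a non-positive entry in each row and on the main diagonal, and, if $n\ge2$, the bottom row of $T_n\cdots T_2$ is not $(1\ 0)$. For an integer $k\ge0$, let $S^1_k(\mathcal M)$ be the space of families $(g_\ell)_{\ell\in K_0}$ of polynomial functions on the $\Omega_\ell$, of degree $\le k$ on triangles and of bidegree $\le(k,k)$ (in coordinates along the sides) on rectangles, such that on every interior edge, for all $u\in[0,1]$, with $g_1,g_2$ the polynomials on the two sides written in the coordinates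 $(u_1,v_1)$, $(u_2,v_2)$, $$g_1(u,0)=g_2(u,0),\qquad \frac{\partial g_1}{\partial v_1}(u,0)=\beta(u)\frac{\partial g_2}{\partial u_2}(u,0)+\gamma(u)\frac{\partial g_2}{\partial v_2}(u,0).$$ For an interior edge $\mathcal E=\tau_1\sim\tau_2$ let $r_j=1$ if $\tau_j$ is an edge of a rectangle and $r_j=0$ if it is an edge of a triangle, and put $\delta(\mathcal E)=\max(r_1+\deg a,\ \deg b,\ r_2+\deg c)$ and $\delta(\mathcal M)=\sum_{\mathcal E}\delta(\mathcal E)$. Let $\mathcal Z$ be the $\mathbb R[u]$-module of triples $(A,B,C)\in\mathbb R[u]^3$ with $aA+bB+cC=0$. The *twisted degree* of a non-zero $(A,B,C)\in\mathcal Z$ is the least integer $d\ge0$ with $\deg A\le d-1+r_1$, $\deg B\le d-1$, $\deg C\le d-1+r_2$, and its leading vector consists of the coefficients of $A$, $B$, $C$ in degrees $d-1+r_1$, $d-1$, $d-1+r_2$. A pair of generators of $\mathcal Z$ is *minimal* if their leading vectors are linearly independent. Let $d_1(\mathcal E)\le d_2(\mathcal E)$ be the twisted degrees of a minimal pair of generators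 of $\mathcal Z$. Let $N_0,N_0^+,N_1^\partial,N_\Box,N_\Delta$ be the numbers of vertices, crossing vertices, boundary edges, rectangles and triangles of $\mathcal M$. **Theorem.** Let $k\ge0$ be an integer such that $k\ge\max\big(2d_1(\mathcal E)+3,\ d_2(\mathcal E)+4\big)$ for every interior edge $\mathcal E$. Then $S^1_k(\mathcal M)$ is finite-dimensional and $$\dim S^1_k(\mathcal M)=3N_0+N_0^+-\delta(\mathcal M)+\Big(k-\frac52\Big)N_1^\partial+(k^2-2k-1)N_\Box+\frac{k^2-3k-1}2\,N_\Delta .$$ -/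

import Mathlib

namespace G1Spline

noncomputable section

/-- The Euclidean plane in which the polygons live. -/
abbrev Plane : Type := EuclideanSpace ℝ (Fin 2)

/-- `p 0, p 1, p 2, p 3` are, in cyclic order, the vertices of a (nondegenerate) rectangle. -/
def IsRectangle (p : Fin 4 → Plane) : Prop :=
  p 1 - p 0 = p 2 - p 3 ∧ inner ℝ (p 1 - p 0) (p 3 - p 0) = 0 ∧ p 1 ≠ p 0 ∧ p 3 ≠ p 0

/-- A polygon of the surface: a triangle or a rectangle in the plane, given by its vertices in
cyclic order. -/
inductive Tile : Type
  | triangle (p : Fin 3 → Plane) (h : AffineIndependent ℝ p) : Tile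
  | rectangle (p : Fin 4 → Plane) (h : IsRectangle p) : Tile

namespace Tile

/-- Number of sides. -/
def sides : Tile → ℕ
  | triangle _ _ => 3
  | rectangle _ _ => 4

instance neZeroSides (T : Tile) : NeZero T.sides :=
  ⟨by cases T <;> simp [sides]⟩

/-- The `i`-th vertex; the `i`-th edge joins the vertices `i` and `i + 1` (cyclically). -/
def vertex : (T : Tile) → Fin T.sides → Plane
  | triangle p _ => p
  | rectangle p _ => p

def IsRect : Tile → Prop
  | triangle _ _ => False
  | rectangle _ _ => True

def IsTri : Tile → Prop
  | triangle _ _ => True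
  | rectangle _ _ => False

/-- `1` for a rectangle, `0` for a triangle. -/
def r : Tile → ℕ
  | triangle _ _ => 0
  | rectangle _ _ => 1

/-- The coefficient `ρ` in the change `(u, v) ↦ (1 - u - ρ v, v)` between the two standard
coordinate systems attached to an edge: `1` for a triangle, `0` for a rectangle. -/
def rho : Tile → ℝ
  | triangle _ _ => 1
  | rectangle _ _ => 0

end Tile

variable {K₀ K₁ : Type*}

/-- A vertex of one of the polygons. -/
abbrev Corner (Ω : K₀ → Tile) : Type _ := (l : K₀) × Fin (Ω l).sides

/-- An edge of one of the polygons; `⟨l, i⟩` joins the vertices `i` and `i + 1` of `Ω l`. -/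
abbrev PolyEdge (Ω : K₀ → Tile) : Type _ := (l : K₀) × Fin (Ω l).sides

/-- A standard coordinate system `(u, v)` at a polygon vertex: the origin is the vertex `idx`.
If `dir = false` then `(u, v) = (1, 0)` at vertex `idx + 1` and `(u, v) = (0, 1)` at vertex
`idx - 1`; if `dir = true` these two roles are exchanged. It is attached to the polygon edge
on which `v = 0`, with `u = 0` at the vertex `idx`. -/
@[ext]
structure Flag (Ω : K₀ → Tile) where
  tile : K₀
  idx : Fin (Ω tile).sides
  dir : Bool

namespace Flag

variable {Ω : K₀ → Tile}

/-- The vertex `u = v = 0`. -/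
def corner (f : Flag Ω) : Corner Ω := ⟨f.tile, f.idx⟩

/-- The edge `v = 0`. -/
def edge (f : Flag Ω) : PolyEdge Ω :=
  ⟨f.tile, if f.dir then f.idx - 1 else f.idx⟩

/-- The coordinate system `(v, u)`. -/
def swap (f : Flag Ω) : Flag Ω := ⟨f.tile, f.idx, !f.dir⟩

/-- The other standard coordinate system attached to the same edge. -/
def rev (f : Flag Ω) : Flag Ω :=
  ⟨f.tile, if f.dir then f.idx - 1 else f.idx + 1, !f.dir⟩

def origin (f : Flag Ω) : Plane := (Ω f.tile).vertex f.idx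

/-- The direction of `∂/∂u`. -/
def uVec (f : Flag Ω) : Plane :=
  (Ω f.tile).vertex (if f.dir then f.idx - 1 else f.idx + 1) - f.origin

/-- The direction of `∂/∂v`. -/
def vVec (f : Flag Ω) : Plane :=
  (Ω f.tile).vertex (if f.dir then f.idx + 1 else f.idx - 1) - f.origin

/-- A polynomial function on the plane, rewritten as a polynomial in the coordinates
`u = X 0`, `v = X 1` of `f`. -/
def pull (f : Flag Ω) : MvPolynomial (Fin 2) ℝ →ₐ[ℝ] MvPolynomial (Fin 2) ℝ :=
  MvPolynomial.aeval fun j : Fin 2 =>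
    MvPolynomial.C (f.origin j) + MvPolynomial.C (f.uVec j) * MvPolynomial.X 0
      + MvPolynomial.C (f.vVec j) * MvPolynomial.X 1

end Flag

/-- A gluing of two polygon edges. With `(u₁, v₁) = src` and `(u₂, v₂) = tgt`, the edge `v₁ = 0`
is glued to the edge `v₂ = 0` by the linear homeomorphism `u₂ = u₁`, and the tangent spaces along
it are identified by `∂/∂u₁ ↦ ∂/∂u₂`, `∂/∂v₁ ↦ β(u₁) ∂/∂u₂ + γ(u₁) ∂/∂v₂`.
Only the restrictions of `β`, `γ` to `[0,1]` matter. -/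
structure EdgeGluing (Ω : K₀ → Tile) where
  src : Flag Ω
  tgt : Flag Ω
  β : ℝ → ℝ
  γ : ℝ → ℝ

namespace EdgeGluing

variable {Ω : K₀ → Tile}

/-- The inverse identification. -/
def symm (e : EdgeGluing Ω) : EdgeGluing Ω where
  src := e.tgt
  tgt := e.src
  β := fun t => -(e.β t / e.γ t)
  γ := fun t => 1 / e.γ t

/-- The same identification, written in the other standard coordinate systems attached to the
two edges. -/
def rev (e : EdgeGluing Ω) : EdgeGluing Ω where
  src := e.src.rev
  tgt := e.tgt.rev
  β := fun t => (Ω e.src.tile).rho - e.β (1 - t) - (Ω e.tgt.tile).rho * e.γ (1 - t)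
  γ := fun t => e.γ (1 - t)

/-- The matrix expressing the partial derivatives in the coordinates `src` at its origin
through those in the coordinates `tgt.swap`. -/
def mat (e : EdgeGluing Ω) : Matrix (Fin 2) (Fin 2) ℝ :=
  !![0, 1; e.γ 0, e.β 0]

/-- The edge is a joining edge at the vertex `u = 0`. -/
def IsJoining (e : EdgeGluing Ω) : Prop := e.β 0 = 0

end EdgeGluing

/-- A linear `G⁰` polygonal surface made up of triangles and rectangles, together with tangent
bundle identifications `β k`, `γ k` on the interior edges `k : K₁`. -/
structure GluedSurface (K₀ K₁ : Type*) where
  Ω : K₀ → Tile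
  gluing : K₁ → EdgeGluing Ω
  /-- Each polygon edge is glued to at most one edge, and not to itself. -/
  paired_once : Function.Injective
    (Sum.elim (fun k => (gluing k).src.edge) (fun k => (gluing k).tgt.edge))
  nonempty : Nonempty K₀
  connected : ∀ l l' : K₀, Relation.EqvGen
    (fun x y => ∃ k, x = (gluing k).src.tile ∧ y = (gluing k).tgt.tile) l l'

namespace GluedSurface

variable (S : GluedSurface K₀ K₁)

/-- The gluing of the interior edge `k` read in all four ways: the first Boolean inverts the
identification, the second one passes to the other endpoint. -/
def oriented : K₁ × Bool × Bool → EdgeGluing S.Ω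
  | (k, false, false) => S.gluing k
  | (k, true, false) => (S.gluing k).symm
  | (k, false, true) => (S.gluing k).rev
  | (k, true, true) => (S.gluing k).symm.rev

def IsGluedEdge (t : PolyEdge S.Ω) : Prop :=
  ∃ k, t = (S.gluing k).src.edge ∨ t = (S.gluing k).tgt.edge

/-- Boundary edges of the surface. -/
abbrev BoundaryEdge : Type _ := {t : PolyEdge S.Ω // ¬ S.IsGluedEdge t}

/-- Vertices of the surface: classes of polygon vertices identified by the gluings. -/
abbrev Vertex : Type _ :=
  Quot fun P Q : Corner S.Ω =>
    ∃ o, P = (S.oriented o).src.corner ∧ Q = (S.oriented o).tgt.corner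

/-- `e 0, …, e (n - 1)`, continued periodically, are the gluings met consecutively around an
interior vertex of valency `n`. The polygon corner number `k` has the standard coordinates
`(S.oriented (e k)).src`; its edge `v = 0` is glued by `e k` to the edge `u = 0` of the corner
number `k - 1`. -/
def IsVertexCycle (n : ℕ) (e : ℕ → K₁ × Bool × Bool) : Prop :=
  0 < n ∧ (∀ k, e (k + n) = e k) ∧
  (∀ k, (S.oriented (e (k + 1))).tgt = (S.oriented (e k)).src.swap) ∧
  Set.InjOn (fun k => (S.oriented (e k)).src.corner) (Set.Iio n)

/-- `e 0, …, e (m - 1)` are the gluings met consecutively around a boundary vertex of valency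
`m + 1`, from one boundary edge to the other. -/
def IsVertexChain (m : ℕ) (e : ℕ → K₁ × Bool × Bool) : Prop :=
  0 < m ∧
  (∀ k, k + 1 < m → (S.oriented (e (k + 1))).tgt = (S.oriented (e k)).src.swap) ∧
  ¬ S.IsGluedEdge (S.oriented (e 0)).tgt.swap.edge ∧
  ¬ S.IsGluedEdge (S.oriented (e (m - 1))).src.swap.edge

/-- The product of the tangent space transformations of `e (j - 1), …, e 0`. -/
def transProd (e : ℕ → K₁ × Bool × Bool) : ℕ → Matrix (Fin 2) (Fin 2) ℝ
  | 0 => 1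
  | j + 1 => (S.oriented (e j)).mat * transProd e j

/-- The labelled interior vertex is a crossing vertex: valency `4`, all edges joining. -/
def IsCrossingCycle (e : ℕ → K₁ × Bool × Bool) : Prop :=
  S.IsVertexCycle 4 e ∧ ∀ k < 4, (S.oriented (e k)).IsJoining

def IsCrossingVertex (v : S.Vertex) : Prop :=
  ∃ e, S.IsCrossingCycle e ∧ v = Quot.mk _ (S.oriented (e 0)).src.corner

/-- There is a non-positive entry on each row and on the main diagonal. -/
def SectorsDisjoint (M : Matrix (Fin 2) (Fin 2) ℝ) : Prop :=
  (∀ i, ∃ j, M i j ≤ 0) ∧ ∃ i, M i i ≤ 0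

/-- Compatibility of the first derivatives of the gluing data around a crossing vertex
(`β₁', …, β₄'` being `β' 0, …, β' 3`, and similarly for `γ`). -/
def CrossingCondition (e : ℕ → K₁ × Bool × Bool) : Prop :=
  ∀ β' γ' : ℕ → ℝ,
    (∀ k < 4, HasDerivWithinAt (S.oriented (e k)).β (β' k) (Set.Icc 0 1) 0 ∧
      HasDerivWithinAt (S.oriented (e k)).γ (γ' k) (Set.Icc 0 1) 0) →
    β' 0 + γ' 1 / (S.oriented (e 1)).γ 0 =
        -(S.oriented (e 0)).γ 0 * (β' 2 + γ' 3 / (S.oriented (e 3)).γ 0) ∧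
    β' 1 + γ' 2 / (S.oriented (e 2)).γ 0 =
        -(S.oriented (e 1)).γ 0 * (β' 3 + γ' 0 / (S.oriented (e 0)).γ 0)

end GluedSurface

/-- A `G¹` polygonal surface made up of triangles and rectangles. -/
structure G1PolygonalSurface (K₀ K₁ : Type*) extends GluedSurface K₀ K₁ where
  β_continuous : ∀ k, ContinuousOn (gluing k).β (Set.Icc 0 1)
  γ_continuous : ∀ k, ContinuousOn (gluing k).γ (Set.Icc 0 1)
  γ_neg : ∀ k, ∀ t ∈ Set.Icc (0 : ℝ) 1, (gluing k).γ t < 0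
  /-- Going around an interior vertex induces the identity of the tangent space. -/
  vertex_identity : ∀ n e, toGluedSurface.IsVertexCycle n e → toGluedSurface.transProd e n = 1
  /-- The tangent sectors around an interior vertex do not wind up. -/
  vertex_sectors : ∀ n e, toGluedSurface.IsVertexCycle n e →
    ∀ j, 1 ≤ j → j < n → GluedSurface.SectorsDisjoint (toGluedSurface.transProd e j)
  crossing : ∀ e, toGluedSurface.IsCrossingCycle e → toGluedSurface.CrossingCondition e
  /-- The tangent sectors around a boundary vertex do not wind up. -/
  boundary_sectors : ∀ m e, toGluedSurface.IsVertexChain m e →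
    (∀ j, 1 ≤ j → j ≤ m → GluedSurface.SectorsDisjoint (toGluedSurface.transProd e j)) ∧
    toGluedSurface.transProd e m 1 ≠ ![1, 0]

namespace G1PolygonalSurface

variable (S : G1PolygonalSurface K₀ K₁)

/-- The gluing data are the rational functions `β k = b k / a k`, `γ k = c k / a k`, where the
polynomials `a k`, `b k`, `c k` have no common factor. -/
def IsRationalWith (a b c : K₁ → Polynomial ℝ) : Prop :=
  ∀ k, (∀ p : Polynomial ℝ, p ∣ a k → p ∣ b k → p ∣ c k → IsUnit p) ∧
    ∀ t ∈ Set.Icc (0 : ℝ) 1, (a k).eval t ≠ 0 ∧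
      (S.gluing k).β t = (b k).eval t / (a k).eval t ∧
      (S.gluing k).γ t = (c k).eval t / (a k).eval t

/-- The polynomials `g l` on the polygons `Ω l` form a `G¹` function. -/
def IsG1 (g : K₀ → MvPolynomial (Fin 2) ℝ) : Prop :=
  ∀ k, ∀ t ∈ Set.Icc (0 : ℝ) 1,
    let e := S.gluing k
    let g₁ := e.src.pull (g e.src.tile)
    let g₂ := e.tgt.pull (g e.tgt.tile)
    MvPolynomial.eval ![t, 0] g₁ = MvPolynomial.eval ![t, 0] g₂ ∧
    MvPolynomial.eval ![t, 0] (MvPolynomial.pderiv 1 g₁) =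
      e.β t * MvPolynomial.eval ![t, 0] (MvPolynomial.pderiv 0 g₂) +
      e.γ t * MvPolynomial.eval ![t, 0] (MvPolynomial.pderiv 1 g₂)

/-- Polynomials of degree `≤ k` on a triangle, and of bidegree `≤ (k, k)` (in coordinates along
the sides) on a rectangle. -/
def degreeSpace (k : ℕ) (l : K₀) : Submodule ℝ (MvPolynomial (Fin 2) ℝ) :=
  match S.Ω l with
  | .triangle _ _ => MvPolynomial.restrictTotalDegree (Fin 2) ℝ k
  | .rectangle _ _ =>
      (MvPolynomial.restrictDegree (Fin 2) ℝ k).comap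
        (Flag.pull (Ω := S.Ω) ⟨l, 0, false⟩).toLinearMap

/-- The space of `G¹` splines of degree `≤ k`. -/
def splineSpace (k : ℕ) : Submodule ℝ (K₀ → MvPolynomial (Fin 2) ℝ) where
  carrier := {g | S.IsG1 g ∧ ∀ l, g l ∈ S.degreeSpace k l}
  zero_mem' := ⟨fun k t _ => by simp, fun l => Submodule.zero_mem _⟩
  add_mem' := by
    rintro g h ⟨hg, hg'⟩ ⟨hh, hh'⟩
    refine ⟨fun k t ht => ?_, fun l => Submodule.add_mem _ (hg' l) (hh' l)⟩
    have h1 := hg k t ht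
    have h2 := hh k t ht
    simp only [Pi.add_apply, map_add] at h1 h2 ⊢
    exact ⟨by rw [h1.1, h2.1], by rw [h1.2, h2.2]; ring⟩
  smul_mem' := by
    rintro x g ⟨hg, hg'⟩
    refine ⟨fun k t ht => ?_, fun l => Submodule.smul_mem _ _ (hg' l)⟩
    have h1 := hg k t ht
    simp only [Pi.smul_apply, map_smul, Derivation.map_smul, MvPolynomial.smul_eval] at h1 ⊢
    exact ⟨by rw [h1.1], by rw [h1.2]; ring⟩

/-- The number of vertices. -/
def numVertices : ℕ := Nat.card S.Vertex

/-- The number of crossing vertices. -/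
def numCrossing : ℕ := Nat.card {v : S.Vertex // S.IsCrossingVertex v}

/-- The number of boundary edges. -/
def numBoundaryEdges : ℕ := Nat.card S.BoundaryEdge

/-- The number of rectangles. -/
def numRectangles : ℕ := Nat.card {l : K₀ // (S.Ω l).IsRect}

/-- The number of triangles. -/
def numTriangles : ℕ := Nat.card {l : K₀ // (S.Ω l).IsTri}

/-- `r₁` for the interior edge `k`. -/
def r₁ (k : K₁) : ℕ := (S.Ω (S.gluing k).src.tile).r

/-- `r₂` for the interior edge `k`. -/
def r₂ (k : K₁) : ℕ := (S.Ω (S.gluing k).tgt.tile).r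

/-- `δ` of the interior edge `k` (the zero polynomial may be given degree `0` here,
because `a k ≠ 0`). -/
def delta (a b c : K₁ → Polynomial ℝ) (k : K₁) : ℕ :=
  max (S.r₁ k + (a k).natDegree) (max (b k).natDegree (S.r₂ k + (c k).natDegree))

end G1PolygonalSurface

/-- The module of syzygies `(A, B, C)` between `a`, `b`, `c`. -/
def syz (a b c : Polynomial ℝ) : Submodule (Polynomial ℝ) (Fin 3 → Polynomial ℝ) where
  carrier := {Z | a * Z 0 + b * Z 1 + c * Z 2 = 0}
  zero_mem' := by simp
  add_mem' := by
    intro Z W hZ hW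
    simp only [Set.mem_ofPred_eq, Pi.add_apply] at hZ hW ⊢
    linear_combination hZ + hW
  smul_mem' := by
    intro p Z hZ
    simp only [Set.mem_ofPred_eq, Pi.smul_apply, smul_eq_mul] at hZ ⊢
    linear_combination p * hZ

/-- The degree bounds `deg A ≤ k - 1 + r₁`, `deg B ≤ k - 1`, `deg C ≤ k - 1 + r₂`. -/
def TwistedDegreeLE (r₁ r₂ : ℕ) (Z : Fin 3 → Polynomial ℝ) (k : ℕ) : Prop :=
  (Z 0).degree < ((k + r₁ : ℕ) : WithBot ℕ) ∧ (Z 1).degree < (k : WithBot ℕ) ∧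
    (Z 2).degree < ((k + r₂ : ℕ) : WithBot ℕ)

/-- The twisted degree (of a non-zero triple): the least `k` with these degree bounds. -/
def tdeg (r₁ r₂ : ℕ) (Z : Fin 3 → Polynomial ℝ) : ℕ :=
  sInf {k | TwistedDegreeLE r₁ r₂ Z k}

/-- The coefficients of the expected leading terms of degrees `k - 1 + r₁`, `k - 1`,
`k - 1 + r₂`, where `k` is the twisted degree. (If such a number is `-1`, the corresponding
component is the zero polynomial, and so is the coefficient.) -/
def leadingVec (r₁ r₂ : ℕ) (Z : Fin 3 → Polynomial ℝ) : Fin 3 → ℝ :=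
  ![(Z 0).coeff (tdeg r₁ r₂ Z + r₁ - 1), (Z 1).coeff (tdeg r₁ r₂ Z - 1),
    (Z 2).coeff (tdeg r₁ r₂ Z + r₂ - 1)]

/-- `Z₁`, `Z₂` is a minimal pair of generators of the syzygy module: their leading terms are
linearly independent. -/
def IsMinimalPair (a b c : Polynomial ℝ) (r₁ r₂ : ℕ) (Z₁ Z₂ : Fin 3 → Polynomial ℝ) : Prop :=
  Submodule.span (Polynomial ℝ) {Z₁, Z₂} = syz a b c ∧
    LinearIndependent ℝ ![leadingVec r₁ r₂ Z₁, leadingVec r₁ r₂ Z₂]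

end

end G1Spline

open Polynomial
open scoped Matrix

namespace G1Spline

noncomputable section

/-! ### Linear algebra -/

/-! The space of splines is split by two maps. Taking two-jets (the Taylor coefficients of 1, u, v,
u², v², uv) at all polygon corners leaves a kernel of splines that are flat at the corners, and
taking values and normal derivatives along the interior edges splits this kernel again. What
remains, the polynomials with zero two-jets and zero traces, satisfies every gluing condition
trivially. Its dimension follows by applying the same two maps to the unglued piecewise polynomials,
for which all two-jets and all flat traces occur (`GluedSurface.finrank_flatPiecewise`).

Edges. With common value p and normal derivatives q, q' on the two sides, the gluing condition is aq
= bp' + cq', that is, (q, -p', -q') is a syzygy of (a, b, c). The syzygy module is free on a minimal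
pair (`exists_isMinimalPair`, `IsMinimalPair.eq_zero`), and comparing its cross product with (a, b,
c) gives d₁ + d₂ + r₁ + r₂ = δ + 2 (`IsMinimalPair.tdeg_add_tdeg`). Flat traces are X²(1 - X)² times
a syzygy of twisted degree at most k - 4 whose weighted middle component has integral zero, so that
p vanishes at both ends. The bound on k makes this integral a nontrivial condition
(`IsMinimalPair.exists_unitIntegral_ne_zero`), so an edge contributes 2k - 9 - δ + r₁ + r₂
(`IsMinimalPair.finrank_flatSyz`).

Vertices. On the walk around a vertex, each edge crossed into a new corner imposes five independent
conditions on its six jet coefficients. At an interior vertex the closing edge adds conditions only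
on the second derivative along the edge and on the mixed derivative; value and gradient agree
because the transitions multiply to the identity. At a crossing vertex the mixed condition is
automatic too, and this is the source of the term N₀⁺ (`FlagSystem.closing_conditions`,
`FlagSystem.finrank_compatibleJets`). Every compatible family of two-jets comes from a spline, since
edges can be treated separately: syzygies of bounded degree interpolate all first order data at both
ends together with the integral (`IsMinimalPair.exists_interpolation`, `map_jets_splineSpace`).

Counting flags by corners, by edges and by walks around vertices expresses the auxiliary numbers
through N₀, the boundary edges and the polygons. -/

theorem finrank_map_add_finrank_inf_ker {V W : Type*} [AddCommGroup V] [Module ℝ V]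
    [AddCommGroup W] [Module ℝ W] (f : V →ₗ[ℝ] W) (P : Submodule ℝ V) [Module.Finite ℝ P] :
    Module.finrank ℝ (P.map f) + Module.finrank ℝ (P ⊓ LinearMap.ker f : Submodule ℝ V) =
      Module.finrank ℝ P := by
  have h := LinearMap.finrank_range_add_finrank_ker (f.domRestrict P)
  rw [LinearMap.range_domRestrict] at h
  rw [← h, LinearMap.ker_domRestrict, ← Submodule.map_comap_subtype, Submodule.finrank_map_subtype_eq]

theorem finrank_degreeLT (n : ℕ) : Module.finrank ℝ (degreeLT ℝ n) = n := by
  rw [(degreeLTEquiv ℝ n).finrank_eq]; simp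

instance finite_degreeLT (n : ℕ) : Module.Finite ℝ (degreeLT ℝ n) :=
  Module.Finite.equiv (degreeLTEquiv ℝ n).symm

/-! ### Univariate polynomials -/

/-- The antiderivative vanishing at `0`. -/
def antider : ℝ[X] →ₗ[ℝ] ℝ[X] :=
  Polynomial.lsum fun n => (Polynomial.monomial (n + 1)).comp
    (((n : ℝ) + 1)⁻¹ • (LinearMap.id : ℝ →ₗ[ℝ] ℝ))

theorem antider_monomial (n : ℕ) (x : ℝ) :
    antider (monomial n x) = monomial (n + 1) (((n : ℝ) + 1)⁻¹ * x) := by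
  simp [antider, Polynomial.lsum_apply, Polynomial.sum_monomial_index]

theorem derivative_antider (p : ℝ[X]) : derivative (antider p) = p := by
  induction p using Polynomial.induction_on' with
  | add p q hp hq => simp [hp, hq]
  | monomial n x =>
    rw [antider_monomial, derivative_monomial]
    congr 1
    have : (n : ℝ) + 1 ≠ 0 := by positivity
    push_cast
    field_simp

theorem coeff_antider_zero (p : ℝ[X]) : (antider p).coeff 0 = 0 := by
  induction p using Polynomial.induction_on' with
  | add p q hp hq => simp [hp, hq]
  | monomial n x => simp [antider_monomial, coeff_monomial]

theorem eval_antider_zero (p : ℝ[X]) : (antider p).eval 0 = 0 := by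
  rw [← coeff_zero_eq_eval_zero, coeff_antider_zero]

theorem antider_derivative (p : ℝ[X]) : antider (derivative p) = p - C (p.coeff 0) := by
  have h : derivative (antider (derivative p) - p) = 0 := by simp [derivative_antider]
  have h2 := eq_C_of_derivative_eq_zero h
  rw [coeff_sub, coeff_antider_zero, zero_sub, C_neg] at h2
  linear_combination h2

theorem coeff_antider_succ (p : ℝ[X]) (n : ℕ) :
    (antider p).coeff (n + 1) * (n + 1) = p.coeff n := by
  conv_rhs => rw [← derivative_antider p, coeff_derivative]

theorem antider_mem_degreeLT {p : ℝ[X]} {n : ℕ} (hp : p ∈ degreeLT ℝ n) :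
    antider p ∈ degreeLT ℝ (n + 1) := by
  rw [mem_degreeLT, degree_lt_iff_coeff_zero] at hp ⊢
  intro m hm
  obtain ⟨m, rfl⟩ : ∃ m', m = m' + 1 := ⟨m - 1, by omega⟩
  have h := coeff_antider_succ p m
  rw [hp m (by omega)] at h
  exact (mul_eq_zero.mp h).resolve_right (by positivity)

theorem derivative_mem_degreeLT {p : ℝ[X]} {n : ℕ} (hp : p ∈ degreeLT ℝ (n + 1)) :
    derivative p ∈ degreeLT ℝ n := by
  rw [mem_degreeLT, degree_lt_iff_coeff_zero] at hp ⊢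
  intro m hm
  rw [coeff_derivative, hp _ (by omega), zero_mul]

/-- The integral over `[0, 1]`. -/
def unitIntegral : ℝ[X] →ₗ[ℝ] ℝ := (Polynomial.leval 1).comp antider

theorem unitIntegral_apply (p : ℝ[X]) : unitIntegral p = (antider p).eval 1 := rfl

theorem unitIntegral_derivative (p : ℝ[X]) :
    unitIntegral (derivative p) = p.eval 1 - p.eval 0 := by
  rw [unitIntegral_apply, antider_derivative, coeff_zero_eq_eval_zero]; simp

/-- The antiderivative is monotone on [0, 1]. If its total increase were zero it would be constant
there, hence constant as a polynomial, forcing p = 0. -/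
theorem unitIntegral_pos {p : ℝ[X]} (hp : p ≠ 0) (h : ∀ t ∈ Set.Icc (0 : ℝ) 1, 0 ≤ p.eval t) :
    0 < unitIntegral p := by
  have hmono : MonotoneOn (fun t => (antider p).eval t) (Set.Icc (0 : ℝ) 1) := by
    apply monotoneOn_of_deriv_nonneg (convex_Icc 0 1) (antider p).continuous.continuousOn
      (antider p).differentiable.differentiableOn
    intro t ht
    rw [Polynomial.deriv, derivative_antider]
    exact h t (interior_subset ht)
  have h0 : (0 : ℝ) ∈ Set.Icc (0 : ℝ) 1 := by simp
  have h1 : (1 : ℝ) ∈ Set.Icc (0 : ℝ) 1 := by simp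
  have hz := eval_antider_zero p
  have hle : 0 ≤ unitIntegral p := by
    have := hmono h0 h1 zero_le_one
    simpa [hz, unitIntegral_apply] using this
  refine lt_of_le_of_ne hle fun he => hp ?_
  have hc : ∀ t ∈ Set.Icc (0 : ℝ) 1, (antider p).eval t = 0 := by
    intro t ht
    have ha := hmono h0 ht ht.1
    have hb := hmono ht h1 ht.2
    rw [unitIntegral_apply] at he
    simp only [hz] at ha
    simp only [← he] at hb
    linarith
  have : antider p = 0 :=
    Polynomial.eq_zero_of_infinite_isRoot _
      ((Set.Icc_infinite (zero_lt_one' ℝ)).mono fun t ht => hc t ht)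
  rw [← derivative_antider p, this, derivative_zero]

theorem exists_hermite (x x' y y' : ℝ) : ∃ p : ℝ[X], p ∈ degreeLT ℝ 4 ∧
    p.eval 0 = x ∧ (derivative p).eval 0 = x' ∧ p.eval 1 = y ∧ (derivative p).eval 1 = y' := by
  refine ⟨C x + C x' * X + C (3 * (y - x) - 2 * x' - y') * X ^ 2 +
    C (2 * (x - y) + x' + y') * X ^ 3, ?_, ?_, ?_, ?_, ?_⟩
  · rw [mem_degreeLT]
    refine lt_of_le_of_lt ?_ (show ((3 : ℕ) : WithBot ℕ) < ((4 : ℕ) : WithBot ℕ) by norm_num)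
    compute_degree!
  all_goals simp
  all_goals ring

/-- The reflection `t ↦ 1 - t`. -/
def flip : ℝ[X] →ₐ[ℝ] ℝ[X] := Polynomial.aeval (1 - X)

theorem flip_apply (p : ℝ[X]) : flip p = p.comp (1 - X) := by
  rw [flip, comp_eq_aeval]

@[simp] theorem flip_X : flip X = 1 - X := by simp [flip_apply]

@[simp] theorem flip_C (x : ℝ) : flip (C x) = C x := by simp [flip_apply]

@[simp] theorem flip_flip (p : ℝ[X]) : flip (flip p) = p := by
  simp [flip_apply, comp_assoc]

@[simp] theorem eval_flip (p : ℝ[X]) (t : ℝ) : (flip p).eval t = p.eval (1 - t) := by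
  simp [flip_apply]

theorem derivative_flip (p : ℝ[X]) : derivative (flip p) = -flip (derivative p) := by
  simp [flip_apply, derivative_comp]

theorem coeff_one_eq_eval (p : ℝ[X]) : p.coeff 1 = (derivative p).eval 0 := by
  rw [← coeff_zero_eq_eval_zero, coeff_derivative]; simp

/-- Vanishing to order n at 0 and at 1 gives divisibility by two coprime powers, hence by their
product. -/
theorem X_pow_mul_dvd_of_coeff {n : ℕ} {p : ℝ[X]} (h0 : ∀ i < n, p.coeff i = 0)
    (h1 : ∀ i < n, (flip p).coeff i = 0) : X ^ n * (1 - X) ^ n ∣ p := by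
  have hc : IsCoprime (X ^ n : ℝ[X]) ((1 - X) ^ n) := by
    apply IsCoprime.pow
    exact ⟨1, 1, by ring⟩
  refine hc.mul_dvd (X_pow_dvd_iff.2 h0) ?_
  have := X_pow_dvd_iff.2 h1
  have := map_dvd flip this
  simpa using this

theorem coeff_X_pow_mul_mul_eq_zero {n i : ℕ} (hi : i < n) (p : ℝ[X]) :
    (X ^ n * (1 - X) ^ n * p).coeff i = 0 :=
  X_pow_dvd_iff.1 (Dvd.intro _ (mul_assoc (X ^ n) _ p).symm) i hi

theorem flip_X_pow_mul (n : ℕ) (p : ℝ[X]) :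
    flip (X ^ n * (1 - X) ^ n * p) = X ^ n * (1 - X) ^ n * flip p := by
  simp only [map_mul, map_pow, map_sub, map_one, flip_X, sub_sub_cancel]
  ring

theorem degree_X_pow_mul (n : ℕ) : (X ^ n * (1 - X) ^ n : ℝ[X]).degree = ((2 * n : ℕ) : WithBot ℕ) := by
  have : (1 - X : ℝ[X]).degree = 1 := by
    rw [← neg_sub, degree_neg]; exact degree_X_sub_C 1
  rw [degree_mul, degree_pow, degree_pow, this, degree_X]
  simp [two_mul]

theorem X_pow_mul_ne_zero (n : ℕ) : (X ^ n * (1 - X) ^ n : ℝ[X]) ≠ 0 := by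
  rw [← degree_ne_bot, degree_X_pow_mul]
  exact WithBot.coe_ne_bot

theorem X_pow_mul_mem_degreeLT (n m : ℕ) (p : ℝ[X]) :
    X ^ n * (1 - X) ^ n * p ∈ degreeLT ℝ (m + 2 * n) ↔ p ∈ degreeLT ℝ m := by
  rcases eq_or_ne p 0 with rfl | h0
  · simp
  rw [mem_degreeLT, mem_degreeLT, degree_mul, degree_X_pow_mul, degree_eq_natDegree h0]
  norm_cast
  omega

end

end G1Spline

namespace G1Spline

noncomputable section

/-! ### Syzygies and their twisted degrees -/

section Syzygies

variable {a b c : ℝ[X]} {r₁ r₂ : ℕ}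

theorem mem_syz {Z : Fin 3 → ℝ[X]} : Z ∈ syz a b c ↔ a * Z 0 + b * Z 1 + c * Z 2 = 0 := Iff.rfl

/-- The twists of the three components of a syzygy. -/
def twist (r₁ r₂ : ℕ) : Fin 3 → ℕ := ![r₁, 0, r₂]

theorem twistedDegreeLE_iff {Z : Fin 3 → ℝ[X]} {n : ℕ} :
    TwistedDegreeLE r₁ r₂ Z n ↔ ∀ i m, n + twist r₁ r₂ i ≤ m → (Z i).coeff m = 0 := by
  rw [TwistedDegreeLE, degree_lt_iff_coeff_zero, degree_lt_iff_coeff_zero,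
    degree_lt_iff_coeff_zero]
  simp [Fin.forall_fin_succ, twist]

theorem TwistedDegreeLE.mono {Z : Fin 3 → ℝ[X]} {n m : ℕ} (h : TwistedDegreeLE r₁ r₂ Z n)
    (hnm : n ≤ m) : TwistedDegreeLE r₁ r₂ Z m := by
  rw [twistedDegreeLE_iff] at h ⊢
  exact fun i l hl => h i l (by omega)

theorem exists_twistedDegreeLE (Z : Fin 3 → ℝ[X]) : ∃ n, TwistedDegreeLE r₁ r₂ Z n := by
  refine ⟨(Z 0).natDegree + (Z 1).natDegree + (Z 2).natDegree + 1, ?_⟩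
  rw [twistedDegreeLE_iff]
  intro i m hm
  apply coeff_eq_zero_of_natDegree_lt
  fin_cases i <;> simp at * <;> omega

theorem twistedDegreeLE_tdeg (Z : Fin 3 → ℝ[X]) :
    TwistedDegreeLE r₁ r₂ Z (tdeg r₁ r₂ Z) :=
  Nat.sInf_mem (s := {k | TwistedDegreeLE r₁ r₂ Z k}) (exists_twistedDegreeLE Z)

theorem tdeg_le {Z : Fin 3 → ℝ[X]} {n : ℕ} (h : TwistedDegreeLE r₁ r₂ Z n) :
    tdeg r₁ r₂ Z ≤ n := Nat.sInf_le h

/-- The vector of the coefficients in the top degrees allowed for twisted degree `n`. -/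
def levelVec (r₁ r₂ n : ℕ) : (Fin 3 → ℝ[X]) →ₗ[ℝ] (Fin 3 → ℝ) where
  toFun Z i := (Z i).coeff (n + twist r₁ r₂ i - 1)
  map_add' Z W := by ext i; simp
  map_smul' x Z := by ext i; simp

theorem levelVec_apply (n : ℕ) (Z : Fin 3 → ℝ[X]) (i : Fin 3) :
    levelVec r₁ r₂ n Z i = (Z i).coeff (n + twist r₁ r₂ i - 1) := rfl

theorem leadingVec_eq (Z : Fin 3 → ℝ[X]) :
    leadingVec r₁ r₂ Z = levelVec r₁ r₂ (tdeg r₁ r₂ Z) Z := by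
  ext i; fin_cases i <;> simp [leadingVec, levelVec_apply, twist]

theorem levelVec_eq_zero_of_lt {Z : Fin 3 → ℝ[X]} {n N : ℕ} (h : TwistedDegreeLE r₁ r₂ Z n)
    (hN : n < N) : levelVec r₁ r₂ N Z = 0 := by
  rw [twistedDegreeLE_iff] at h
  ext i
  exact h i _ (by omega)

theorem TwistedDegreeLE.of_levelVec_eq_zero {Z : Fin 3 → ℝ[X]} {n : ℕ}
    (h : TwistedDegreeLE r₁ r₂ Z (n + 1)) (h0 : levelVec r₁ r₂ (n + 1) Z = 0) :
    TwistedDegreeLE r₁ r₂ Z n := by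
  rw [twistedDegreeLE_iff] at h ⊢
  intro i m hm
  rcases Nat.lt_or_ge m (n + 1 + twist r₁ r₂ i) with h1 | h1
  · have h2 := congrFun h0 i
    rw [levelVec_apply, show n + 1 + twist r₁ r₂ i - 1 = m by omega] at h2
    exact h2
  · exact h i m h1

/-- In twisted degree 0 the middle component is zero and the outer ones are at most constants,
because the twists are at most 1. The level vector therefore sees everything; this is the bottom
case of degree reduction. -/
theorem eq_zero_of_levelVec_eq_zero (h₁ : r₁ ≤ 1) (h₂ : r₂ ≤ 1) {Z : Fin 3 → ℝ[X]}
    (h : TwistedDegreeLE r₁ r₂ Z 0) (h0 : levelVec r₁ r₂ 0 Z = 0) : Z = 0 := by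
  rw [twistedDegreeLE_iff] at h
  funext i
  ext m
  have ht : twist r₁ r₂ i ≤ 1 := by fin_cases i <;> simp [twist, h₁, h₂]
  rcases Nat.lt_or_ge m (twist r₁ r₂ i) with h1 | h1
  · have h2 := congrFun h0 i
    rw [levelVec_apply, show 0 + twist r₁ r₂ i - 1 = m by omega] at h2
    exact h2
  · exact h i m (by omega)

theorem TwistedDegreeLE.smul {Z : Fin 3 → ℝ[X]} {d N : ℕ} (h : TwistedDegreeLE r₁ r₂ Z d)
    {p : ℝ[X]} (hp : ∀ m, N < d + m → p.coeff m = 0) : TwistedDegreeLE r₁ r₂ (p • Z) N := by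
  rw [twistedDegreeLE_iff] at h ⊢
  intro i m hm
  rw [Pi.smul_apply, smul_eq_mul, coeff_mul]
  refine Finset.sum_eq_zero fun x hx => ?_
  rw [Finset.HasAntidiagonal.mem_antidiagonal] at hx
  rcases Nat.lt_or_ge N (d + x.1) with h1 | h1
  · rw [hp _ h1, zero_mul]
  · rw [h i x.2 (by omega), mul_zero]

theorem levelVec_smul {Z : Fin 3 → ℝ[X]} {d N : ℕ} (h : TwistedDegreeLE r₁ r₂ Z d)
    {p : ℝ[X]} (hp : ∀ m, N < d + m → p.coeff m = 0) (hN : d ≤ N) :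
    levelVec r₁ r₂ N (p • Z) = p.coeff (N - d) • levelVec r₁ r₂ d Z := by
  rw [twistedDegreeLE_iff] at h
  ext i
  rw [Pi.smul_apply, levelVec_apply, levelVec_apply, Pi.smul_apply, smul_eq_mul, smul_eq_mul]
  -- When `d + twist = 0` the subtraction of 1 is truncated and reads the coefficient in degree 0,
  -- but the component itself is then zero.
  rcases Nat.eq_zero_or_pos (d + twist r₁ r₂ i) with h1 | h1
  · have : Z i = 0 := by ext m; exact h i m (by omega)
    simp [this]
  · rw [show N + twist r₁ r₂ i - 1 = (N - d) + (d + twist r₁ r₂ i - 1) by omega]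
    apply coeff_mul_add_eq_of_natDegree_le
    · rw [natDegree_le_iff_coeff_eq_zero]; exact fun m hm => hp m (by omega)
    · rw [natDegree_le_iff_coeff_eq_zero]; exact fun m hm => h i m (by omega)

theorem TwistedDegreeLE.add {Z W : Fin 3 → ℝ[X]} {n : ℕ} (hZ : TwistedDegreeLE r₁ r₂ Z n)
    (hW : TwistedDegreeLE r₁ r₂ W n) : TwistedDegreeLE r₁ r₂ (Z + W) n := by
  rw [twistedDegreeLE_iff] at *
  intro i m hm
  rw [Pi.add_apply, coeff_add, hZ i m hm, hW i m hm, add_zero]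

theorem TwistedDegreeLE.const_smul {Z : Fin 3 → ℝ[X]} {n : ℕ} (hZ : TwistedDegreeLE r₁ r₂ Z n)
    (x : ℝ) : TwistedDegreeLE r₁ r₂ (x • Z) n := by
  rw [twistedDegreeLE_iff] at *
  intro i m hm
  rw [Pi.smul_apply, coeff_smul, hZ i m hm, smul_zero]

/-- Syzygies of twisted degree at most `n`. -/
def syzLE (a b c : ℝ[X]) (r₁ r₂ n : ℕ) : Submodule ℝ (Fin 3 → ℝ[X]) where
  carrier := {Z | Z ∈ syz a b c ∧ TwistedDegreeLE r₁ r₂ Z n}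
  zero_mem' := ⟨Submodule.zero_mem _, by rw [twistedDegreeLE_iff]; simp⟩
  add_mem' hZ hW := ⟨Submodule.add_mem _ hZ.1 hW.1, hZ.2.add hW.2⟩
  smul_mem' x Z hZ := by
    refine ⟨?_, hZ.2.const_smul x⟩
    have : x • Z = (C x : ℝ[X]) • Z := by ext i; simp
    rw [this]
    exact Submodule.smul_mem _ _ hZ.1

/-- The degree `δ` of the gluing data. -/
def gluingDegree (a b c : ℝ[X]) (r₁ r₂ : ℕ) : ℕ :=
  max (r₁ + a.natDegree) (max b.natDegree (r₂ + c.natDegree))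

/-- The top coefficients of the gluing data. -/
def topVec (a b c : ℝ[X]) (r₁ r₂ : ℕ) : Fin 3 → ℝ :=
  ![a.coeff (gluingDegree a b c r₁ r₂ - r₁), b.coeff (gluingDegree a b c r₁ r₂),
    c.coeff (gluingDegree a b c r₁ r₂ - r₂)]

/-- The maximum defining δ is attained. If neither a nor c attains it, then b does with strictly
larger degree, so b has positive degree and its leading coefficient appears. -/
theorem topVec_ne_zero (ha : a ≠ 0) (hc : c ≠ 0) : topVec a b c r₁ r₂ ≠ 0 := by
  intro h
  have h0 : a.coeff (gluingDegree a b c r₁ r₂ - r₁) = 0 := congrFun h 0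
  have h1 : b.coeff (gluingDegree a b c r₁ r₂) = 0 := congrFun h 1
  have h2 : c.coeff (gluingDegree a b c r₁ r₂ - r₂) = 0 := congrFun h 2
  have ha' : a.coeff a.natDegree ≠ 0 := leadingCoeff_ne_zero.2 ha
  have hc' : c.coeff c.natDegree ≠ 0 := leadingCoeff_ne_zero.2 hc
  have e0 : gluingDegree a b c r₁ r₂ - r₁ ≠ a.natDegree := fun e => ha' (e ▸ h0)
  have e2 : gluingDegree a b c r₁ r₂ - r₂ ≠ c.natDegree := fun e => hc' (e ▸ h2)
  have hmax : gluingDegree a b c r₁ r₂ = b.natDegree ∧ r₁ + a.natDegree < b.natDegree := by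
    unfold gluingDegree at *
    omega
  rw [hmax.1] at h1
  have : b = 0 := leadingCoeff_eq_zero.1 h1
  rw [this] at hmax
  simp at hmax

theorem coeff_mul_twist {p q : ℝ[X]} {D r n : ℕ} (hp : r + p.natDegree ≤ D)
    (hq : ∀ m, n + r ≤ m → q.coeff m = 0) :
    (p * q).coeff (D + n - 1) = p.coeff (D - r) * q.coeff (n + r - 1) := by
  rcases Nat.eq_zero_or_pos (n + r) with h1 | h1
  · have : q = 0 := by ext m; exact hq m (by omega)
    simp [this]
  · rw [show D + n - 1 = (D - r) + (n + r - 1) by omega]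
    apply coeff_mul_add_eq_of_natDegree_le
    · omega
    · rw [natDegree_le_iff_coeff_eq_zero]; exact fun m hm => hq m (by omega)

/-- This is the coefficient of aA + bB + cC in degree δ + n - 1, the highest that can occur. It
confines all level vectors to one fixed plane. -/
theorem topVec_dotProduct_levelVec {Z : Fin 3 → ℝ[X]} {n : ℕ} (hZ : Z ∈ syzLE a b c r₁ r₂ n) :
    topVec a b c r₁ r₂ ⬝ᵥ levelVec r₁ r₂ n Z = 0 := by
  obtain ⟨h, hd⟩ := hZ
  rw [twistedDegreeLE_iff] at hd
  have h1 := congrArg (fun p => p.coeff (gluingDegree a b c r₁ r₂ + n - 1)) (mem_syz.1 h)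
  simp only [coeff_add, coeff_zero] at h1
  rw [coeff_mul_twist (r := r₁) (by unfold gluingDegree; omega) (hd 0),
    coeff_mul_twist (r := 0) (by unfold gluingDegree; omega) (hd 1),
    coeff_mul_twist (r := r₂) (by unfold gluingDegree; omega) (hd 2)] at h1
  simpa [topVec, dotProduct, Fin.sum_univ_succ, levelVec_apply, twist, add_assoc] using h1

theorem mem_span_pair_of_dotProduct_eq_zero {u v w t : Fin 3 → ℝ} (ht : t ≠ 0)
    (huv : LinearIndependent ℝ ![u, v]) (hu : t ⬝ᵥ u = 0) (hv : t ⬝ᵥ v = 0) (hw : t ⬝ᵥ w = 0) :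
    ∃ x y : ℝ, w = x • u + y • v := by
  let φ : (Fin 3 → ℝ) →ₗ[ℝ] ℝ := dotProductBilin ℝ ℝ t
  have hφ : ∀ z, φ z = t ⬝ᵥ z := fun z => rfl
  have hsurj : Function.Surjective φ := by
    apply LinearMap.surjective
    intro h
    apply ht
    have := congrArg (fun f => f t) h
    simp only [hφ, LinearMap.zero_apply] at this
    exact dotProduct_self_eq_zero.1 this
  have hk : Module.finrank ℝ (LinearMap.ker φ) = 2 := by
    have := LinearMap.finrank_range_add_finrank_ker φ
    rw [LinearMap.range_eq_top.2 hsurj] at this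
    simp at this
    omega
  have hs : Module.finrank ℝ (Submodule.span ℝ (Set.range ![u, v])) = 2 := by
    rw [finrank_span_eq_card huv]; simp
  have hle : Submodule.span ℝ (Set.range ![u, v]) ≤ LinearMap.ker φ := by
    rw [Submodule.span_le]
    rintro _ ⟨i, rfl⟩
    fin_cases i
    · exact hu
    · exact hv
  have heq := Submodule.eq_of_le_of_finrank_eq hle (hs.trans hk.symm)
  have : w ∈ Submodule.span ℝ (Set.range ![u, v]) := by rw [heq]; exact hw
  rw [Matrix.range_cons, Matrix.range_cons, Matrix.range_empty, Set.union_empty,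
    Set.singleton_union, Submodule.mem_span_pair] at this
  obtain ⟨x, y, h⟩ := this
  exact ⟨x, y, h.symm⟩

theorem coeff_C_mul_X_pow_eq_zero (x : ℝ) (d N : ℕ) (hN : d ≤ N) (m : ℕ) (hm : N < d + m) :
    (C x * X ^ (N - d) : ℝ[X]).coeff m = 0 := by
  rw [coeff_C_mul_X_pow, if_neg (by omega)]

/-- `Z₁` is a nonzero syzygy of least twisted degree and `Z₂` one of least twisted degree outside
the multiples of `Z₁`. Minimality makes the leading vectors independent. They then span the plane
orthogonal to `topVec`, so the top part of any syzygy can be cancelled, and degree reduction shows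
that the pair generates. -/
theorem exists_isMinimalPair (h₁ : r₁ ≤ 1) (h₂ : r₂ ≤ 1) (ha : a ≠ 0) (hc : c ≠ 0) :
    ∃ Z₁ Z₂, IsMinimalPair a b c r₁ r₂ Z₁ Z₂ ∧ tdeg r₁ r₂ Z₁ ≤ tdeg r₁ r₂ Z₂ := by
  classical
  have hex1 : ∃ n, ∃ Z ∈ syzLE a b c r₁ r₂ n, Z ≠ 0 := by
    obtain ⟨n, hn⟩ := exists_twistedDegreeLE (r₁ := r₁) (r₂ := r₂) ![c, 0, -a]
    refine ⟨n, _, ⟨?_, hn⟩, fun h => hc (congrFun h 0)⟩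
    rw [mem_syz]; simp; ring
  obtain ⟨Z₁, hZ₁, hZ₁0⟩ := Nat.find_spec hex1
  have hmin1 : ∀ m < Nat.find hex1, ∀ Z ∈ syzLE a b c r₁ r₂ m, Z = 0 := by
    intro m hm Z hZ
    by_contra h0
    exact Nat.find_min hex1 hm ⟨Z, hZ, h0⟩
  set d₁ := Nat.find hex1
  -- One generator is not enough: if (c, 0, -a) and (b, -a, 0) were multiples of `Z₁`, the first
  -- would force the middle entry of `Z₁` to vanish and the second would then give a = 0.
  have hex2 : ∃ n, ∃ Z ∈ syzLE a b c r₁ r₂ n, Z ∉ Submodule.span ℝ[X] {Z₁} := by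
    by_contra! hcon
    have hall : ∀ Z ∈ syz a b c, ∃ p : ℝ[X], p • Z₁ = Z := by
      intro Z hZ
      obtain ⟨n, hn⟩ := exists_twistedDegreeLE (r₁ := r₁) (r₂ := r₂) Z
      exact Submodule.mem_span_singleton.1 (hcon n Z ⟨hZ, hn⟩)
    obtain ⟨p, hp⟩ := hall ![c, 0, -a] (by rw [mem_syz]; simp; ring)
    obtain ⟨q, hq⟩ := hall ![b, -a, 0] (by rw [mem_syz]; simp; ring)
    have e1 : p * Z₁ 0 = c := congrFun hp 0
    have e2 : p * Z₁ 1 = 0 := congrFun hp 1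
    have e3 : q * Z₁ 1 = -a := congrFun hq 1
    rcases mul_eq_zero.1 e2 with h | h
    · rw [h, zero_mul] at e1; exact hc e1.symm
    · rw [h, mul_zero] at e3; exact ha (neg_eq_zero.1 e3.symm)
  obtain ⟨Z₂, hZ₂, hZ₂s⟩ := Nat.find_spec hex2
  have hmin2 : ∀ m < Nat.find hex2, ∀ Z ∈ syzLE a b c r₁ r₂ m,
      Z ∈ Submodule.span ℝ[X] {Z₁} := by
    intro m hm Z hZ
    by_contra h0
    exact Nat.find_min hex2 hm ⟨Z, hZ, h0⟩
  set d₂ := Nat.find hex2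
  have hZ₂0 : Z₂ ≠ 0 := fun h => hZ₂s (h ▸ Submodule.zero_mem _)
  have hd12 : d₁ ≤ d₂ := by
    by_contra! hlt
    exact hZ₂0 (hmin1 _ hlt Z₂ hZ₂)
  have ht1 : tdeg r₁ r₂ Z₁ = d₁ := by
    apply le_antisymm (tdeg_le hZ₁.2)
    by_contra! hlt
    exact hZ₁0 (hmin1 _ hlt Z₁ ⟨hZ₁.1, twistedDegreeLE_tdeg Z₁⟩)
  have ht2 : tdeg r₁ r₂ Z₂ = d₂ := by
    apply le_antisymm (tdeg_le hZ₂.2)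
    by_contra! hlt
    exact hZ₂s (hmin2 _ hlt Z₂ ⟨hZ₂.1, twistedDegreeLE_tdeg Z₂⟩)
  have hlv1 : levelVec r₁ r₂ d₁ Z₁ ≠ 0 := by
    intro h0
    rcases Nat.eq_zero_or_pos d₁ with hd | hd
    · rw [hd] at h0 hZ₁
      exact hZ₁0 (eq_zero_of_levelVec_eq_zero h₁ h₂ hZ₁.2 h0)
    · obtain ⟨e, he⟩ : ∃ e, d₁ = e + 1 := ⟨d₁ - 1, by omega⟩
      rw [he] at h0 hZ₁
      exact hZ₁0 (hmin1 e (by omega) Z₁ ⟨hZ₁.1, hZ₁.2.of_levelVec_eq_zero h0⟩)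
  have hlin : LinearIndependent ℝ ![levelVec r₁ r₂ d₁ Z₁, levelVec r₁ r₂ d₂ Z₂] := by
    rw [LinearIndependent.pair_iff' hlv1]
    intro x hx
    -- If the leading vector of `Z₂` were a multiple of that of `Z₁`, subtracting a shifted multiple
    -- of `Z₁` would lower the degree of `Z₂` without moving it into the span of `Z₁`, against the
    -- choice of `d₂`.
    have hW : Z₂ + (C (-x) * X ^ (d₂ - d₁) : ℝ[X]) • Z₁ ∈ syzLE a b c r₁ r₂ d₂ :=
      Submodule.add_mem _ hZ₂ ⟨Submodule.smul_mem _ _ hZ₁.1,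
        hZ₁.2.smul (coeff_C_mul_X_pow_eq_zero _ _ _ hd12)⟩
    have hWs : Z₂ + (C (-x) * X ^ (d₂ - d₁) : ℝ[X]) • Z₁ ∉ Submodule.span ℝ[X] {Z₁} := by
      intro h
      refine hZ₂s ((Submodule.add_mem_iff_left _ ?_).1 h)
      exact Submodule.smul_mem _ _ (Submodule.mem_span_singleton_self _)
    have hl : levelVec r₁ r₂ d₂ (Z₂ + (C (-x) * X ^ (d₂ - d₁) : ℝ[X]) • Z₁) = 0 := by
      rw [map_add, levelVec_smul hZ₁.2 (coeff_C_mul_X_pow_eq_zero _ _ _ hd12) hd12, ← hx,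
        coeff_C_mul_X_pow, if_pos rfl, ← add_smul, add_neg_cancel, zero_smul]
    rcases Nat.eq_zero_or_pos d₂ with hd | hd
    · rw [hd] at hl hW
      rw [hd] at hWs
      exact hWs (eq_zero_of_levelVec_eq_zero h₁ h₂ hW.2 hl ▸ Submodule.zero_mem _)
    · obtain ⟨e, he⟩ : ∃ e, d₂ = e + 1 := ⟨d₂ - 1, by omega⟩
      rw [he] at hl hW
      rw [he] at hWs
      exact hWs (hmin2 e (by omega) _ ⟨hW.1, hW.2.of_levelVec_eq_zero hl⟩)
  refine ⟨Z₁, Z₂, ⟨?_, ?_⟩, ?_⟩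
  · apply le_antisymm
    · rw [Submodule.span_le]
      rintro _ (rfl | rfl)
      · exact hZ₁.1
      · exact hZ₂.1
    · have hmem1 : Z₁ ∈ Submodule.span ℝ[X] {Z₁, Z₂} := Submodule.subset_span (by simp)
      have hmem2 : Z₂ ∈ Submodule.span ℝ[X] {Z₁, Z₂} := Submodule.subset_span (by simp)
      -- Induction on the degree. Below `d₂` membership is the minimality of `d₂`; from `d₂` on,
      -- power multiples of both generators cancel the level vector.
      have key : ∀ n, ∀ Z ∈ syzLE a b c r₁ r₂ n, Z ∈ Submodule.span ℝ[X] {Z₁, Z₂} := by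
        intro n
        induction n with
        | zero =>
          intro Z hZ
          rcases Nat.lt_or_ge 0 d₂ with hd | hd
          · exact Submodule.span_mono (by simp) (hmin2 _ hd Z hZ)
          · obtain ⟨x, y, hxy⟩ := mem_span_pair_of_dotProduct_eq_zero (topVec_ne_zero ha hc) hlin
              (topVec_dotProduct_levelVec hZ₁) (topVec_dotProduct_levelVec hZ₂)
              (topVec_dotProduct_levelVec hZ)
            have hd1 : d₁ = 0 := by omega
            have hd2 : d₂ = 0 := by omega
            rw [hd1] at hZ₁ hxy
            rw [hd2] at hZ₂ hxy
            have hW : Z - (x • Z₁ + y • Z₂) ∈ syzLE a b c r₁ r₂ 0 :=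
              Submodule.sub_mem _ hZ (Submodule.add_mem _ (Submodule.smul_mem _ _ hZ₁)
                (Submodule.smul_mem _ _ hZ₂))
            have h0 := eq_zero_of_levelVec_eq_zero h₁ h₂ hW.2 (by simp [hxy])
            rw [sub_eq_zero.1 h0, show x • Z₁ = (C x : ℝ[X]) • Z₁ by ext i; simp,
              show y • Z₂ = (C y : ℝ[X]) • Z₂ by ext i; simp]
            exact Submodule.add_mem _ (Submodule.smul_mem _ _ hmem1)
              (Submodule.smul_mem _ _ hmem2)
        | succ n ih =>
          intro Z hZ
          rcases Nat.lt_or_ge (n + 1) d₂ with hd | hd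
          · exact Submodule.span_mono (by simp) (hmin2 _ hd Z hZ)
          · obtain ⟨x, y, hxy⟩ := mem_span_pair_of_dotProduct_eq_zero (topVec_ne_zero ha hc) hlin
              (topVec_dotProduct_levelVec hZ₁) (topVec_dotProduct_levelVec hZ₂)
              (topVec_dotProduct_levelVec hZ)
            have hd1 : d₁ ≤ n + 1 := by omega
            have hW1 : (C x * X ^ (n + 1 - d₁) : ℝ[X]) • Z₁ ∈ syzLE a b c r₁ r₂ (n + 1) :=
              ⟨Submodule.smul_mem _ _ hZ₁.1,
                hZ₁.2.smul (coeff_C_mul_X_pow_eq_zero _ _ _ hd1)⟩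
            have hW2 : (C y * X ^ (n + 1 - d₂) : ℝ[X]) • Z₂ ∈ syzLE a b c r₁ r₂ (n + 1) :=
              ⟨Submodule.smul_mem _ _ hZ₂.1,
                hZ₂.2.smul (coeff_C_mul_X_pow_eq_zero _ _ _ hd)⟩
            have hW := Submodule.sub_mem _ hZ (Submodule.add_mem _ hW1 hW2)
            have h0 : levelVec r₁ r₂ (n + 1) (Z - ((C x * X ^ (n + 1 - d₁) : ℝ[X]) • Z₁ +
                (C y * X ^ (n + 1 - d₂) : ℝ[X]) • Z₂)) = 0 := by
              rw [map_sub, map_add, levelVec_smul hZ₁.2 (coeff_C_mul_X_pow_eq_zero _ _ _ hd1) hd1,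
                levelVec_smul hZ₂.2 (coeff_C_mul_X_pow_eq_zero _ _ _ hd) hd, hxy]
              simp
            have := ih _ ⟨hW.1, hW.2.of_levelVec_eq_zero h0⟩
            refine (Submodule.sub_mem_iff_left _ ?_).1 this
            exact Submodule.add_mem _ (Submodule.smul_mem _ _ hmem1)
              (Submodule.smul_mem _ _ hmem2)
      intro Z hZ
      obtain ⟨n, hn⟩ := exists_twistedDegreeLE (r₁ := r₁) (r₂ := r₂) Z
      exact key n Z ⟨hZ, hn⟩
  · rw [leadingVec_eq, leadingVec_eq, ht1, ht2]
    exact hlin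
  · rw [ht1, ht2]
    exact hd12

end Syzygies

end

end G1Spline

namespace G1Spline

noncomputable section

/-! ### Minimal pairs of syzygies: freeness, degrees and interpolation -/

section MinimalPair

variable {a b c : ℝ[X]} {r₁ r₂ : ℕ} {Z₁ Z₂ : Fin 3 → ℝ[X]}

theorem linearIndependent_pair_of_cross_ne_zero {u v : Fin 3 → ℝ} {i j : Fin 3}
    (h : u i * v j - u j * v i ≠ 0) : LinearIndependent ℝ ![u, v] := by
  rw [LinearIndependent.pair_iff]
  intro s t hst
  have h1 : s * u i + t * v i = 0 := congrFun hst i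
  have h2 : s * u j + t * v j = 0 := congrFun hst j
  constructor
  · refine (mul_eq_zero.1 (?_ : s * (u i * v j - u j * v i) = 0)).resolve_right h
    linear_combination v j * h1 - v i * h2
  · refine (mul_eq_zero.1 (?_ : t * (u i * v j - u j * v i) = 0)).resolve_right h
    linear_combination u i * h2 - u j * h1

theorem exists_cross_ne_zero {u v : Fin 3 → ℝ} (h : LinearIndependent ℝ ![u, v]) :
    u 1 * v 2 - u 2 * v 1 ≠ 0 ∨ u 2 * v 0 - u 0 * v 2 ≠ 0 ∨ u 0 * v 1 - u 1 * v 0 ≠ 0 := by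
  by_contra! hcon
  obtain ⟨h0, h1, h2⟩ := hcon
  rw [LinearIndependent.pair_iff] at h
  by_cases hu : u = 0
  · have := (h 1 0 (by simp [hu])).1
    exact one_ne_zero this
  · obtain ⟨i, hi⟩ := Function.ne_iff.1 hu
    have := (h (v i) (-(u i)) (by
      ext j
      simp only [Pi.add_apply, Pi.smul_apply, smul_eq_mul, Pi.zero_apply]
      fin_cases i <;> fin_cases j <;> simp <;> linarith)).2
    exact hi (neg_eq_zero.1 this)

theorem exists_smul_add_smul_of_mem_syz (h : IsMinimalPair a b c r₁ r₂ Z₁ Z₂) {Z : Fin 3 → ℝ[X]}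
    (hZ : Z ∈ syz a b c) : ∃ p q : ℝ[X], Z = p • Z₁ + q • Z₂ := by
  rw [← h.1, Submodule.mem_span_pair] at hZ
  obtain ⟨p, q, hpq⟩ := hZ
  exact ⟨p, q, hpq.symm⟩

theorem IsMinimalPair.mem_left (h : IsMinimalPair a b c r₁ r₂ Z₁ Z₂) : Z₁ ∈ syz a b c := by
  rw [← h.1]; exact Submodule.subset_span (by simp)

theorem IsMinimalPair.mem_right (h : IsMinimalPair a b c r₁ r₂ Z₁ Z₂) : Z₂ ∈ syz a b c := by
  rw [← h.1]; exact Submodule.subset_span (by simp)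

/-- Independent leading vectors exclude cancellation of top terms, so the degree of a combination
bounds the degrees of its two summands separately. -/
theorem IsMinimalPair.coeff_eq_zero (h : IsMinimalPair a b c r₁ r₂ Z₁ Z₂) {p q : ℝ[X]} {n : ℕ}
    (hn : TwistedDegreeLE r₁ r₂ (p • Z₁ + q • Z₂) n) :
    (∀ m, n < tdeg r₁ r₂ Z₁ + m → p.coeff m = 0) ∧
      (∀ m, n < tdeg r₁ r₂ Z₂ + m → q.coeff m = 0) := by
  have hlin := h.2
  rw [leadingVec_eq, leadingVec_eq, LinearIndependent.pair_iff] at hlin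
  set d₁ := tdeg r₁ r₂ Z₁ with hd₁
  set d₂ := tdeg r₁ r₂ Z₂ with hd₂
  have hZ₁ : TwistedDegreeLE r₁ r₂ Z₁ d₁ := twistedDegreeLE_tdeg Z₁
  have hZ₂ : TwistedDegreeLE r₁ r₂ Z₂ d₂ := twistedDegreeLE_tdeg Z₂
  -- Descending induction from a bound beyond all degrees. As long as N + 1 > n, the level vector of
  -- the combination in degree N + 1 is zero, and independence kills the top coefficients of p and
  -- q.
  have key : ∀ N, n ≤ N → N ≤ n + d₁ + d₂ + p.natDegree + q.natDegree →
      (∀ m, N < d₁ + m → p.coeff m = 0) ∧ (∀ m, N < d₂ + m → q.coeff m = 0) := by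
    intro N hN hN'
    induction hN' using Nat.decreasingInduction with
    | self =>
      exact ⟨fun m hm => coeff_eq_zero_of_natDegree_lt (by omega),
        fun m hm => coeff_eq_zero_of_natDegree_lt (by omega)⟩
    | of_succ N hlt ih =>
      obtain ⟨hp, hq⟩ := ih (by omega)
      have h0 := levelVec_eq_zero_of_lt hn (show n < N + 1 by omega)
      have e1 : ∃ x : ℝ, levelVec r₁ r₂ (N + 1) (p • Z₁) = x • levelVec r₁ r₂ d₁ Z₁ ∧
          (x = 0 → ∀ m, N < d₁ + m → p.coeff m = 0) := by
        rcases Nat.lt_or_ge (N + 1) d₁ with hd | hd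
        · refine ⟨0, ?_, fun _ m hm => hp m (by omega)⟩
          have : p = 0 := by ext m; exact hp m (by omega)
          rw [this, zero_smul, map_zero, zero_smul]
        · refine ⟨_, levelVec_smul hZ₁ hp hd, fun hx m hm => ?_⟩
          rcases Nat.lt_or_ge (N + 1) (d₁ + m) with hm' | hm'
          · exact hp m hm'
          · rwa [show m = N + 1 - d₁ by omega]
      have e2 : ∃ x : ℝ, levelVec r₁ r₂ (N + 1) (q • Z₂) = x • levelVec r₁ r₂ d₂ Z₂ ∧
          (x = 0 → ∀ m, N < d₂ + m → q.coeff m = 0) := by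
        rcases Nat.lt_or_ge (N + 1) d₂ with hd | hd
        · refine ⟨0, ?_, fun _ m hm => hq m (by omega)⟩
          have : q = 0 := by ext m; exact hq m (by omega)
          rw [this, zero_smul, map_zero, zero_smul]
        · refine ⟨_, levelVec_smul hZ₂ hq hd, fun hx m hm => ?_⟩
          rcases Nat.lt_or_ge (N + 1) (d₂ + m) with hm' | hm'
          · exact hq m hm'
          · rwa [show m = N + 1 - d₂ by omega]
      obtain ⟨x, hx, hx0⟩ := e1
      obtain ⟨y, hy, hy0⟩ := e2
      rw [map_add, hx, hy] at h0
      obtain ⟨rfl, rfl⟩ := hlin x y h0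
      exact ⟨hx0 rfl, hy0 rfl⟩
  exact key n le_rfl (by omega)

theorem exists_bezout (hcop : ∀ p : ℝ[X], p ∣ a → p ∣ b → p ∣ c → IsUnit p) :
    ∃ x y z : ℝ[X], x * a + y * b + z * c = 1 := by
  have h : IsUnit (gcd a (gcd b c)) := hcop _ (gcd_dvd_left _ _)
    ((gcd_dvd_right _ _).trans (gcd_dvd_left _ _)) ((gcd_dvd_right _ _).trans (gcd_dvd_right _ _))
  obtain ⟨y, z, h1⟩ := exists_gcd_eq_mul_add_mul b c
  obtain ⟨x, w, h2⟩ := exists_gcd_eq_mul_add_mul a (gcd b c)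
  obtain ⟨u, hu⟩ := h
  refine ⟨↑u⁻¹ * x, ↑u⁻¹ * w * y, ↑u⁻¹ * w * z, ?_⟩
  have h3 : (↑u⁻¹ : ℝ[X]) * u = 1 := u.inv_mul
  rw [hu, h2, h1] at *
  rw [hu] at h3
  linear_combination h3

/-- The cross product of a minimal pair is a constant multiple of the gluing data. -/
theorem IsMinimalPair.cross (h : IsMinimalPair a b c r₁ r₂ Z₁ Z₂) (ha : a ≠ 0)
    (hcop : ∀ p : ℝ[X], p ∣ a → p ∣ b → p ∣ c → IsUnit p) : ∃ x : ℝ, x ≠ 0 ∧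
      Z₁ 1 * Z₂ 2 - Z₁ 2 * Z₂ 1 = C x * a ∧ Z₁ 2 * Z₂ 0 - Z₁ 0 * Z₂ 2 = C x * b ∧
      Z₁ 0 * Z₂ 1 - Z₁ 1 * Z₂ 0 = C x * c := by
  obtain ⟨x, y, z, hxyz⟩ := exists_bezout hcop
  have hm1 := mem_syz.1 h.mem_left
  have hm2 := mem_syz.1 h.mem_right
  set X₀ := Z₁ 1 * Z₂ 2 - Z₁ 2 * Z₂ 1 with hX₀
  set X₁ := Z₁ 2 * Z₂ 0 - Z₁ 0 * Z₂ 2 with hX₁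
  set X₂ := Z₁ 0 * Z₂ 1 - Z₁ 1 * Z₂ 0 with hX₂
  -- The cross product and (a, b, c) are both orthogonal to `Z₁` and `Z₂`, hence proportional.
  -- Bézout coefficients for a, b, c turn this into a factor g with cross product g · (a, b, c).
  have e01 : a * X₁ = b * X₀ := by linear_combination Z₁ 2 * hm2 - Z₂ 2 * hm1
  have e02 : a * X₂ = c * X₀ := by linear_combination Z₂ 1 * hm1 - Z₁ 1 * hm2
  have e12 : b * X₂ = c * X₁ := by linear_combination Z₁ 0 * hm2 - Z₂ 0 * hm1
  set g := x * X₀ + y * X₁ + z * X₂ with hg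
  have g0 : X₀ = g * a := by linear_combination (-X₀) * hxyz - y * e01 - z * e02
  have g1 : X₁ = g * b := by linear_combination (-X₁) * hxyz + x * e01 - z * e12
  have g2 : X₂ = g * c := by linear_combination (-X₂) * hxyz + x * e02 + y * e12
  -- The Koszul syzygies are combinations of the generators, so their 2 × 2 minors are multiples of
  -- the minor `X₀ = g * a`. Those minors are a times c, a and b; hence g divides all three and is a
  -- unit.
  obtain ⟨p₁, q₁, k1⟩ := exists_smul_add_smul_of_mem_syz h (Z := ![0, c, -b])
    (by rw [mem_syz]; simp; ring)
  obtain ⟨p₂, q₂, k2⟩ := exists_smul_add_smul_of_mem_syz h (Z := ![-c, 0, a])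
    (by rw [mem_syz]; simp; ring)
  obtain ⟨p₃, q₃, k3⟩ := exists_smul_add_smul_of_mem_syz h (Z := ![b, -a, 0])
    (by rw [mem_syz]; simp; ring)
  have k11 : c = p₁ * Z₁ 1 + q₁ * Z₂ 1 := congrFun k1 1
  have k12 : -b = p₁ * Z₁ 2 + q₁ * Z₂ 2 := congrFun k1 2
  have k21 : 0 = p₂ * Z₁ 1 + q₂ * Z₂ 1 := congrFun k2 1
  have k22 : a = p₂ * Z₁ 2 + q₂ * Z₂ 2 := congrFun k2 2
  have k31 : -a = p₃ * Z₁ 1 + q₃ * Z₂ 1 := congrFun k3 1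
  have k32 : 0 = p₃ * Z₁ 2 + q₃ * Z₂ 2 := congrFun k3 2
  have dc : g ∣ c := by
    refine ⟨p₁ * q₂ - q₁ * p₂, mul_left_cancel₀ ha ?_⟩
    have : c * a - (-b) * 0 = (p₁ * q₂ - q₁ * p₂) * X₀ := by
      rw [k11, k12, k22, k21, hX₀]; ring
    rw [g0] at this
    linear_combination this
  have da : g ∣ a := by
    refine ⟨p₂ * q₃ - q₂ * p₃, mul_left_cancel₀ ha ?_⟩
    have : 0 * 0 - a * (-a) = (p₂ * q₃ - q₂ * p₃) * X₀ := by
      rw [k31]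
      conv_lhs => rw [k22]
      linear_combination (p₂ * Z₁ 1 + q₂ * Z₂ 1) * k32
    rw [g0] at this
    linear_combination this
  have db : g ∣ b := by
    refine ⟨p₃ * q₁ - q₃ * p₁, mul_left_cancel₀ ha ?_⟩
    have : (-a) * (-b) - 0 * c = (p₃ * q₁ - q₃ * p₁) * X₀ := by
      rw [k31, k12, hX₀]
      linear_combination (-c) * k32 - (p₃ * Z₁ 2 + q₃ * Z₂ 2) * k11
    rw [g0] at this
    linear_combination this
  obtain ⟨s, hs, hsg⟩ := Polynomial.isUnit_iff.1 (hcop g da db dc)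
  rw [← hsg] at g0 g1 g2
  exact ⟨s, hs.ne_zero, g0, g1, g2⟩

/-- Freeness by Cramer's rule: the minor from the last two components is a nonzero multiple of a. -/
theorem IsMinimalPair.eq_zero (h : IsMinimalPair a b c r₁ r₂ Z₁ Z₂) (ha : a ≠ 0)
    (hcop : ∀ p : ℝ[X], p ∣ a → p ∣ b → p ∣ c → IsUnit p) {p q : ℝ[X]}
    (hpq : p • Z₁ + q • Z₂ = 0) : p = 0 ∧ q = 0 := by
  obtain ⟨x, hx, h0, -, -⟩ := h.cross ha hcop
  have hne : C x * a ≠ 0 := mul_ne_zero (C_ne_zero.2 hx) ha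
  have e1 : p * Z₁ 1 + q * Z₂ 1 = 0 := congrFun hpq 1
  have e2 : p * Z₁ 2 + q * Z₂ 2 = 0 := congrFun hpq 2
  constructor
  · refine (mul_eq_zero.1 (?_ : p * (C x * a) = 0)).resolve_right hne
    rw [← h0]; linear_combination Z₂ 2 * e1 - Z₂ 1 * e2
  · refine (mul_eq_zero.1 (?_ : q * (C x * a) = 0)).resolve_right hne
    rw [← h0]; linear_combination Z₁ 1 * e2 - Z₁ 2 * e1

theorem coeff_mul_top {p q : ℝ[X]} {n m : ℕ} (hp : ∀ i, n ≤ i → p.coeff i = 0)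
    (hq : ∀ i, m ≤ i → q.coeff i = 0) :
    (p * q).coeff (n + m - 2) = p.coeff (n - 1) * q.coeff (m - 1) := by
  rcases Nat.eq_zero_or_pos n with rfl | hn
  · have : p = 0 := by ext i; exact hp i (by omega)
    simp [this]
  rcases Nat.eq_zero_or_pos m with rfl | hm
  · have : q = 0 := by ext i; exact hq i (by omega)
    simp [this]
  rw [show n + m - 2 = (n - 1) + (m - 1) by omega]
  apply coeff_mul_add_eq_of_natDegree_le
  · rw [natDegree_le_iff_coeff_eq_zero]; exact fun i hi => hp i (by omega)
  · rw [natDegree_le_iff_coeff_eq_zero]; exact fun i hi => hq i (by omega)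

theorem coeff_mul_above {p q : ℝ[X]} {n m l : ℕ} (hp : ∀ i, n ≤ i → p.coeff i = 0)
    (hq : ∀ i, m ≤ i → q.coeff i = 0) (hl : n + m ≤ l + 1) : (p * q).coeff l = 0 := by
  rw [coeff_mul]
  refine Finset.sum_eq_zero fun x hx => ?_
  rw [Finset.HasAntidiagonal.mem_antidiagonal] at hx
  rcases Nat.lt_or_ge x.1 n with h1 | h1
  · rw [hq x.2 (by omega), mul_zero]
  · rw [hp x.1 h1, zero_mul]

/-- Degrees are compared in the cross product of the pair, which is a constant times (a, b, c). Its
components obey the degree bounds inherited from the factors, which gives one inequality.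
Independence of the leading vectors makes one of their minors nonzero, so one bound is attained,
which gives the other. -/
theorem IsMinimalPair.tdeg_add_tdeg (h : IsMinimalPair a b c r₁ r₂ Z₁ Z₂) (ha : a ≠ 0) (hc : c ≠ 0)
    (hcop : ∀ p : ℝ[X], p ∣ a → p ∣ b → p ∣ c → IsUnit p) :
    tdeg r₁ r₂ Z₁ + tdeg r₁ r₂ Z₂ + r₁ + r₂ = gluingDegree a b c r₁ r₂ + 2 := by
  obtain ⟨x, hx, h0, h1, h2⟩ := h.cross ha hcop
  have hlin := h.2
  rw [leadingVec_eq, leadingVec_eq] at hlin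
  have hZ₁ := twistedDegreeLE_iff.1 (twistedDegreeLE_tdeg (r₁ := r₁) (r₂ := r₂) Z₁)
  have hZ₂ := twistedDegreeLE_iff.1 (twistedDegreeLE_tdeg (r₁ := r₁) (r₂ := r₂) Z₂)
  set d₁ := tdeg r₁ r₂ Z₁
  set d₂ := tdeg r₁ r₂ Z₂
  have top : ∀ i j : Fin 3, (Z₁ i * Z₂ j - Z₁ j * Z₂ i).coeff
      (d₁ + d₂ + twist r₁ r₂ i + twist r₁ r₂ j - 2) =
      levelVec r₁ r₂ d₁ Z₁ i * levelVec r₁ r₂ d₂ Z₂ j -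
        levelVec r₁ r₂ d₁ Z₁ j * levelVec r₁ r₂ d₂ Z₂ i := by
    intro i j
    rw [coeff_sub]
    congr 1
    · rw [show d₁ + d₂ + twist r₁ r₂ i + twist r₁ r₂ j - 2 =
        (d₁ + twist r₁ r₂ i) + (d₂ + twist r₁ r₂ j) - 2 by omega]
      exact coeff_mul_top (hZ₁ i) (hZ₂ j)
    · rw [show d₁ + d₂ + twist r₁ r₂ i + twist r₁ r₂ j - 2 =
        (d₁ + twist r₁ r₂ j) + (d₂ + twist r₁ r₂ i) - 2 by omega]
      exact coeff_mul_top (hZ₁ j) (hZ₂ i)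
  have above : ∀ (i j : Fin 3) (l : ℕ), d₁ + d₂ + twist r₁ r₂ i + twist r₁ r₂ j ≤ l + 1 →
      (Z₁ i * Z₂ j - Z₁ j * Z₂ i).coeff l = 0 := by
    intro i j l hl
    rw [coeff_sub, coeff_mul_above (hZ₁ i) (hZ₂ j) (by omega),
      coeff_mul_above (hZ₁ j) (hZ₂ i) (by omega), sub_zero]
  have t12 := top 1 2
  have t20 := top 2 0
  have t01 := top 0 1
  have a12 := above 1 2
  have a20 := above 2 0
  have a01 := above 0 1
  simp only [h0, h1, h2, coeff_C_mul, twist, Matrix.cons_val_zero, Matrix.cons_val_one,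
    Matrix.cons_val, mul_eq_zero, hx, false_or] at t12 t20 t01 a12 a20 a01
  have ha' : a.coeff a.natDegree ≠ 0 := leadingCoeff_ne_zero.2 ha
  have hc' : c.coeff c.natDegree ≠ 0 := leadingCoeff_ne_zero.2 hc
  have ua : a.natDegree + 2 ≤ d₁ + d₂ + r₂ := by
    by_contra! hlt
    exact ha' (a12 _ (by omega))
  have uc : c.natDegree + 2 ≤ d₁ + d₂ + r₁ := by
    by_contra! hlt
    exact hc' (a01 _ (by omega))
  have ub : b.natDegree + 2 ≤ d₁ + d₂ + r₁ + r₂ := by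
    by_contra! hlt
    rcases eq_or_ne b 0 with hb | hb
    · simp [hb] at hlt; omega
    · exact leadingCoeff_ne_zero.2 hb (a20 _ (by omega))
  have low : d₁ + d₂ + r₁ + r₂ ≤ gluingDegree a b c r₁ r₂ + 2 := by
    unfold gluingDegree
    rcases exists_cross_ne_zero hlin with hne | hne | hne
    · rw [← t12] at hne
      have := le_natDegree_of_ne_zero (right_ne_zero_of_mul hne)
      omega
    · rw [← t20] at hne
      have := le_natDegree_of_ne_zero (right_ne_zero_of_mul hne)
      omega
    · rw [← t01] at hne
      have := le_natDegree_of_ne_zero (right_ne_zero_of_mul hne)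
      omega
  unfold gluingDegree at *
  omega

theorem mem_degreeLT_sub_iff {p : ℝ[X]} {n d : ℕ} :
    p ∈ degreeLT ℝ (n + 1 - d) ↔ ∀ m, n < d + m → p.coeff m = 0 := by
  rw [mem_degreeLT, degree_lt_iff_coeff_zero]
  exact forall_congr' fun m => by
    constructor <;> intro h hm <;> exact h (by omega)

/-- The combinations of `Z₁`, `Z₂` with bounded coefficients. -/
def combination (Z₁ Z₂ : Fin 3 → ℝ[X]) (m₁ m₂ : ℕ) :
    (degreeLT ℝ m₁ × degreeLT ℝ m₂) →ₗ[ℝ] (Fin 3 → ℝ[X]) where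
  toFun x := (x.1 : ℝ[X]) • Z₁ + (x.2 : ℝ[X]) • Z₂
  map_add' x y := by simp [add_smul]; abel
  map_smul' s x := by simp

theorem IsMinimalPair.range_combination (h : IsMinimalPair a b c r₁ r₂ Z₁ Z₂) (n : ℕ) :
    LinearMap.range (combination Z₁ Z₂ (n + 1 - tdeg r₁ r₂ Z₁) (n + 1 - tdeg r₁ r₂ Z₂)) =
      syzLE a b c r₁ r₂ n := by
  ext Z
  constructor
  · rintro ⟨⟨p, q⟩, rfl⟩
    refine Submodule.add_mem _ ⟨Submodule.smul_mem _ _ h.mem_left, ?_⟩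
      ⟨Submodule.smul_mem _ _ h.mem_right, ?_⟩
    · exact (twistedDegreeLE_tdeg Z₁).smul (mem_degreeLT_sub_iff.1 p.2)
    · exact (twistedDegreeLE_tdeg Z₂).smul (mem_degreeLT_sub_iff.1 q.2)
  · rintro ⟨hZ, hn⟩
    obtain ⟨p, q, rfl⟩ := exists_smul_add_smul_of_mem_syz h hZ
    obtain ⟨hp, hq⟩ := h.coeff_eq_zero hn
    exact ⟨(⟨p, mem_degreeLT_sub_iff.2 hp⟩, ⟨q, mem_degreeLT_sub_iff.2 hq⟩), rfl⟩

theorem IsMinimalPair.finite_syzLE (h : IsMinimalPair a b c r₁ r₂ Z₁ Z₂) (n : ℕ) :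
    Module.Finite ℝ (syzLE a b c r₁ r₂ n) := by
  rw [← h.range_combination]; infer_instance

theorem IsMinimalPair.finrank_syzLE (h : IsMinimalPair a b c r₁ r₂ Z₁ Z₂) (ha : a ≠ 0)
    (hcop : ∀ p : ℝ[X], p ∣ a → p ∣ b → p ∣ c → IsUnit p) (n : ℕ) :
    Module.finrank ℝ (syzLE a b c r₁ r₂ n) =
      (n + 1 - tdeg r₁ r₂ Z₁) + (n + 1 - tdeg r₁ r₂ Z₂) := by
  rw [← h.range_combination, LinearMap.finrank_range_of_inj, Module.finrank_prod,
    finrank_degreeLT, finrank_degreeLT]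
  rw [← LinearMap.ker_eq_bot, LinearMap.ker_eq_bot']
  rintro ⟨p, q⟩ hpq
  obtain ⟨hp, hq⟩ := h.eq_zero ha hcop (p := p) (q := q) hpq
  ext1
  · exact Subtype.ext hp
  · exact Subtype.ext hq

/-- In twisted degree 0 the middle component is zero; if this held for both generators, the cross
product would give a = 0. The bound on k hence forces 5 ≤ k as soon as there is an interior edge. -/
theorem IsMinimalPair.one_le_tdeg_right (h : IsMinimalPair a b c r₁ r₂ Z₁ Z₂) (ha : a ≠ 0)
    (hcop : ∀ p : ℝ[X], p ∣ a → p ∣ b → p ∣ c → IsUnit p)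
    (hle : tdeg r₁ r₂ Z₁ ≤ tdeg r₁ r₂ Z₂) : 1 ≤ tdeg r₁ r₂ Z₂ := by
  by_contra! hlt
  obtain ⟨x, hx, h0, -, -⟩ := h.cross ha hcop
  have hB : ∀ Z : Fin 3 → ℝ[X], tdeg r₁ r₂ Z = 0 → Z 1 = 0 := by
    intro Z hZ
    have := twistedDegreeLE_iff.1 (twistedDegreeLE_tdeg (r₁ := r₁) (r₂ := r₂) Z)
    rw [hZ] at this
    ext m
    exact this 1 m (by simp [twist])
  rw [hB Z₁ (by omega), hB Z₂ (by omega), zero_mul, mul_zero, sub_zero] at h0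
  exact mul_ne_zero (C_ne_zero.2 hx) ha h0.symm

/-- The weight X²(1 - X)² is nonnegative on [0, 1], so a middle component of constant sign suffices.
If the middle component B of `Z₁` is nonzero, B · `Z₁` has middle component B² and twisted degree at
most 2d₁ - 1, which is where the hypothesis 2d₁ + 3 ≤ k comes from. If B = 0, the cross product
shows that the middle component of `Z₂` divides a nonzero multiple of a, so it has no zero on [0,
1]. -/
theorem IsMinimalPair.exists_unitIntegral_ne_zero (h : IsMinimalPair a b c r₁ r₂ Z₁ Z₂)
    (ha : ∀ t ∈ Set.Icc (0 : ℝ) 1, a.eval t ≠ 0)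
    (hcop : ∀ p : ℝ[X], p ∣ a → p ∣ b → p ∣ c → IsUnit p) {k : ℕ}
    (hk₁ : 2 * tdeg r₁ r₂ Z₁ + 3 ≤ k) (hk₂ : tdeg r₁ r₂ Z₂ + 4 ≤ k) :
    ∃ Z ∈ syzLE a b c r₁ r₂ (k - 4), unitIntegral (X ^ 2 * (1 - X) ^ 2 * Z 1) ≠ 0 := by
  have hw : ∀ t ∈ Set.Icc (0 : ℝ) 1, 0 ≤ (X ^ 2 * (1 - X) ^ 2 : ℝ[X]).eval t := by
    intro t _
    simp
    positivity
  have ha0 : a ≠ 0 := by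
    rintro rfl
    exact ha 0 (by simp) (by simp)
  have hZ₁ := twistedDegreeLE_tdeg (r₁ := r₁) (r₂ := r₂) Z₁
  by_cases hB : Z₁ 1 = 0
  · refine ⟨Z₂, ⟨h.mem_right, (twistedDegreeLE_tdeg Z₂).mono (by omega)⟩, ?_⟩
    obtain ⟨x, hx, h0, -, -⟩ := h.cross ha0 hcop
    rw [hB, zero_mul, zero_sub] at h0
    have hne : ∀ t ∈ Set.Icc (0 : ℝ) 1, (Z₂ 1).eval t ≠ 0 := by
      intro t ht h1
      have := congrArg (Polynomial.eval t) h0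
      simp [h1] at this
      exact this.elim hx (ha t ht)
    have hZ0 : Z₂ 1 ≠ 0 := fun h1 => hne 0 (by simp) (by simp [h1])
    have hw0 : X ^ 2 * (1 - X) ^ 2 * Z₂ 1 ≠ 0 := mul_ne_zero (X_pow_mul_ne_zero 2) hZ0
    have hsign : (∀ t ∈ Set.Icc (0 : ℝ) 1, 0 ≤ (Z₂ 1).eval t) ∨
        (∀ t ∈ Set.Icc (0 : ℝ) 1, (Z₂ 1).eval t ≤ 0) := by
      by_contra! hcon
      obtain ⟨⟨s, hs, hs'⟩, ⟨t, ht, ht'⟩⟩ := hcon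
      have hconv : IsPreconnected (Set.Icc (0 : ℝ) 1) := isPreconnected_Icc
      obtain ⟨u, hu, hu'⟩ := hconv.intermediate_value hs ht (Z₂ 1).continuous.continuousOn
        (show (0 : ℝ) ∈ Set.Icc _ _ from ⟨hs'.le, ht'.le⟩)
      exact hne u hu hu'
    rcases hsign with hs | hs
    · refine (unitIntegral_pos hw0 fun t ht => ?_).ne'
      rw [eval_mul]
      exact mul_nonneg (hw t ht) (hs t ht)
    · have := unitIntegral_pos (neg_ne_zero.2 hw0) fun t ht => by
        rw [eval_neg, eval_mul]
        exact neg_nonneg.2 (mul_nonpos_of_nonneg_of_nonpos (hw t ht) (hs t ht))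
      rw [map_neg] at this
      exact (neg_pos.1 this).ne
  · refine ⟨Z₁ 1 • Z₁, ⟨Submodule.smul_mem _ _ h.mem_left, hZ₁.smul fun m hm => ?_⟩, ?_⟩
    · exact twistedDegreeLE_iff.1 hZ₁ 1 m (by simp [twist]; omega)
    · refine (unitIntegral_pos ?_ fun t ht => ?_).ne'
      · exact mul_ne_zero (X_pow_mul_ne_zero 2) (mul_ne_zero hB hB)
      · rw [eval_mul, Pi.smul_apply, smul_eq_mul, eval_mul (p := Z₁ 1)]
        exact mul_nonneg (hw t ht) (mul_self_nonneg _)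

/-- First order solutions of the syzygy equation at `0` extend to combinations of two syzygies
that are independent there. -/
theorem exists_firstOrder_combination (hZ₁ : Z₁ ∈ syz a b c) (hZ₂ : Z₂ ∈ syz a b c)
    (ha : a.coeff 0 ≠ 0) (hX : (Z₁ 1 * Z₂ 2 - Z₁ 2 * Z₂ 1).coeff 0 ≠ 0) (u u' : Fin 3 → ℝ)
    (h0 : a.coeff 0 * u 0 + b.coeff 0 * u 1 + c.coeff 0 * u 2 = 0)
    (h1 : a.coeff 0 * u' 0 + b.coeff 0 * u' 1 + c.coeff 0 * u' 2 +
      (a.coeff 1 * u 0 + b.coeff 1 * u 1 + c.coeff 1 * u 2) = 0) :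
    ∃ p p' q q' : ℝ, ∀ i, u i = p * (Z₁ i).coeff 0 + q * (Z₂ i).coeff 0 ∧
      u' i = p * (Z₁ i).coeff 1 + p' * (Z₁ i).coeff 0 +
        (q * (Z₂ i).coeff 1 + q' * (Z₂ i).coeff 0) := by
  let t : Fin 3 → ℝ := ![a.coeff 0, b.coeff 0, c.coeff 0]
  have ht : t ≠ 0 := fun h => ha (congrFun h 0)
  have hdot : ∀ w : Fin 3 → ℝ,
      t ⬝ᵥ w = a.coeff 0 * w 0 + b.coeff 0 * w 1 + c.coeff 0 * w 2 := by
    intro w; simp [t, dotProduct, Fin.sum_univ_succ, add_assoc]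
  have hs0 : ∀ Z ∈ syz a b c, t ⬝ᵥ (fun i => (Z i).coeff 0) = 0 := by
    intro Z hZ
    have := congrArg (fun p => p.coeff 0) (mem_syz.1 hZ)
    simpa [mul_coeff_zero, hdot] using this
  have hs1 : ∀ Z ∈ syz a b c, t ⬝ᵥ (fun i => (Z i).coeff 1) +
      (a.coeff 1 * (Z 0).coeff 0 + b.coeff 1 * (Z 1).coeff 0 + c.coeff 1 * (Z 2).coeff 0) = 0 := by
    intro Z hZ
    have := congrArg (fun p => p.coeff 1) (mem_syz.1 hZ)
    simp [mul_coeff_one] at this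
    rw [hdot]
    linear_combination this
  have hlin : LinearIndependent ℝ ![fun i => (Z₁ i).coeff 0, fun i => (Z₂ i).coeff 0] := by
    apply linearIndependent_pair_of_cross_ne_zero (i := 1) (j := 2)
    simpa [mul_coeff_zero] using hX
  obtain ⟨p, q, hpq⟩ := mem_span_pair_of_dotProduct_eq_zero ht hlin (hs0 _ hZ₁) (hs0 _ hZ₂)
    ((hdot u).trans h0)
  have hpq' : ∀ i, u i = p * (Z₁ i).coeff 0 + q * (Z₂ i).coeff 0 := fun i => congrFun hpq i
  -- The values fix p and q. After subtracting their effect from the first derivatives, the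
  -- remainder is again orthogonal to the values of (a, b, c) at 0, so the same two vectors span it.
  obtain ⟨p', q', hpq1⟩ := mem_span_pair_of_dotProduct_eq_zero ht hlin (hs0 _ hZ₁) (hs0 _ hZ₂)
    (w := fun i => u' i - p * (Z₁ i).coeff 1 - q * (Z₂ i).coeff 1) (by
      have e1 := hs1 _ hZ₁
      have e2 := hs1 _ hZ₂
      rw [hdot] at e1 e2 ⊢
      rw [hpq' 0, hpq' 1, hpq' 2] at h1
      linear_combination h1 - p * e1 - q * e2)
  refine ⟨p, p', q, q', fun i => ⟨hpq' i, ?_⟩⟩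
  have := congrFun hpq1 i
  simp at this
  linear_combination this

theorem flip_mem_syz {Z : Fin 3 → ℝ[X]} (hZ : Z ∈ syz a b c) :
    (fun i => flip (Z i)) ∈ syz (flip a) (flip b) (flip c) := by
  rw [mem_syz] at *
  rw [← map_mul, ← map_mul, ← map_mul, ← map_add, ← map_add, hZ, map_zero]

theorem exists_hermite_coeff (x x' y y' : ℝ) : ∃ p : ℝ[X], p ∈ degreeLT ℝ 4 ∧
    p.coeff 0 = x ∧ p.coeff 1 = x' ∧ (flip p).coeff 0 = y ∧ (flip p).coeff 1 = y' := by
  obtain ⟨p, hp, h1, h2, h3, h4⟩ := exists_hermite x x' y (-y')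
  refine ⟨p, hp, ?_, ?_, ?_, ?_⟩
  · rw [coeff_zero_eq_eval_zero, h1]
  · rw [coeff_one_eq_eval, h2]
  · rw [coeff_zero_eq_eval_zero, eval_flip, sub_zero, h3]
  · rw [coeff_one_eq_eval, derivative_flip, eval_neg, eval_flip, sub_zero, h4, neg_neg]

/-- Syzygies of bounded degree interpolate all first order data at both end points together with
the integral of the middle component. -/
theorem IsMinimalPair.exists_interpolation (h : IsMinimalPair a b c r₁ r₂ Z₁ Z₂)
    (ha : ∀ t ∈ Set.Icc (0 : ℝ) 1, a.eval t ≠ 0)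
    (hcop : ∀ p : ℝ[X], p ∣ a → p ∣ b → p ∣ c → IsUnit p) {k : ℕ}
    (hk₁ : 2 * tdeg r₁ r₂ Z₁ + 3 ≤ k) (hk₂ : tdeg r₁ r₂ Z₂ + 4 ≤ k) (u u' v v' : Fin 3 → ℝ)
    (hu : a.coeff 0 * u 0 + b.coeff 0 * u 1 + c.coeff 0 * u 2 = 0)
    (hu' : a.coeff 0 * u' 0 + b.coeff 0 * u' 1 + c.coeff 0 * u' 2 +
      (a.coeff 1 * u 0 + b.coeff 1 * u 1 + c.coeff 1 * u 2) = 0)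
    (hv : (flip a).coeff 0 * v 0 + (flip b).coeff 0 * v 1 + (flip c).coeff 0 * v 2 = 0)
    (hv' : (flip a).coeff 0 * v' 0 + (flip b).coeff 0 * v' 1 + (flip c).coeff 0 * v' 2 +
      ((flip a).coeff 1 * v 0 + (flip b).coeff 1 * v 1 + (flip c).coeff 1 * v 2) = 0) (s : ℝ) :
    ∃ Z ∈ syzLE a b c r₁ r₂ k, (∀ i, (Z i).coeff 0 = u i ∧ (Z i).coeff 1 = u' i ∧
      (flip (Z i)).coeff 0 = v i ∧ (flip (Z i)).coeff 1 = v' i) ∧ unitIntegral (Z 1) = s := by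
  have ha0 : a ≠ 0 := by
    rintro rfl
    exact ha 0 (by simp) (by simp)
  obtain ⟨x, hx, hX, -, -⟩ := h.cross ha0 hcop
  have a0 : a.coeff 0 ≠ 0 := by rw [coeff_zero_eq_eval_zero]; exact ha 0 (by simp)
  have a1 : (flip a).coeff 0 ≠ 0 := by
    rw [coeff_zero_eq_eval_zero, eval_flip]; exact ha _ (by simp)
  obtain ⟨p, p', q, q', hpq⟩ := exists_firstOrder_combination h.mem_left h.mem_right a0
    (by rw [hX]; simp [hx, a0]) u u' hu hu'
  obtain ⟨s₁, s₁', s₂, s₂', hs⟩ := exists_firstOrder_combination (flip_mem_syz h.mem_left)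
    (flip_mem_syz h.mem_right) a1
    (by simp only [← map_mul, ← map_sub]; rw [hX]; simpa [hx] using a1) v v' hv hv'
  -- Cubic coefficients realise the required first order data at both ends and raise the twisted
  -- degree by at most 3, which the bounds on k allow.
  obtain ⟨P, hP, P0, P1, P2, P3⟩ := exists_hermite_coeff p p' s₁ s₁'
  obtain ⟨Q, hQ, Q0, Q1, Q2, Q3⟩ := exists_hermite_coeff q q' s₂ s₂'
  obtain ⟨W, hW, hWI⟩ := h.exists_unitIntegral_ne_zero ha hcop hk₁ hk₂
  rw [mem_degreeLT, degree_lt_iff_coeff_zero] at hP hQ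
  have hY : P • Z₁ + Q • Z₂ ∈ syzLE a b c r₁ r₂ k :=
    Submodule.add_mem _ ⟨Submodule.smul_mem _ _ h.mem_left,
      (twistedDegreeLE_tdeg Z₁).smul fun m hm => hP m (by omega)⟩
      ⟨Submodule.smul_mem _ _ h.mem_right,
      (twistedDegreeLE_tdeg Z₂).smul fun m hm => hQ m (by omega)⟩
  have hw : ∀ m, 4 < m → (X ^ 2 * (1 - X) ^ 2 : ℝ[X]).coeff m = 0 := by
    intro m hm
    apply coeff_eq_zero_of_degree_lt
    rw [degree_X_pow_mul]
    exact_mod_cast hm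
  have hV : (X ^ 2 * (1 - X) ^ 2 : ℝ[X]) • W ∈ syzLE a b c r₁ r₂ k :=
    ⟨Submodule.smul_mem _ _ hW.1, hW.2.smul fun m hm => hw m (by omega)⟩
  -- The integral is adjusted by a multiple of X²(1 - X)² `W`, which changes no first order data at
  -- the ends.
  refine ⟨P • Z₁ + Q • Z₂ + ((s - unitIntegral ((P • Z₁ + Q • Z₂) 1)) /
    unitIntegral (X ^ 2 * (1 - X) ^ 2 * W 1)) • ((X ^ 2 * (1 - X) ^ 2 : ℝ[X]) • W),
    Submodule.add_mem _ hY (Submodule.smul_mem _ _ hV), fun i => ?_, ?_⟩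
  · obtain ⟨e1, e2⟩ := hpq i
    obtain ⟨e3, e4⟩ := hs i
    have w0 := coeff_X_pow_mul_mul_eq_zero (show 0 < 2 by norm_num) (W i)
    have w1 := coeff_X_pow_mul_mul_eq_zero (show 1 < 2 by norm_num) (W i)
    have w2 := coeff_X_pow_mul_mul_eq_zero (show 0 < 2 by norm_num) (flip (W i))
    have w3 := coeff_X_pow_mul_mul_eq_zero (show 1 < 2 by norm_num) (flip (W i))
    rw [← flip_X_pow_mul] at w2 w3
    simp only [Pi.add_apply, Pi.smul_apply, smul_eq_mul]
    generalize X ^ 2 * (1 - X) ^ 2 * W i = w at w0 w1 w2 w3 ⊢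
    simp only [map_add, map_smul, coeff_add, coeff_smul, w0, w1, w2, w3, smul_zero, add_zero, map_mul,
      mul_coeff_zero, mul_coeff_one, P0, P1, P2, P3, Q0, Q1, Q2, Q3]
    refine ⟨?_, ?_, ?_, ?_⟩
    · rw [e1]
    · rw [e2]
    · rw [e3]
    · rw [e4]
  · simp only [Pi.add_apply, Pi.smul_apply, smul_eq_mul, map_add, map_smul]
    field_simp
    ring

/-- The syzygies `Z` of twisted degree at most `n` such that the middle component of
`X² (1 - X)² Z` has integral zero. -/
def flatSyz (a b c : ℝ[X]) (r₁ r₂ n : ℕ) : Submodule ℝ (Fin 3 → ℝ[X]) :=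
  syzLE a b c r₁ r₂ n ⊓ LinearMap.ker (unitIntegral.comp
    ((LinearMap.mulLeft ℝ (X ^ 2 * (1 - X) ^ 2 : ℝ[X])).comp (LinearMap.proj 1)))

theorem mem_flatSyz {Z : Fin 3 → ℝ[X]} {n : ℕ} : Z ∈ flatSyz a b c r₁ r₂ n ↔
    Z ∈ syzLE a b c r₁ r₂ n ∧ unitIntegral (X ^ 2 * (1 - X) ^ 2 * Z 1) = 0 := Iff.rfl

theorem IsMinimalPair.finite_flatSyz (h : IsMinimalPair a b c r₁ r₂ Z₁ Z₂) (n : ℕ) :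
    Module.Finite ℝ (flatSyz a b c r₁ r₂ n) := by
  have := h.finite_syzLE n
  exact Submodule.finiteDimensional_of_le (S₂ := syzLE a b c r₁ r₂ n) inf_le_left

/-- Syzygies of twisted degree at most k - 4 have dimension (k - 3 - d₁) + (k - 3 - d₂), the
integral condition is one nonzero linear form, and d₁ + d₂ = δ + 2 - r₁ - r₂. -/
theorem IsMinimalPair.finrank_flatSyz (h : IsMinimalPair a b c r₁ r₂ Z₁ Z₂)
    (ha : ∀ t ∈ Set.Icc (0 : ℝ) 1, a.eval t ≠ 0) (hc : c ≠ 0)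
    (hcop : ∀ p : ℝ[X], p ∣ a → p ∣ b → p ∣ c → IsUnit p) {k : ℕ}
    (hk₁ : 2 * tdeg r₁ r₂ Z₁ + 3 ≤ k) (hk₂ : tdeg r₁ r₂ Z₂ + 4 ≤ k) :
    Module.finrank ℝ (flatSyz a b c r₁ r₂ (k - 4)) + gluingDegree a b c r₁ r₂ + 9 =
      2 * k + r₁ + r₂ := by
  have ha0 : a ≠ 0 := by
    rintro rfl
    exact ha 0 (by simp) (by simp)
  have := h.finite_syzLE (k - 4)
  obtain ⟨W, hW, hWI⟩ := h.exists_unitIntegral_ne_zero ha hcop hk₁ hk₂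
  have h1 := finrank_map_add_finrank_inf_ker (unitIntegral.comp
    ((LinearMap.mulLeft ℝ (X ^ 2 * (1 - X) ^ 2 : ℝ[X])).comp
      (LinearMap.proj (R := ℝ) (φ := fun _ : Fin 3 => ℝ[X]) 1))) (syzLE a b c r₁ r₂ (k - 4))
  have h2 : (syzLE a b c r₁ r₂ (k - 4)).map (unitIntegral.comp
    ((LinearMap.mulLeft ℝ (X ^ 2 * (1 - X) ^ 2 : ℝ[X])).comp
      (LinearMap.proj (R := ℝ) (φ := fun _ : Fin 3 => ℝ[X]) 1))) = ⊤ := by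
    rw [eq_top_iff]
    intro s _
    refine ⟨(s / unitIntegral (X ^ 2 * (1 - X) ^ 2 * W 1)) • W, Submodule.smul_mem _ _ hW, ?_⟩
    rw [map_smul, smul_eq_mul]
    exact div_mul_cancel₀ _ hWI
  rw [h2, finrank_top, Module.finrank_self, h.finrank_syzLE ha0 hcop] at h1
  have h3 := h.tdeg_add_tdeg ha0 hc hcop
  change 1 + Module.finrank ℝ (flatSyz a b c r₁ r₂ (k - 4)) = _ at h1
  omega

end MinimalPair

end

end G1Spline

namespace G1Spline

noncomputable section

/-! ### Bivariate polynomials along a coordinate axis -/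

abbrev Bivar : Type := MvPolynomial (Fin 2) ℝ

abbrev bu : Bivar := MvPolynomial.X 0

abbrev bv : Bivar := MvPolynomial.X 1

/-- Restriction to the axis `v = 0`. -/
def axisVal : Bivar →ₐ[ℝ] ℝ[X] := MvPolynomial.aeval ![X, 0]

/-- Restriction of `∂/∂v` to the axis `v = 0`. -/
def axisNor : Bivar →ₗ[ℝ] ℝ[X] :=
  axisVal.toLinearMap.comp (MvPolynomial.pderiv 1).toLinearMap

@[simp] theorem axisVal_u : axisVal bu = X := by simp [axisVal]

@[simp] theorem axisVal_v : axisVal bv = 0 := by simp [axisVal]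

@[simp] theorem axisVal_C (x : ℝ) : axisVal (MvPolynomial.C x) = C x := by
  simp [axisVal]

theorem axisNor_apply (G : Bivar) : axisNor G = axisVal (MvPolynomial.pderiv 1 G) := rfl

@[simp] theorem axisNor_C (x : ℝ) : axisNor (MvPolynomial.C x) = 0 := by
  simp [axisNor_apply]

@[simp] theorem axisNor_one : axisNor 1 = 0 := by
  simp [axisNor_apply]

@[simp] theorem axisNor_u : axisNor bu = 0 := by
  simp [axisNor_apply, MvPolynomial.pderiv_X]

@[simp] theorem axisNor_v : axisNor bv = 1 := by
  simp [axisNor_apply]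

@[simp] theorem axisNor_mul (G H : Bivar) :
    axisNor (G * H) = axisVal G * axisNor H + axisNor G * axisVal H := by
  simp only [axisNor_apply, Derivation.leibniz, smul_eq_mul, map_add, map_mul]
  ring

theorem axisNor_pow (G : Bivar) (n : ℕ) :
    axisNor (G ^ n) = C (n : ℝ) * axisVal G ^ (n - 1) * axisNor G := by
  simp [axisNor_apply, Derivation.leibniz_pow, mul_assoc]

theorem axisVal_pderiv_zero (G : Bivar) :
    axisVal (MvPolynomial.pderiv 0 G) = derivative (axisVal G) := by
  induction G using MvPolynomial.induction_on with
  | C x => simp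
  | add G H hG hH => simp [hG, hH]
  | mul_X G i hG =>
    rw [Derivation.leibniz, map_add, smul_eq_mul, smul_eq_mul, map_mul, map_mul, hG, map_mul,
      derivative_mul]
    fin_cases i <;> simp [MvPolynomial.pderiv_X] <;> ring

theorem eval_axis (t : ℝ) (G : Bivar) :
    MvPolynomial.eval ![t, 0] G = (axisVal G).eval t := by
  induction G using MvPolynomial.induction_on with
  | C x => simp
  | add G H hG hH => simp [hG, hH]
  | mul_X G i hG =>
    rw [map_mul, map_mul, hG, eval_mul]
    fin_cases i <;> simp

/-- The substitution exchanging `u` and `v`. -/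
def swapHom : Bivar →ₐ[ℝ] Bivar := MvPolynomial.aeval ![bv, bu]

/-- The substitution `u ↦ 1 - u - ρ v`. -/
def revHom (ρ : ℝ) : Bivar →ₐ[ℝ] Bivar :=
  MvPolynomial.aeval ![1 - bu - MvPolynomial.C ρ * bv, bv]

@[simp] theorem swapHom_u : swapHom bu = bv := by simp [swapHom]

@[simp] theorem swapHom_v : swapHom bv = bu := by simp [swapHom]

@[simp] theorem revHom_u (ρ : ℝ) : revHom ρ bu = 1 - bu - MvPolynomial.C ρ * bv := by
  simp [revHom]

@[simp] theorem revHom_v (ρ : ℝ) : revHom ρ bv = bv := by simp [revHom]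

@[simp] theorem revHom_C (ρ x : ℝ) : revHom ρ (MvPolynomial.C x) = MvPolynomial.C x := by
  simp [revHom]

theorem bivar_algHom_ext {A : Type*} [CommSemiring A] [Algebra ℝ A] {f g : Bivar →ₐ[ℝ] A}
    (hu : f bu = g bu) (hv : f bv = g bv) : f = g := by
  apply MvPolynomial.algHom_ext
  intro i
  fin_cases i
  · exact hu
  · exact hv

theorem swapHom_comp_swapHom : swapHom.comp swapHom = AlgHom.id ℝ Bivar :=
  bivar_algHom_ext (by simp) (by simp)

theorem revHom_comp_revHom (ρ : ℝ) : (revHom ρ).comp (revHom ρ) = AlgHom.id ℝ Bivar :=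
  bivar_algHom_ext (by simp; ring) (by simp)

theorem swapHom_swapHom (G : Bivar) : swapHom (swapHom G) = G := by
  rw [← AlgHom.comp_apply, swapHom_comp_swapHom, AlgHom.id_apply]

theorem revHom_revHom (ρ : ℝ) (G : Bivar) : revHom ρ (revHom ρ G) = G := by
  rw [← AlgHom.comp_apply, revHom_comp_revHom, AlgHom.id_apply]

theorem axisVal_revHom (ρ : ℝ) (G : Bivar) : axisVal (revHom ρ G) = flip (axisVal G) := by
  have : axisVal.comp (revHom ρ) = flip.comp axisVal := bivar_algHom_ext (by simp) (by simp)
  exact DFunLike.congr_fun this G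

/-- Chain rule for u ↦ 1 - u - ρv: the derivative in v picks up -ρ times the derivative in u. -/
theorem axisNor_revHom (ρ : ℝ) (G : Bivar) :
    axisNor (revHom ρ G) = flip (axisNor G) - C ρ * flip (derivative (axisVal G)) := by
  induction G using MvPolynomial.induction_on with
  | C x => simp
  | add G H hG hH => simp only [map_add, hG, hH]; ring
  | mul_X G i hG =>
    rw [map_mul, axisNor_mul, hG, axisNor_mul, map_mul, derivative_mul, axisVal_revHom]
    fin_cases i
    · simp; ring
    · simp

/-- Swapping exchanges the coefficients of u and v and keeps those of 1 and uv. They are treated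
together because multiplication by a variable shifts one into another. -/
theorem coeff_swapHom (G : Bivar) :
    (axisVal (swapHom G)).coeff 0 = (axisVal G).coeff 0 ∧
    (axisVal (swapHom G)).coeff 1 = (axisNor G).coeff 0 ∧
    (axisNor (swapHom G)).coeff 0 = (axisVal G).coeff 1 ∧
    (axisNor (swapHom G)).coeff 1 = (axisNor G).coeff 1 := by
  induction G using MvPolynomial.induction_on with
  | C x => simp [coeff_C]
  | add G H hG hH =>
    obtain ⟨h1, h2, h3, h4⟩ := hG
    obtain ⟨h5, h6, h7, h8⟩ := hH
    simp only [map_add, coeff_add, h1, h2, h3, h4, h5, h6, h7, h8, and_self]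
  | mul_X G i hG =>
    obtain ⟨h1, h2, h3, h4⟩ := hG
    fin_cases i <;> simp [h1, h2, h3, h4, mul_coeff_zero, mul_coeff_one]

/-! ### Two-jets at the origin -/

/-- The Taylor coefficients of `1, u, v, u², v², uv` at the origin. -/
def jet : Bivar →ₗ[ℝ] (Fin 6 → ℝ) where
  toFun G := ![(axisVal G).coeff 0, (axisVal G).coeff 1, (axisNor G).coeff 0,
    (axisVal G).coeff 2, (axisVal (swapHom G)).coeff 2, (axisNor G).coeff 1]
  map_add' G H := by
    ext i; fin_cases i <;> simp
  map_smul' x G := by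
    ext i; fin_cases i <;> simp

theorem jet_swapHom (G : Bivar) : jet (swapHom G) =
    ![jet G 0, jet G 2, jet G 1, jet G 4, jet G 3, jet G 5] := by
  obtain ⟨h1, h2, h3, h4⟩ := coeff_swapHom G
  simp [jet, h1, h2, h3, h4, swapHom_swapHom]

theorem jet_swapHom_eq_zero_iff (G : Bivar) : jet (swapHom G) = 0 ↔ jet G = 0 := by
  have key : ∀ G, jet G = 0 → jet (swapHom G) = 0 := by
    intro G h
    rw [jet_swapHom, h]
    ext i; fin_cases i <;> simp
  refine ⟨fun h => ?_, key G⟩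
  have := key _ h
  rwa [swapHom_swapHom] at this

theorem jet_eq_zero_of_u_pow_dvd {G : Bivar} (h : bu ^ 3 ∣ G) : jet G = 0 := by
  obtain ⟨H, rfl⟩ := h
  have e1 : axisVal (bu ^ 3 * H) = X ^ 3 * axisVal H := by simp
  have e2 : axisNor (bu ^ 3 * H) = X ^ 3 * axisNor H := by simp [axisNor_pow]
  have e3 : axisVal (swapHom (bu ^ 3 * H)) = 0 := by simp
  have hc : ∀ (p : ℝ[X]) (i : ℕ), i < 3 → (X ^ 3 * p).coeff i = 0 :=
    fun p i hi => X_pow_dvd_iff.1 (Dvd.intro _ rfl) i hi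
  ext i
  fin_cases i <;> simp [jet, e1, e2, e3, hc, -map_mul, -map_pow, -axisNor_mul]

theorem axis_eq_zero_of_v_sq_dvd {G : Bivar} (h : bv ^ 2 ∣ G) :
    axisVal G = 0 ∧ axisNor G = 0 := by
  obtain ⟨H, rfl⟩ := h
  simp [axisNor_pow]

/-! ### The polynomial spaces of a tile -/

namespace Tile

/-- The monomials `u^i v^j` of the polynomial space of degree `k` of a tile. -/
def exponents (T : Tile) (k : ℕ) : Set (Fin 2 →₀ ℕ) :=
  match T with
  | triangle _ _ => {n | (n.sum fun _ e => e) ≤ k}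
  | rectangle _ _ => {n | ∀ i, n i ≤ k}

/-- The polynomial space of degree `k` of a tile, in standard coordinates. -/
def polySpace (T : Tile) (k : ℕ) : Submodule ℝ Bivar :=
  MvPolynomial.restrictSupport ℝ (T.exponents k)

/-- Rewriting a polynomial in the standard coordinates at vertex `i`. -/
def pull (T : Tile) (i : Fin T.sides) (d : Bool) : Bivar →ₐ[ℝ] Bivar :=
  MvPolynomial.aeval fun j : Fin 2 =>
    MvPolynomial.C (T.vertex i j)
      + MvPolynomial.C ((T.vertex (if d then i - 1 else i + 1) - T.vertex i) j) * bu
      + MvPolynomial.C ((T.vertex (if d then i + 1 else i - 1) - T.vertex i) j) * bv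

theorem mem_polySpace_triangle {p h k} {G : Bivar} :
    G ∈ (triangle p h).polySpace k ↔ G.totalDegree ≤ k :=
  MvPolynomial.mem_restrictTotalDegree _ _ _

theorem mem_polySpace_rectangle {p h k} {G : Bivar} :
    G ∈ (rectangle p h).polySpace k ↔ ∀ i, G.degreeOf i ≤ k := by
  change G ∈ MvPolynomial.restrictDegree (Fin 2) ℝ k ↔ _
  rw [MvPolynomial.mem_restrictDegree]
  simp only [MvPolynomial.degreeOf_le_iff]
  exact ⟨fun h i s hs => h s hs i, fun h s hs i => h i s hs⟩

theorem map_mem_polySpace {T : Tile} {k : ℕ} {M : Type*} [AddCommGroup M] [Module ℝ M]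
    (f : Bivar →ₗ[ℝ] M) (N : Submodule ℝ M)
    (h : ∀ n ∈ T.exponents k, f (bu ^ n 0 * bv ^ n 1) ∈ N) {G : Bivar}
    (hG : G ∈ T.polySpace k) : f G ∈ N := by
  have : T.polySpace k ≤ N.comap f := by
    rw [polySpace, MvPolynomial.restrictSupport_eq_span, Submodule.span_le]
    rintro _ ⟨n, hn, rfl⟩
    have := h n hn
    rw [SetLike.mem_coe, Submodule.mem_comap]
    beta_reduce
    rw [MvPolynomial.monomial_eq]
    simpa [Finsupp.prod_fintype] using this
  exact this hG

theorem exponents_triangle {p h k} {n : Fin 2 →₀ ℕ} :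
    n ∈ (triangle p h).exponents k ↔ n 0 + n 1 ≤ k := by
  change (n.sum fun _ e => e) ≤ k ↔ _
  rw [Finsupp.sum_fintype _ _ (fun _ => rfl), Fin.sum_univ_two]

theorem exponents_rectangle {p h k} {n : Fin 2 →₀ ℕ} :
    n ∈ (rectangle p h).exponents k ↔ n 0 ≤ k ∧ n 1 ≤ k := by
  change (∀ i, n i ≤ k) ↔ _
  rw [Fin.forall_fin_two]

instance finite_polySpace (T : Tile) (k : ℕ) : Module.Finite ℝ (T.polySpace k) := by
  cases T
  · exact inferInstanceAs (Module.Finite ℝ (MvPolynomial.restrictTotalDegree (Fin 2) ℝ k))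
  · exact inferInstanceAs (Module.Finite ℝ (MvPolynomial.restrictDegree (Fin 2) ℝ k))

theorem finrank_polySpace (T : Tile) (k : ℕ) :
    Module.finrank ℝ (T.polySpace k) = Nat.card (T.exponents k) :=
  Module.finrank_eq_nat_card_basis (MvPolynomial.basisRestrictSupport ℝ (T.exponents k))

/-- Exponents as pairs. -/
def exponentEquiv : (Fin 2 →₀ ℕ) ≃ ℕ × ℕ :=
  Finsupp.equivFunOnFinite.trans (finTwoArrowEquiv ℕ)

theorem card_exponents_triangle {p h k} : Nat.card ((triangle p h).exponents k) * 2 =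
    (k + 1) * (k + 2) := by
  have e : (triangle p h).exponents k ≃
      ((Finset.range (k + 1)).sigma fun a => Finset.range (k + 1 - a) : Finset (Σ _ : ℕ, ℕ)) :=
    { toFun := fun n => ⟨⟨n.1 0, n.1 1⟩, by
        have := exponents_triangle.1 n.2
        simp; omega⟩
      invFun := fun x => ⟨exponentEquiv.symm (x.1.1, x.1.2), by
        rw [exponents_triangle]
        have := Finset.mem_sigma.1 x.2
        rw [Finset.mem_range, Finset.mem_range] at this
        simp [exponentEquiv, finTwoArrowEquiv]
        omega⟩
      left_inv := fun n => by
        ext i; fin_cases i <;> simp [exponentEquiv, finTwoArrowEquiv]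
      right_inv := fun x => by simp [exponentEquiv, finTwoArrowEquiv] }
  rw [Nat.card_congr e, Nat.card_eq_fintype_card, Fintype.card_coe, Finset.card_sigma]
  simp only [Finset.card_range]
  have h1 := Finset.sum_range_reflect (fun a => a + 1) (k + 1)
  have h2 : ∑ a ∈ Finset.range (k + 1), (k + 1 - a) =
      ∑ a ∈ Finset.range (k + 1), (k + 1 - 1 - a + 1) :=
    Finset.sum_congr rfl fun a ha => by
      rw [Finset.mem_range] at ha; omega
  rw [h2, h1]
  have h3 := Finset.sum_range_succ' (fun a => a) (k + 1)
  rw [add_zero] at h3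
  rw [← h3, Finset.sum_range_id_mul_two]
  simp; ring

theorem card_exponents_rectangle {p h k} : Nat.card ((rectangle p h).exponents k) =
    (k + 1) ^ 2 := by
  have e : (rectangle p h).exponents k ≃ Fin (k + 1) × Fin (k + 1) :=
    { toFun := fun n => (⟨n.1 0, by have := exponents_rectangle.1 n.2; omega⟩,
        ⟨n.1 1, by have := exponents_rectangle.1 n.2; omega⟩)
      invFun := fun x => ⟨exponentEquiv.symm (x.1, x.2), by
        rw [exponents_rectangle]
        simp [exponentEquiv, finTwoArrowEquiv]
        omega⟩
      left_inv := fun n => by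
        ext i; fin_cases i <;> simp [exponentEquiv, finTwoArrowEquiv]
      right_inv := fun x => by simp [exponentEquiv, finTwoArrowEquiv] }
  rw [Nat.card_congr e]
  simp [sq]

end Tile

end

end G1Spline

namespace G1Spline

noncomputable section

namespace Tile

/-! ### Changes between the standard coordinate systems of a tile -/

theorem pull_swap (T : Tile) (i : Fin T.sides) (d : Bool) :
    T.pull i (!d) = swapHom.comp (T.pull i d) := by
  apply MvPolynomial.algHom_ext
  intro j
  cases d <;> simp [pull] <;> ring

/-- The vertex relation behind the change of coordinates along an edge. -/
theorem vertex_relation (T : Tile) (i : Fin T.sides) :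
    T.vertex (i + 1 + 1) - T.vertex (i + 1) =
      (T.vertex (i - 1) - T.vertex i) - T.rho • (T.vertex (i + 1) - T.vertex i) := by
  cases T with
  | triangle p h =>
    have key : ∀ j : Fin 3, p (j + 1 + 1) - p (j + 1) = (p (j - 1) - p j) - (1 : ℝ) • (p (j + 1) - p j) := by
      intro j
      have : j + 1 + 1 = j - 1 := by revert j; decide
      rw [this, one_smul]; abel
    exact key i
  | rectangle p h =>
    have key : ∀ j : Fin 4, p (j + 1 + 1) - p (j + 1) = (p (j - 1) - p j) - (0 : ℝ) • (p (j + 1) - p j) := by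
      intro j
      have h1 : p 2 = p 1 - p 0 + p 3 := by rw [h.1]; abel
      rw [zero_smul, sub_zero]
      fin_cases j <;> simp [h1] <;> abel
    exact key i

theorem pull_rev_false (T : Tile) (i : Fin T.sides) :
    T.pull (i + 1) true = (revHom T.rho).comp (T.pull i false) := by
  apply MvPolynomial.algHom_ext
  intro j
  have h := congrArg (fun v : Plane => (MvPolynomial.C (v j) : Bivar)) (T.vertex_relation i)
  simp at h
  simp only [pull, MvPolynomial.aeval_X, AlgHom.comp_apply, map_add, map_mul, revHom_C, revHom_u,
    revHom_v, if_true, Bool.false_eq_true, if_false, PiLp.sub_apply, add_sub_cancel_right,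
    map_sub]
  linear_combination bv * h

theorem pull_rev_true (T : Tile) (i : Fin T.sides) :
    T.pull (i - 1) false = (revHom T.rho).comp (T.pull i true) := by
  have h := T.pull_rev_false (i - 1)
  rw [sub_add_cancel] at h
  rw [h, ← AlgHom.comp_assoc, revHom_comp_revHom, AlgHom.id_comp]

theorem pull_rev (T : Tile) (i : Fin T.sides) (d : Bool) :
    T.pull (if d then i - 1 else i + 1) (!d) = (revHom T.rho).comp (T.pull i d) := by
  cases d
  · exact T.pull_rev_false i
  · exact T.pull_rev_true i

/-- The standard coordinate systems of a tile are connected by the two elementary changes. -/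
theorem flag_induction (T : Tile) {P : Fin T.sides → Bool → Prop} (h0 : P 0 false)
    (hs : ∀ i d, P i d → P i (!d)) (hr : ∀ i, P i false → P (i + 1) true)
    (i : Fin T.sides) (d : Bool) : P i d := by
  have key : ∀ (n : ℕ) (hn : n < T.sides), P ⟨n, hn⟩ false := by
    intro n
    induction n with
    | zero => exact fun hn => h0
    | succ n ih =>
      intro hn
      have h1 := hs _ _ (hr _ (ih (by omega)))
      have h2 : (⟨n, by omega⟩ + 1 : Fin T.sides) = ⟨n + 1, hn⟩ := by
        ext
        rw [Fin.val_add, show ((1 : Fin T.sides) : ℕ) = 1 % T.sides from rfl, Nat.add_mod_mod]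
        exact Nat.mod_eq_of_lt hn
      rwa [h2] at h1
  have h1 : P i false := key i.1 i.2
  cases d
  · exact h1
  · exact hs _ _ h1

/-- The two edge directions at the first vertex are linearly independent. -/
theorem det_ne_zero (T : Tile) :
    (T.vertex (0 + 1) - T.vertex 0) 0 * (T.vertex (0 - 1) - T.vertex 0) 1 -
      (T.vertex (0 + 1) - T.vertex 0) 1 * (T.vertex (0 - 1) - T.vertex 0) 0 ≠ 0 := by
  cases T with
  | triangle p h =>
    change (p 1 - p 0) 0 * (p 2 - p 0) 1 - (p 1 - p 0) 1 * (p 2 - p 0) 0 ≠ 0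
    intro hdet
    rw [affineIndependent_iff_linearIndependent_vsub ℝ _ (0 : Fin 3)] at h
    have hinj : Function.Injective (![⟨1, by decide⟩, ⟨2, by decide⟩] :
        Fin 2 → {x : Fin 3 // x ≠ 0}) := by decide
    have h2 := h.comp _ hinj
    have h3 : (fun i : {x : Fin 3 // x ≠ 0} => p i -ᵥ p 0) ∘ ![⟨1, by decide⟩, ⟨2, by decide⟩] =
        ![p 1 - p 0, p 2 - p 0] := by
      ext i; fin_cases i <;> rfl
    rw [h3, LinearIndependent.pair_iff] at h2
    set U := p 1 - p 0
    set V := p 2 - p 0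
    have e1 := h2 (V 1) (-U 1) (by
      ext j; fin_cases j
      · simp; linarith
      · simp; ring)
    have e2 := h2 (V 0) (-U 0) (by
      ext j; fin_cases j
      · simp; ring
      · simp; linarith)
    have hV : V = 0 := by
      ext j; fin_cases j
      · exact e2.1
      · exact e1.1
    exact one_ne_zero (h2 0 1 (by simp [hV])).2
  | rectangle p h =>
    change (p 1 - p 0) 0 * (p 3 - p 0) 1 - (p 1 - p 0) 1 * (p 3 - p 0) 0 ≠ 0
    obtain ⟨-, h1, h2, h3⟩ := h
    rw [← sub_ne_zero] at h2 h3
    set U := p 1 - p 0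
    set V := p 3 - p 0
    have hin : U 0 * V 0 + U 1 * V 1 = 0 := by
      simpa [PiLp.inner_apply, Fin.sum_univ_two, mul_comm] using h1
    intro hdet
    -- Lagrange's identity: |U|²|V|² is the sum of the squares of the inner product and the
    -- determinant.
    have e : (U 0 ^ 2 + U 1 ^ 2) * (V 0 ^ 2 + V 1 ^ 2) = 0 := by
      linear_combination (U 0 * V 0 + U 1 * V 1) * hin + (U 0 * V 1 - U 1 * V 0) * hdet
    have hz : ∀ W : Plane, W 0 ^ 2 + W 1 ^ 2 = 0 → W = 0 := by
      intro W hW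
      ext j
      fin_cases j
      · simp; nlinarith [sq_nonneg (W 0), sq_nonneg (W 1)]
      · simp; nlinarith [sq_nonneg (W 0), sq_nonneg (W 1)]
    rcases mul_eq_zero.1 e with e | e
    · exact h2 (hz _ e)
    · exact h3 (hz _ e)

end Tile

/-- Affine substitutions with invertible linear part are invertible by affine substitutions. -/
theorem exists_inverse_affine (o U V : Fin 2 → ℝ) (hdet : U 0 * V 1 - U 1 * V 0 ≠ 0) :
    ∃ ψ : Bivar →ₐ[ℝ] Bivar, (∀ i, (ψ (MvPolynomial.X i)).totalDegree ≤ 1) ∧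
      ψ.comp (MvPolynomial.aeval fun j => MvPolynomial.C (o j) + MvPolynomial.C (U j) * bu +
        MvPolynomial.C (V j) * bv) = AlgHom.id ℝ Bivar ∧
      (MvPolynomial.aeval fun j => MvPolynomial.C (o j) + MvPolynomial.C (U j) * bu +
        MvPolynomial.C (V j) * bv).comp ψ = AlgHom.id ℝ Bivar := by
  set D := U 0 * V 1 - U 1 * V 0
  have e : (MvPolynomial.C (U 0) * MvPolynomial.C (V 1) -
      MvPolynomial.C (U 1) * MvPolynomial.C (V 0)) * MvPolynomial.C D⁻¹ = (1 : Bivar) := by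
    rw [← map_mul, ← map_mul, ← map_sub, ← map_mul, mul_inv_cancel₀ hdet, map_one]
  have hdeg : ∀ x y z w : ℝ, (MvPolynomial.C D⁻¹ * (MvPolynomial.C x * (bu - MvPolynomial.C y) -
      MvPolynomial.C z * (bv - MvPolynomial.C w)) : Bivar).totalDegree ≤ 1 := by
    intro x y z w
    have hX : ∀ (i : Fin 2) (x y : ℝ), (MvPolynomial.C x * (MvPolynomial.X i - MvPolynomial.C y) :
        Bivar).totalDegree ≤ 1 := by
      intro i x y
      refine (MvPolynomial.totalDegree_mul _ _).trans ?_
      rw [MvPolynomial.totalDegree_C, zero_add]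
      exact (MvPolynomial.totalDegree_sub_C_le _ _).trans (MvPolynomial.totalDegree_X _).le
    refine (MvPolynomial.totalDegree_mul _ _).trans ?_
    rw [MvPolynomial.totalDegree_C, zero_add]
    exact (MvPolynomial.totalDegree_sub _ _).trans (max_le (hX _ _ _) (hX _ _ _))
  refine ⟨MvPolynomial.aeval ![MvPolynomial.C D⁻¹ * (MvPolynomial.C (V 1) *
    (bu - MvPolynomial.C (o 0)) - MvPolynomial.C (V 0) * (bv - MvPolynomial.C (o 1))),
    MvPolynomial.C D⁻¹ * (MvPolynomial.C (-U 1) * (bu - MvPolynomial.C (o 0)) -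
    MvPolynomial.C (-U 0) * (bv - MvPolynomial.C (o 1)))], ?_, ?_, ?_⟩
  · intro i
    fin_cases i
    · simpa using hdeg _ _ _ _
    · rw [MvPolynomial.aeval_X]; exact hdeg _ _ _ _
  · apply bivar_algHom_ext
    · simp
      linear_combination (bu - MvPolynomial.C (o 0)) * e
    · simp
      linear_combination (bv - MvPolynomial.C (o 1)) * e
  · apply bivar_algHom_ext
    · simp
      linear_combination bu * e
    · simp
      linear_combination bv * e

theorem totalDegree_algHom_le {φ : Bivar →ₐ[ℝ] Bivar}
    (h : ∀ i, (φ (MvPolynomial.X i)).totalDegree ≤ 1) (G : Bivar) {k : ℕ} (hG : G.totalDegree ≤ k) :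
    (φ G).totalDegree ≤ k := by
  have h1 : G ∈ MvPolynomial.restrictTotalDegree (Fin 2) ℝ k :=
    (MvPolynomial.mem_restrictTotalDegree _ _ _).2 hG
  rw [MvPolynomial.restrictTotalDegree, MvPolynomial.restrictSupport_eq_span] at h1
  have h2 : Submodule.span ℝ ((fun n : Fin 2 →₀ ℕ => MvPolynomial.monomial n (1 : ℝ)) ''
      {n | (n.sum fun _ e => e) ≤ k}) ≤
      (MvPolynomial.restrictTotalDegree (Fin 2) ℝ k).comap φ.toLinearMap := by
    rw [Submodule.span_le]
    rintro _ ⟨n, hn, rfl⟩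
    rw [SetLike.mem_coe, Submodule.mem_comap, MvPolynomial.mem_restrictTotalDegree]
    beta_reduce
    rw [MvPolynomial.monomial_eq, map_one, one_mul, Finsupp.prod_fintype _ _ (by simp),
      Fin.prod_univ_two, AlgHom.toLinearMap_apply, map_mul, map_pow, map_pow]
    refine (MvPolynomial.totalDegree_mul _ _).trans ?_
    have e0 := (MvPolynomial.totalDegree_pow (φ (MvPolynomial.X 0)) (n 0)).trans
      (Nat.mul_le_mul_left _ (h 0))
    have e1 := (MvPolynomial.totalDegree_pow (φ (MvPolynomial.X 1)) (n 1)).trans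
      (Nat.mul_le_mul_left _ (h 1))
    have hn' : (n.sum fun _ e => e) ≤ k := hn
    rw [Finsupp.sum_fintype _ _ (fun _ => rfl), Fin.sum_univ_two] at hn'
    omega
  exact (MvPolynomial.mem_restrictTotalDegree _ _ _).1 (h2 h1)

/-! ### Polynomial spaces of a tile and their independence of the coordinate system -/

namespace Tile

/-- The polynomial functions of degree `k` on a tile. -/
def space (T : Tile) (k : ℕ) : Submodule ℝ Bivar :=
  match T with
  | triangle _ _ => MvPolynomial.restrictTotalDegree (Fin 2) ℝ k
  | rectangle p h =>
      (MvPolynomial.restrictDegree (Fin 2) ℝ k).comap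
        ((rectangle p h).pull 0 false).toLinearMap

theorem exists_pull_inverse (T : Tile) : ∃ ψ : Bivar →ₐ[ℝ] Bivar,
    (∀ i, (ψ (MvPolynomial.X i)).totalDegree ≤ 1) ∧
      ψ.comp (T.pull 0 false) = AlgHom.id ℝ Bivar ∧
      (T.pull 0 false).comp ψ = AlgHom.id ℝ Bivar := by
  have := exists_inverse_affine (fun j => T.vertex 0 j)
    (fun j => (T.vertex (0 + 1) - T.vertex 0) j) (fun j => (T.vertex (0 - 1) - T.vertex 0) j)
    T.det_ne_zero
  exact this

theorem pull_bijective (T : Tile) (i : Fin T.sides) (d : Bool) :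
    Function.Bijective (T.pull i d) := by
  have hsw : Function.Bijective swapHom :=
    Function.Involutive.bijective swapHom_swapHom
  have hrev : Function.Bijective (revHom T.rho) :=
    Function.Involutive.bijective (revHom_revHom _)
  refine T.flag_induction (P := fun i d => Function.Bijective (T.pull i d)) ?_ ?_ ?_ i d
  · obtain ⟨ψ, -, h1, h2⟩ := T.exists_pull_inverse
    refine Function.bijective_iff_has_inverse.2 ⟨ψ, fun G => ?_, fun G => ?_⟩
    · rw [← AlgHom.comp_apply, h1, AlgHom.id_apply]
    · rw [← AlgHom.comp_apply, h2, AlgHom.id_apply]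
  · intro i d h
    rw [pull_swap, AlgHom.coe_comp]
    exact hsw.comp h
  · intro i h
    rw [pull_rev_false, AlgHom.coe_comp]
    exact hrev.comp h

theorem swapHom_mem_polySpace {T : Tile} {k : ℕ} {G : Bivar} (hG : G ∈ T.polySpace k) :
    swapHom G ∈ T.polySpace k := by
  refine map_mem_polySpace (swapHom : Bivar →ₐ[ℝ] Bivar).toLinearMap (T.polySpace k) ?_ hG
  intro n hn
  rw [AlgHom.toLinearMap_apply, map_mul, map_pow, map_pow, swapHom_u, swapHom_v]
  cases T with
  | triangle p h =>
    rw [exponents_triangle] at hn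
    rw [mem_polySpace_triangle]
    refine (MvPolynomial.totalDegree_mul _ _).trans ?_
    rw [MvPolynomial.totalDegree_X_pow, MvPolynomial.totalDegree_X_pow]
    exact hn
  | rectangle p h =>
    rw [exponents_rectangle] at hn
    rw [mem_polySpace_rectangle]
    intro i
    refine (MvPolynomial.degreeOf_mul_le _ _ _).trans ?_
    fin_cases i <;> simp [MvPolynomial.degreeOf_X_pow_of_ne, hn]

/-- On a triangle any affine substitution preserves total degree. On a rectangle ρ = 0, so the
substitution u ↦ 1 - u does not mix the variables and preserves bidegree. -/
theorem revHom_mem_polySpace {T : Tile} {k : ℕ} {G : Bivar} (hG : G ∈ T.polySpace k) :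
    revHom T.rho G ∈ T.polySpace k := by
  cases T with
  | triangle p h =>
    rw [mem_polySpace_triangle] at hG ⊢
    refine totalDegree_algHom_le (fun i => ?_) G hG
    fin_cases i
    · change (revHom _ bu).totalDegree ≤ 1
      rw [revHom_u]
      refine (MvPolynomial.totalDegree_sub _ _).trans (max_le
        ((MvPolynomial.totalDegree_sub _ _).trans (max_le ?_ ?_))
        ((MvPolynomial.totalDegree_mul _ _).trans ?_))
      · simp
      · simp
      · simp
    · change (revHom _ bv).totalDegree ≤ 1
      simp
  | rectangle p h =>
    refine map_mem_polySpace (revHom _).toLinearMap ((rectangle p h).polySpace k) ?_ hG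
    intro n hn
    rw [exponents_rectangle] at hn
    rw [mem_polySpace_rectangle]
    intro i
    rw [AlgHom.toLinearMap_apply, map_mul, map_pow, map_pow, revHom_u, revHom_v]
    have e : (1 - bu - MvPolynomial.C (rectangle p h).rho * bv : Bivar) = 1 - bu := by
      simp [rho]
    rw [e]
    refine (MvPolynomial.degreeOf_mul_le _ _ _).trans ?_
    have h1 := MvPolynomial.degreeOf_pow_le i (1 - bu) (n 0)
    have h2 := MvPolynomial.degreeOf_sub_le i 1 bu
    rw [MvPolynomial.degreeOf_one] at h2
    fin_cases i
    · have h3 : MvPolynomial.degreeOf 0 (1 - bu) ≤ 1 := by simpa using h2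
      have h4 : n 0 * MvPolynomial.degreeOf 0 (1 - bu) ≤ n 0 * 1 := Nat.mul_le_mul_left _ h3
      have h5 : MvPolynomial.degreeOf 0 (bv ^ n 1) = 0 :=
        MvPolynomial.degreeOf_X_pow_of_ne _ (by decide)
      have h6 := hn.1
      simp only [Fin.zero_eta, Fin.isValue] at h1 ⊢
      omega
    · have h3 : MvPolynomial.degreeOf 1 (1 - bu) = 0 := by
        have : MvPolynomial.degreeOf 1 bu = 0 := MvPolynomial.degreeOf_X_of_ne (by decide)
        simp only [Fin.mk_one, this] at h2
        simpa using h2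
      have h5 : MvPolynomial.degreeOf 1 (bv ^ n 1) = n 1 := by simp
      have h6 := hn.2
      simp only [Fin.mk_one, Fin.isValue, h3, mul_zero] at h1 ⊢
      omega

/-- The two elementary coordinate changes preserve the polynomial space and connect all flags of a
tile, so the degree condition may be checked at any flag. -/
theorem mem_space_iff (T : Tile) (k : ℕ) (i : Fin T.sides) (d : Bool) (g : Bivar) :
    g ∈ T.space k ↔ T.pull i d g ∈ T.polySpace k := by
  have key : ∀ i d, T.pull 0 false g ∈ T.polySpace k ↔ T.pull i d g ∈ T.polySpace k := by
    refine fun i d => T.flag_induction (P := fun i d => T.pull 0 false g ∈ T.polySpace k ↔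
      T.pull i d g ∈ T.polySpace k) Iff.rfl ?_ ?_ i d
    · intro i d h
      rw [h, pull_swap, AlgHom.comp_apply]
      refine ⟨swapHom_mem_polySpace, fun h1 => ?_⟩
      have := swapHom_mem_polySpace h1
      rwa [swapHom_swapHom] at this
    · intro i h
      rw [h, pull_rev_false, AlgHom.comp_apply]
      refine ⟨revHom_mem_polySpace, fun h1 => ?_⟩
      have := revHom_mem_polySpace h1
      rwa [revHom_revHom] at this
  rw [← key i d]
  cases T with
  | rectangle p h => exact Iff.rfl
  | triangle p h =>
    rw [mem_polySpace_triangle]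
    change g ∈ MvPolynomial.restrictTotalDegree (Fin 2) ℝ k ↔ _
    rw [MvPolynomial.mem_restrictTotalDegree]
    obtain ⟨ψ, hψ, h1, h2⟩ := (triangle p h).exists_pull_inverse
    constructor
    · refine totalDegree_algHom_le (fun i => ?_) g
      rw [pull, MvPolynomial.aeval_X]
      refine (MvPolynomial.totalDegree_add _ _).trans (max_le
        ((MvPolynomial.totalDegree_add _ _).trans (max_le ?_ ?_)) ?_)
      · simp
      · refine (MvPolynomial.totalDegree_mul _ _).trans ?_
        rw [MvPolynomial.totalDegree_C, MvPolynomial.totalDegree_X]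
      · refine (MvPolynomial.totalDegree_mul _ _).trans ?_
        rw [MvPolynomial.totalDegree_C, MvPolynomial.totalDegree_X]
    · intro h3
      have := totalDegree_algHom_le hψ _ h3
      rwa [← AlgHom.comp_apply, h1, AlgHom.id_apply] at this

/-- The polynomial functions on a tile, in standard coordinates. -/
def spaceEquiv (T : Tile) (k : ℕ) : T.space k ≃ₗ[ℝ] T.polySpace k :=
  LinearEquiv.ofBijective
    (((T.pull 0 false).toLinearMap.comp (T.space k).subtype).codRestrict (T.polySpace k)
      fun g => (T.mem_space_iff k 0 false g).1 g.2)
    ⟨fun g h hgh => Subtype.ext ((T.pull_bijective 0 false).1 (congrArg Subtype.val hgh)),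
      fun G => by
        obtain ⟨g, hg⟩ := (T.pull_bijective 0 false).2 G
        refine ⟨⟨g, (T.mem_space_iff k 0 false g).2 (by rw [hg]; exact G.2)⟩, ?_⟩
        exact Subtype.ext hg⟩

theorem axisVal_mem {T : Tile} {k : ℕ} {G : Bivar} (hG : G ∈ T.polySpace k) :
    axisVal G ∈ degreeLT ℝ (k + 1) := by
  refine map_mem_polySpace (axisVal : Bivar →ₐ[ℝ] ℝ[X]).toLinearMap _ ?_ hG
  intro n hn
  have h0 : n 0 ≤ k := by
    cases T with
    | triangle p h => have := exponents_triangle.1 hn; omega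
    | rectangle p h => exact (exponents_rectangle.1 hn).1
  rw [AlgHom.toLinearMap_apply, map_mul, map_pow, map_pow, axisVal_u, axisVal_v, mem_degreeLT]
  rcases Nat.eq_zero_or_pos (n 1) with h1 | h1
  · rw [h1, pow_zero, mul_one, degree_X_pow]
    exact_mod_cast Nat.lt_succ_of_le h0
  · rw [zero_pow h1.ne', mul_zero, degree_zero]
    exact WithBot.bot_lt_coe _

/-- Differentiating in v lowers total degree but not the degree in u. The normal derivative thus has
degree at most k - 1 on a triangle and k on a rectangle, and this explains the twists r₁, r₂. -/
theorem axisNor_mem {T : Tile} {k : ℕ} {G : Bivar} (hG : G ∈ T.polySpace k) :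
    axisNor G ∈ degreeLT ℝ (k + T.r) := by
  refine map_mem_polySpace axisNor _ ?_ hG
  intro n hn
  rw [axisNor_mul, axisNor_pow, axisNor_pow, map_pow, map_pow, axisNor_u, axisNor_v, axisVal_u,
    axisVal_v, mul_zero, zero_mul, add_zero, mem_degreeLT, mul_one]
  rcases eq_or_ne (n 1) 1 with h1 | h1
  · have h0 : n 0 < k + T.r := by
      cases T with
      | triangle p h => have := exponents_triangle.1 hn; simp [r]; omega
      | rectangle p h => have := (exponents_rectangle.1 hn).1; simp [r]; omega
    rw [h1]
    simp only [Nat.cast_one, map_one, tsub_self, pow_zero, mul_one, degree_X_pow]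
    exact_mod_cast h0
  · have : C ((n 1 : ℕ) : ℝ) * (0 : ℝ[X]) ^ (n 1 - 1) = 0 := by
      rcases Nat.eq_zero_or_pos (n 1) with h2 | h2
      · simp [h2]
      · rw [zero_pow (by omega), mul_zero]
    rw [this, mul_zero, degree_zero]
    exact WithBot.bot_lt_coe _

end Tile

end

end G1Spline

namespace G1Spline

noncomputable section

/-! ### Degree bounds for explicit bivariate polynomials -/

theorem totalDegree_mul_le_add {G H : Bivar} {m n : ℕ} (hG : G.totalDegree ≤ m)
    (hH : H.totalDegree ≤ n) : (G * H).totalDegree ≤ m + n :=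
  (MvPolynomial.totalDegree_mul _ _).trans (add_le_add hG hH)

theorem totalDegree_pow_le_mul {G : Bivar} {m : ℕ} (hG : G.totalDegree ≤ m) (n : ℕ) :
    (G ^ n).totalDegree ≤ n * m :=
  (MvPolynomial.totalDegree_pow _ _).trans (Nat.mul_le_mul_left _ hG)

theorem degreeOf_mul_le_add {i : Fin 2} {G H : Bivar} {m n : ℕ} (hG : G.degreeOf i ≤ m)
    (hH : H.degreeOf i ≤ n) : (G * H).degreeOf i ≤ m + n :=
  (MvPolynomial.degreeOf_mul_le _ _ _).trans (add_le_add hG hH)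

theorem degreeOf_pow_le_mul {i : Fin 2} {G : Bivar} {m : ℕ} (hG : G.degreeOf i ≤ m) (n : ℕ) :
    (G ^ n).degreeOf i ≤ n * m :=
  (MvPolynomial.degreeOf_pow_le _ _ _).trans (Nat.mul_le_mul_left _ hG)

theorem degreeOf_add_le_of_le {i : Fin 2} {G H : Bivar} {m : ℕ} (hG : G.degreeOf i ≤ m)
    (hH : H.degreeOf i ≤ m) : (G + H).degreeOf i ≤ m :=
  (MvPolynomial.degreeOf_add_le _ _ _).trans (max_le hG hH)

theorem degreeOf_sub_le_of_le {i : Fin 2} {G H : Bivar} {m : ℕ} (hG : G.degreeOf i ≤ m)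
    (hH : H.degreeOf i ≤ m) : (G - H).degreeOf i ≤ m :=
  (MvPolynomial.degreeOf_sub_le _ _ _).trans (max_le hG hH)

theorem totalDegree_add_le_of_le {G H : Bivar} {m : ℕ} (hG : G.totalDegree ≤ m)
    (hH : H.totalDegree ≤ m) : (G + H).totalDegree ≤ m :=
  (MvPolynomial.totalDegree_add _ _).trans (max_le hG hH)

theorem totalDegree_one_sub_sub : (1 - bu - bv : Bivar).totalDegree ≤ 1 := by
  refine (MvPolynomial.totalDegree_sub _ _).trans (max_le
    ((MvPolynomial.totalDegree_sub _ _).trans (max_le ?_ ?_)) ?_) <;> simp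

/-- A univariate polynomial, as a polynomial in `u`. -/
def inU : ℝ[X] →ₐ[ℝ] Bivar := Polynomial.aeval bu

@[simp] theorem axisVal_inU (p : ℝ[X]) : axisVal (inU p) = p := by
  have : axisVal.comp inU = AlgHom.id ℝ ℝ[X] := by
    apply Polynomial.algHom_ext
    simp [inU]
  exact DFunLike.congr_fun this p

@[simp] theorem axisNor_inU (p : ℝ[X]) : axisNor (inU p) = 0 := by
  induction p using Polynomial.induction_on' with
  | add p q hp hq => simp [hp, hq]
  | monomial n x =>
    have : inU (monomial n x) = MvPolynomial.C x * bu ^ n := by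
      simp [inU, aeval_monomial, MvPolynomial.algebraMap_eq]
    rw [this]
    simp [axisNor_pow]

theorem totalDegree_inU_le {p : ℝ[X]} {n : ℕ} (hp : p.natDegree ≤ n) :
    (inU p).totalDegree ≤ n := by
  rw [inU, aeval_eq_sum_range]
  refine MvPolynomial.totalDegree_finsetSum_le fun i hi => ?_
  rw [Finset.mem_range] at hi
  refine (MvPolynomial.totalDegree_smul_le _ _).trans ?_
  rw [MvPolynomial.totalDegree_X_pow]
  omega

theorem degreeOf_one_inU (p : ℝ[X]) : (inU p).degreeOf 1 ≤ 0 := by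
  rw [inU, aeval_eq_sum_range]
  refine (MvPolynomial.degreeOf_sum_le _ _ _).trans (Finset.sup_le fun i _ => ?_)
  rw [MvPolynomial.smul_eq_C_mul]
  refine (MvPolynomial.degreeOf_C_mul_le _ _ _).trans ?_
  rw [MvPolynomial.degreeOf_X_pow_of_ne _ (by decide)]

namespace Tile

theorem inU_mul_mem_triangle {p h k n} {q : ℝ[X]} (hq : q ∈ degreeLT ℝ n) {H : Bivar} {m : ℕ}
    (hH : H.totalDegree ≤ m) (hk : m + n ≤ k + 1) : inU q * H ∈ (triangle p h).polySpace k := by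
  rcases eq_or_ne q 0 with rfl | h0
  · simp
  rw [mem_degreeLT, ← natDegree_lt_iff_degree_lt h0] at hq
  rw [mem_polySpace_triangle]
  refine (totalDegree_mul_le_add (totalDegree_inU_le le_rfl) hH).trans ?_
  omega

theorem inU_mul_mem_rectangle {p h k n} {q : ℝ[X]} (hq : q ∈ degreeLT ℝ n) {H : Bivar} {m : ℕ}
    (hH : H.degreeOf 0 ≤ m) (hk : m + n ≤ k + 1) (hH1 : H.degreeOf 1 ≤ k) :
    inU q * H ∈ (rectangle p h).polySpace k := by
  rcases eq_or_ne q 0 with rfl | h0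
  · simp
  rw [mem_degreeLT, ← natDegree_lt_iff_degree_lt h0] at hq
  rw [mem_polySpace_rectangle, Fin.forall_fin_two]
  constructor
  · refine (degreeOf_mul_le_add ((MvPolynomial.degreeOf_le_totalDegree _ _).trans
      (totalDegree_inU_le le_rfl)) hH).trans ?_
    omega
  · refine (degreeOf_mul_le_add (degreeOf_one_inU q) hH1).trans ?_
    omega

/-! ### The flags of a tile -/

/-- The other flag at the same vertex. -/
def flagSwap {n : ℕ} (x : Fin n × Bool) : Fin n × Bool := (x.1, !x.2)

/-- The other flag on the same edge. -/
def flagRev {n : ℕ} [NeZero n] (x : Fin n × Bool) : Fin n × Bool :=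
  (if x.2 then x.1 - 1 else x.1 + 1, !x.2)

/-- The edge of a flag. -/
def flagEdge {n : ℕ} [NeZero n] (x : Fin n × Bool) : Fin n := if x.2 then x.1 - 1 else x.1

/-- Every flag off the given edge is a short word in the two elementary moves, so vanishing along
the other edges reduces to applying `swapHom` and `revHom` to one explicit polynomial. -/
theorem flags_off_edge_three : ∀ x y : Fin 3 × Bool, flagEdge y ≠ flagEdge x →
    y = flagSwap x ∨ y = flagRev (flagSwap x) ∨ y = flagSwap (flagRev x) ∨
      y = flagRev (flagSwap (flagRev x)) := by decide

theorem flags_off_edge_four : ∀ x y : Fin 4 × Bool, flagEdge y ≠ flagEdge x →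
    y = flagSwap x ∨ y = flagRev (flagSwap x) ∨ y = flagSwap (flagRev x) ∨
      y = flagRev (flagSwap (flagRev x)) ∨ y = flagSwap (flagRev (flagSwap x)) ∨
      y = flagRev (flagSwap (flagRev (flagSwap x))) := by decide

theorem flags_off_vertex_three : ∀ i j : Fin 3, j ≠ i →
    (j, false) = flagSwap (flagRev (i, false)) ∨ (j, false) = flagRev (flagSwap (i, false)) := by
  decide

theorem flags_off_vertex_four : ∀ i j : Fin 4, j ≠ i →
    (j, false) = flagSwap (flagRev (i, false)) ∨ (j, false) = flagRev (flagSwap (i, false)) ∨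
      (j, false) = flagSwap (flagRev (flagSwap (flagRev (i, false)))) := by
  decide

theorem flags_off_edge_triangle {p h} (x y : Fin (triangle p h).sides × Bool)
    (hy : flagEdge y ≠ flagEdge x) :
    y = flagSwap x ∨ y = flagRev (flagSwap x) ∨ y = flagSwap (flagRev x) ∨
      y = flagRev (flagSwap (flagRev x)) := flags_off_edge_three x y hy

theorem flags_off_edge_rectangle {p h} (x y : Fin (rectangle p h).sides × Bool)
    (hy : flagEdge y ≠ flagEdge x) :
    y = flagSwap x ∨ y = flagRev (flagSwap x) ∨ y = flagSwap (flagRev x) ∨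
      y = flagRev (flagSwap (flagRev x)) ∨ y = flagSwap (flagRev (flagSwap x)) ∨
      y = flagRev (flagSwap (flagRev (flagSwap x))) := flags_off_edge_four x y hy

theorem flags_off_vertex_triangle {p h} (i j : Fin (triangle p h).sides) (hj : j ≠ i) :
    (j, false) = flagSwap (flagRev (i, false)) ∨ (j, false) = flagRev (flagSwap (i, false)) :=
  flags_off_vertex_three i j hj

theorem flags_off_vertex_rectangle {p h} (i j : Fin (rectangle p h).sides) (hj : j ≠ i) :
    (j, false) = flagSwap (flagRev (i, false)) ∨ (j, false) = flagRev (flagSwap (i, false)) ∨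
      (j, false) = flagSwap (flagRev (flagSwap (flagRev (i, false)))) :=
  flags_off_vertex_four i j hj

theorem pull_flagSwap (T : Tile) (x : Fin T.sides × Bool) (g : Bivar) :
    T.pull (flagSwap x).1 (flagSwap x).2 g = swapHom (T.pull x.1 x.2 g) := by
  rw [flagSwap, pull_swap, AlgHom.comp_apply]

theorem pull_flagRev (T : Tile) (x : Fin T.sides × Bool) (g : Bivar) :
    T.pull (flagRev x).1 (flagRev x).2 g = revHom T.rho (T.pull x.1 x.2 g) := by
  rw [flagRev, pull_rev, AlgHom.comp_apply]

/-! ### Polynomials with prescribed traces along an edge -/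

theorem exists_polynomial_trace_triangle {p h k} (hk : 5 ≤ k) {f q : ℝ[X]}
    (hf : f ∈ degreeLT ℝ (k - 5)) (hq : q ∈ degreeLT ℝ (k - 4)) :
    ∃ G ∈ (triangle p h).polySpace k, axisVal G = X ^ 3 * (1 - X) ^ 3 * f ∧
      axisNor G = X ^ 2 * (1 - X) ^ 2 * q ∧ bu ^ 2 ∣ G ∧ (1 - bu - bv) ^ 2 ∣ G := by
  have hXf : X * f ∈ degreeLT ℝ (k - 4) := by
    rw [mem_degreeLT, degree_lt_iff_coeff_zero] at hf ⊢
    intro m hm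
    obtain ⟨m, rfl⟩ : ∃ m', m = m' + 1 := ⟨m - 1, by omega⟩
    rw [coeff_X_mul]
    exact hf m (by omega)
  have hq' : q + (3 : ℝ) • (X * f) ∈ degreeLT ℝ (k - 4) :=
    Submodule.add_mem _ hq (Submodule.smul_mem _ _ hXf)
  -- The first summand carries the value, but its normal derivative is -3u³(1 - u)²f. The second
  -- vanishes on v = 0, cancels this by 3Xf and supplies q. The squared factors make both flat on
  -- the other two edges, and the total degrees come out as k.
  refine ⟨inU f * ((1 - bu - bv) ^ 3 * bu ^ 3) +
    inU (q + (3 : ℝ) • (X * f)) * (bv * (1 - bu - bv) ^ 2 * bu ^ 2), ?_, ?_, ?_, ?_, ?_⟩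
  · refine Submodule.add_mem _ (inU_mul_mem_triangle hf (m := 6) ?_ (by omega))
      (inU_mul_mem_triangle hq' (m := 5) ?_ (by omega))
    · exact totalDegree_mul_le_add (totalDegree_pow_le_mul totalDegree_one_sub_sub 3)
        (totalDegree_pow_le_mul (MvPolynomial.totalDegree_X _).le 3)
    · exact totalDegree_mul_le_add (totalDegree_mul_le_add (MvPolynomial.totalDegree_X _).le
        (totalDegree_pow_le_mul totalDegree_one_sub_sub 2))
        (totalDegree_pow_le_mul (MvPolynomial.totalDegree_X _).le 2)
  · simp
    ring
  · simp only [map_add, axisNor_mul, axisNor_pow, axisNor_inU, axisVal_inU, map_mul, map_sub,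
      map_pow, axisVal_u, axisVal_v, axisNor_u, axisNor_v, map_one, axisNor_one, smul_eq_C_mul]
    simp
    ring
  · exact dvd_add (Dvd.intro_left (inU f * ((1 - bu - bv) ^ 3 * bu)) (by ring))
      (Dvd.intro_left (inU (q + (3 : ℝ) • (X * f)) * (bv * (1 - bu - bv) ^ 2)) (by ring))
  · exact dvd_add (Dvd.intro_left (inU f * ((1 - bu - bv) * bu ^ 3)) (by ring))
      (Dvd.intro_left (inU (q + (3 : ℝ) • (X * f)) * (bv * bu ^ 2)) (by ring))

theorem exists_polynomial_trace_rectangle {p h k} (hk : 5 ≤ k) {f q : ℝ[X]}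
    (hf : f ∈ degreeLT ℝ (k - 5)) (hq : q ∈ degreeLT ℝ (k - 4 + 1)) :
    ∃ G ∈ (rectangle p h).polySpace k, axisVal G = X ^ 3 * (1 - X) ^ 3 * f ∧
      axisNor G = X ^ 2 * (1 - X) ^ 2 * q ∧ bu ^ 2 ∣ G ∧ (1 - bu) ^ 2 ∣ G ∧ (1 - bv) ^ 2 ∣ G := by
  have h00 : (1 - bu).degreeOf 0 ≤ 1 := degreeOf_sub_le_of_le (by simp) (by simp)
  have h01 : (1 - bu).degreeOf 1 ≤ 0 :=
    degreeOf_sub_le_of_le (by simp) (MvPolynomial.degreeOf_X_of_ne (by decide)).le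
  have h10 : (1 - bv).degreeOf 0 ≤ 0 :=
    degreeOf_sub_le_of_le (by simp) (MvPolynomial.degreeOf_X_of_ne (by decide)).le
  have h11 : (1 - bv).degreeOf 1 ≤ 1 := degreeOf_sub_le_of_le (by simp) (by simp)
  have u0 : bu.degreeOf 0 ≤ 1 := by simp
  have u1 : bu.degreeOf 1 ≤ 0 := (MvPolynomial.degreeOf_X_of_ne (by decide)).le
  have v0 : bv.degreeOf 0 ≤ 0 := (MvPolynomial.degreeOf_X_of_ne (by decide)).le
  have v1 : bv.degreeOf 1 ≤ 1 := by simp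
  have w0 : (1 + MvPolynomial.C 2 * bv : Bivar).degreeOf 0 ≤ 0 :=
    degreeOf_add_le_of_le (by simp) ((MvPolynomial.degreeOf_C_mul_le _ _ _).trans v0)
  have w1 : (1 + MvPolynomial.C 2 * bv : Bivar).degreeOf 1 ≤ 1 :=
    degreeOf_add_le_of_le (by simp) ((MvPolynomial.degreeOf_C_mul_le _ _ _).trans v1)
  -- The factor (1 - v)²(1 + 2v) has value 1 and derivative 0 at v = 0 and vanishes doubly at v = 1.
  -- The factor v(1 - v)² has value 0 and derivative 1 at v = 0, so value and normal derivative are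
  -- prescribed independently.
  refine ⟨inU f * (bu ^ 3 * (1 - bu) ^ 3 * ((1 - bv) ^ 2 * (1 + MvPolynomial.C 2 * bv))) +
    inU q * (bu ^ 2 * (1 - bu) ^ 2 * (bv * (1 - bv) ^ 2)), ?_, ?_, ?_, ?_, ?_, ?_⟩
  · refine Submodule.add_mem _ (inU_mul_mem_rectangle hf (m := 6) ?_ (by omega) ?_)
      (inU_mul_mem_rectangle hq (m := 4) ?_ (by omega) ?_)
    · exact degreeOf_mul_le_add (degreeOf_mul_le_add (degreeOf_pow_le_mul u0 3)
        (degreeOf_pow_le_mul h00 3)) (degreeOf_mul_le_add (degreeOf_pow_le_mul h10 2) w0)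
    · refine (degreeOf_mul_le_add (degreeOf_mul_le_add (degreeOf_pow_le_mul u1 3)
        (degreeOf_pow_le_mul h01 3)) (degreeOf_mul_le_add (degreeOf_pow_le_mul h11 2) w1)).trans ?_
      omega
    · exact degreeOf_mul_le_add (degreeOf_mul_le_add (degreeOf_pow_le_mul u0 2)
        (degreeOf_pow_le_mul h00 2)) (degreeOf_mul_le_add v0 (degreeOf_pow_le_mul h10 2))
    · refine (degreeOf_mul_le_add (degreeOf_mul_le_add (degreeOf_pow_le_mul u1 2)
        (degreeOf_pow_le_mul h01 2)) (degreeOf_mul_le_add v1 (degreeOf_pow_le_mul h11 2))).trans ?_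
      omega
  · simp
    ring
  · simp only [map_add, axisNor_mul, axisNor_pow, axisNor_inU, axisVal_inU, map_mul, map_sub,
      map_pow, axisVal_u, axisVal_v, axisNor_u, axisNor_v, map_one, axisNor_one, axisNor_C,
      axisVal_C]
    simp
    ring
  · exact dvd_add (Dvd.intro_left
      (inU f * (bu * (1 - bu) ^ 3 * ((1 - bv) ^ 2 * (1 + MvPolynomial.C 2 * bv)))) (by ring))
      (Dvd.intro_left (inU q * ((1 - bu) ^ 2 * (bv * (1 - bv) ^ 2))) (by ring))
  · exact dvd_add (Dvd.intro_left
      (inU f * (bu ^ 3 * (1 - bu) * ((1 - bv) ^ 2 * (1 + MvPolynomial.C 2 * bv)))) (by ring))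
      (Dvd.intro_left (inU q * (bu ^ 2 * (bv * (1 - bv) ^ 2))) (by ring))
  · exact dvd_add (Dvd.intro_left
      (inU f * (bu ^ 3 * (1 - bu) ^ 3 * (1 + MvPolynomial.C 2 * bv))) (by ring))
      (Dvd.intro_left (inU q * (bu ^ 2 * (1 - bu) ^ 2 * bv)) (by ring))

/-- A function on a tile with prescribed value and normal derivative, vanishing to high order at
the end points, along one edge, and flat along the other edges. -/
theorem exists_trace (T : Tile) {k : ℕ} (hk : 5 ≤ k) (x : Fin T.sides × Bool) {f q : ℝ[X]}
    (hf : f ∈ degreeLT ℝ (k - 5)) (hq : q ∈ degreeLT ℝ (k - 4 + T.r)) :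
    ∃ g ∈ T.space k, axisVal (T.pull x.1 x.2 g) = X ^ 3 * (1 - X) ^ 3 * f ∧
      axisNor (T.pull x.1 x.2 g) = X ^ 2 * (1 - X) ^ 2 * q ∧
      ∀ y : Fin T.sides × Bool, flagEdge y ≠ flagEdge x →
        axisVal (T.pull y.1 y.2 g) = 0 ∧ axisNor (T.pull y.1 y.2 g) = 0 := by
  cases T with
  | triangle p h =>
    obtain ⟨G, hG, h1, h2, h3, h4⟩ := exists_polynomial_trace_triangle (p := p) (h := h) hk hf hq
    obtain ⟨g, hg⟩ := ((triangle p h).pull_bijective x.1 x.2).2 G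
    refine ⟨g, ((triangle p h).mem_space_iff k x.1 x.2 g).2 (by rw [hg]; exact hG),
      by rw [hg, h1], by rw [hg, h2], fun y hy => ?_⟩
    -- In coordinates attached to another edge, the squared equation of that edge becomes v², which
    -- kills both value and normal derivative.
    have d1 : bv ^ 2 ∣ swapHom G := by simpa using map_dvd swapHom h3
    have d2 : bv ^ 2 ∣ swapHom (revHom (triangle p h).rho G) := by
      have := map_dvd swapHom (map_dvd (revHom (triangle p h).rho) h4)
      have e : swapHom (revHom (triangle p h).rho (1 - bu - bv)) = bv := by simp [rho]; ring
      rwa [map_pow, map_pow, e] at this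
    have hr : ∀ H : Bivar, bv ^ 2 ∣ H → bv ^ 2 ∣ revHom (triangle p h).rho H := fun H hH => by
      simpa using map_dvd (revHom (triangle p h).rho) hH
    apply axis_eq_zero_of_v_sq_dvd
    rcases flags_off_edge_triangle x y hy with rfl | rfl | rfl | rfl
    · rw [pull_flagSwap, hg]; exact d1
    · rw [pull_flagRev, pull_flagSwap, hg]; exact hr _ d1
    · rw [pull_flagSwap, pull_flagRev, hg]; exact d2
    · rw [pull_flagRev, pull_flagSwap, pull_flagRev, hg]; exact hr _ d2
  | rectangle p h =>
    obtain ⟨G, hG, h1, h2, h3, h4, h5⟩ :=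
      exists_polynomial_trace_rectangle (p := p) (h := h) hk hf hq
    obtain ⟨g, hg⟩ := ((rectangle p h).pull_bijective x.1 x.2).2 G
    refine ⟨g, ((rectangle p h).mem_space_iff k x.1 x.2 g).2 (by rw [hg]; exact hG),
      by rw [hg, h1], by rw [hg, h2], fun y hy => ?_⟩
    have d1 : bv ^ 2 ∣ swapHom G := by simpa using map_dvd swapHom h3
    have d2 : bv ^ 2 ∣ swapHom (revHom (rectangle p h).rho G) := by
      have := map_dvd swapHom (map_dvd (revHom (rectangle p h).rho) h4)
      simpa [rho] using this
    have d3 : bv ^ 2 ∣ swapHom (revHom (rectangle p h).rho (swapHom G)) := by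
      have := map_dvd swapHom (map_dvd (revHom (rectangle p h).rho) (map_dvd swapHom h5))
      simpa [rho] using this
    have hr : ∀ H : Bivar, bv ^ 2 ∣ H → bv ^ 2 ∣ revHom (rectangle p h).rho H := fun H hH => by
      simpa using map_dvd (revHom (rectangle p h).rho) hH
    apply axis_eq_zero_of_v_sq_dvd
    rcases flags_off_edge_rectangle x y hy with rfl | rfl | rfl | rfl | rfl | rfl
    · rw [pull_flagSwap, hg]; exact d1
    · rw [pull_flagRev, pull_flagSwap, hg]; exact hr _ d1
    · rw [pull_flagSwap, pull_flagRev, hg]; exact d2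
    · rw [pull_flagRev, pull_flagSwap, pull_flagRev, hg]; exact hr _ d2
    · rw [pull_flagSwap, pull_flagRev, pull_flagSwap, hg]; exact d3
    · rw [pull_flagRev, pull_flagSwap, pull_flagRev, pull_flagSwap, hg]; exact hr _ d3

/-! ### Polynomials with a prescribed jet at one vertex -/

theorem C_three : (C 3 : ℝ[X]) = 3 := map_ofNat C 3

theorem C_six : (C 6 : ℝ[X]) = 6 := map_ofNat C 6

theorem C_nine : (C 9 : ℝ[X]) = 9 := map_ofNat C 9

theorem C_twelve : (C 12 : ℝ[X]) = 12 := map_ofNat C 12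

theorem coeff_quadratic_add (x y z : ℝ) (p : ℝ[X]) :
    (C x + C y * X + C z * X ^ 2 + X ^ 3 * p).coeff 0 = x ∧
    (C x + C y * X + C z * X ^ 2 + X ^ 3 * p).coeff 1 = y ∧
    (C x + C y * X + C z * X ^ 2 + X ^ 3 * p).coeff 2 = z := by
  have hc : ∀ i : ℕ, i < 3 → (X ^ 3 * p).coeff i = 0 :=
    fun i hi => X_pow_dvd_iff.1 (Dvd.intro _ rfl) i hi
  refine ⟨?_, ?_, ?_⟩
  · rw [coeff_add, hc 0 (by norm_num)]; simp
  · rw [coeff_add, hc 1 (by norm_num)]; simp [coeff_C]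
  · rw [coeff_add, hc 2 (by norm_num)]; simp

/-- A general polynomial of total degree at most two. -/
def quadratic (q : Fin 6 → ℝ) : Bivar :=
  MvPolynomial.C (q 0) + MvPolynomial.C (q 1) * bu + MvPolynomial.C (q 2) * bv +
    MvPolynomial.C (q 3) * bu ^ 2 + MvPolynomial.C (q 4) * bv ^ 2 +
    MvPolynomial.C (q 5) * (bu * bv)

theorem totalDegree_quadratic (q : Fin 6 → ℝ) : (quadratic q).totalDegree ≤ 2 := by
  have hu : bu.totalDegree ≤ 1 := (MvPolynomial.totalDegree_X _).le
  have hv : bv.totalDegree ≤ 1 := (MvPolynomial.totalDegree_X _).le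
  have hC : ∀ (x : ℝ) (G : Bivar), G.totalDegree ≤ 2 →
      (MvPolynomial.C x * G).totalDegree ≤ 2 := fun x G hG => by
    refine (totalDegree_mul_le_add (MvPolynomial.totalDegree_C x).le hG).trans (by norm_num)
  refine totalDegree_add_le_of_le (totalDegree_add_le_of_le (totalDegree_add_le_of_le
    (totalDegree_add_le_of_le (totalDegree_add_le_of_le ?_ ?_) ?_) ?_) ?_) ?_
  · simp
  · exact hC _ _ (hu.trans (by norm_num))
  · exact hC _ _ (hv.trans (by norm_num))
  · exact hC _ _ (totalDegree_pow_le_mul hu 2)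
  · exact hC _ _ (totalDegree_pow_le_mul hv 2)
  · exact hC _ _ (totalDegree_mul_le_add hu hv)

/-- The quadratic factor is the truncation of the product of the jet with (1 - u - v)⁻³ = 1 + 3(u +
v) + 6(u + v)² + …, hence the constants 3, 6 and 12. -/
theorem jet_triangle (j : Fin 6 → ℝ) : jet ((1 - bu - bv) ^ 3 * quadratic ![j 0, j 1 + 3 * j 0,
    j 2 + 3 * j 0, j 3 + 3 * j 1 + 6 * j 0, j 4 + 3 * j 2 + 6 * j 0,
    j 5 + 3 * j 1 + 3 * j 2 + 12 * j 0]) = j := by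
  set q : Fin 6 → ℝ := ![j 0, j 1 + 3 * j 0, j 2 + 3 * j 0, j 3 + 3 * j 1 + 6 * j 0,
    j 4 + 3 * j 2 + 6 * j 0, j 5 + 3 * j 1 + 3 * j 2 + 12 * j 0] with hq
  have e1 : axisVal ((1 - bu - bv) ^ 3 * quadratic q) = C (j 0) + C (j 1) * X + C (j 3) * X ^ 2 +
      X ^ 3 * (-C (j 0) + 3 * C (q 1) - 3 * C (q 3) + X * (-C (q 1) + 3 * C (q 3)) -
        X ^ 2 * C (q 3)) := by
    simp [quadratic, hq, C_three, C_six]; ring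
  have e2 : axisVal (swapHom ((1 - bu - bv) ^ 3 * quadratic q)) =
      C (j 0) + C (j 2) * X + C (j 4) * X ^ 2 +
      X ^ 3 * (-C (j 0) + 3 * C (q 2) - 3 * C (q 4) + X * (-C (q 2) + 3 * C (q 4)) -
        X ^ 2 * C (q 4)) := by
    simp [quadratic, hq, C_three, C_six]; ring
  have e3 : axisNor ((1 - bu - bv) ^ 3 * quadratic q) = C (j 2) + C (j 5) * X +
      C (-3 * q 0 + 6 * q 1 - 3 * q 3 + 3 * q 2 - 3 * q 5) * X ^ 2 +
      X ^ 3 * (-3 * C (q 1) + 6 * C (q 3) - C (q 2) + 3 * C (q 5) +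
        X * (-3 * C (q 3) - C (q 5))) := by
    simp [quadratic, hq, axisNor_pow, C_three, C_six, C_twelve]; ring
  obtain ⟨a0, a1, a2⟩ := e1 ▸ coeff_quadratic_add (j 0) (j 1) (j 3) _
  obtain ⟨b0, b1, b2⟩ := e2 ▸ coeff_quadratic_add (j 0) (j 2) (j 4) _
  obtain ⟨c0, c1, c2⟩ := e3 ▸ coeff_quadratic_add (j 2) (j 5) _ _
  ext i
  simp only [jet, LinearMap.coe_mk, AddHom.coe_mk, a0, a1, a2, b2, c0, c1]
  fin_cases i <;> rfl

/-- As for the triangle, with (1 - u)⁻³(1 - v)⁻³, whose uv coefficient is 9. -/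
theorem jet_rectangle (j : Fin 6 → ℝ) : jet ((1 - bu) ^ 3 * (1 - bv) ^ 3 *
    quadratic ![j 0, j 1 + 3 * j 0,
    j 2 + 3 * j 0, j 3 + 3 * j 1 + 6 * j 0, j 4 + 3 * j 2 + 6 * j 0,
    j 5 + 3 * j 1 + 3 * j 2 + 9 * j 0]) = j := by
  set q : Fin 6 → ℝ := ![j 0, j 1 + 3 * j 0, j 2 + 3 * j 0, j 3 + 3 * j 1 + 6 * j 0,
    j 4 + 3 * j 2 + 6 * j 0, j 5 + 3 * j 1 + 3 * j 2 + 9 * j 0] with hq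
  have e1 : axisVal ((1 - bu) ^ 3 * (1 - bv) ^ 3 * quadratic q) =
      C (j 0) + C (j 1) * X + C (j 3) * X ^ 2 +
      X ^ 3 * (-C (j 0) + 3 * C (q 1) - 3 * C (q 3) + X * (-C (q 1) + 3 * C (q 3)) -
        X ^ 2 * C (q 3)) := by
    simp [quadratic, hq, C_three, C_six]; ring
  have e2 : axisVal (swapHom ((1 - bu) ^ 3 * (1 - bv) ^ 3 * quadratic q)) =
      C (j 0) + C (j 2) * X + C (j 4) * X ^ 2 +
      X ^ 3 * (-C (j 0) + 3 * C (q 2) - 3 * C (q 4) + X * (-C (q 2) + 3 * C (q 4)) -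
        X ^ 2 * C (q 4)) := by
    simp [quadratic, hq, C_three, C_six]; ring
  have e3 : axisNor ((1 - bu) ^ 3 * (1 - bv) ^ 3 * quadratic q) = C (j 2) + C (j 5) * X +
      C (-9 * q 0 + 9 * q 1 - 3 * q 3 + 3 * q 2 - 3 * q 5) * X ^ 2 +
      X ^ 3 * (3 * C (q 0) - 9 * C (q 1) + 9 * C (q 3) - C (q 2) + 3 * C (q 5) +
        X * (3 * C (q 1) - 9 * C (q 3) - C (q 5)) + X ^ 2 * (3 * C (q 3))) := by
    simp [quadratic, hq, axisNor_pow, C_three, C_six, C_nine]; ring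
  obtain ⟨a0, a1, a2⟩ := e1 ▸ coeff_quadratic_add (j 0) (j 1) (j 3) _
  obtain ⟨b0, b1, b2⟩ := e2 ▸ coeff_quadratic_add (j 0) (j 2) (j 4) _
  obtain ⟨c0, c1, c2⟩ := e3 ▸ coeff_quadratic_add (j 2) (j 5) _ _
  ext i
  simp only [jet, LinearMap.coe_mk, AddHom.coe_mk, a0, a1, a2, b2, c0, c1]
  fin_cases i <;> rfl

/-- Arbitrary two-jets at one vertex are attained by functions with vanishing two-jets at the
other vertices. -/
theorem exists_jet (T : Tile) {k : ℕ} (hk : 5 ≤ k) (i : Fin T.sides) (j : Fin 6 → ℝ) :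
    ∃ g ∈ T.space k, jet (T.pull i false g) = j ∧ ∀ i' ≠ i, jet (T.pull i' false g) = 0 := by
  cases T with
  | triangle p h =>
    obtain ⟨g, hg⟩ := ((triangle p h).pull_bijective i false).2
      ((1 - bu - bv) ^ 3 * quadratic ![j 0, j 1 + 3 * j 0,
      j 2 + 3 * j 0, j 3 + 3 * j 1 + 6 * j 0, j 4 + 3 * j 2 + 6 * j 0,
      j 5 + 3 * j 1 + 3 * j 2 + 12 * j 0])
    refine ⟨g, ((triangle p h).mem_space_iff k i false g).2 ?_, by rw [hg, jet_triangle],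
      fun i' hi' => ?_⟩
    · rw [hg, mem_polySpace_triangle]
      exact (totalDegree_mul_le_add (totalDegree_pow_le_mul totalDegree_one_sub_sub 3)
        (totalDegree_quadratic _)).trans hk
    · set q := quadratic _ with hq
      have e0 : (triangle p h).pull i' false g = (triangle p h).pull
        ((i', false) : Fin (triangle p h).sides × Bool).1 ((i', false) : Fin _ × Bool).2 g := rfl
      -- The cubed linear factor vanishes on the opposite edge; in suitable coordinates at each
      -- other vertex it becomes u³, which has zero two-jet.
      have e1 : revHom (triangle p h).rho (1 - bu - bv) = bu := by simp [rho]; ring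
      have e2 : revHom (triangle p h).rho (swapHom (1 - bu - bv)) = bu := by simp [rho]
      rcases flags_off_vertex_triangle i i' hi' with e | e
      · rw [e0, e, pull_flagSwap, pull_flagRev, hg, jet_swapHom_eq_zero_iff]
        apply jet_eq_zero_of_u_pow_dvd
        rw [map_mul, map_pow, e1]
        exact dvd_mul_right _ _
      · rw [e0, e, pull_flagRev, pull_flagSwap, hg]
        apply jet_eq_zero_of_u_pow_dvd
        rw [map_mul, map_mul, map_pow, map_pow, e2]
        exact dvd_mul_right _ _
  | rectangle p h =>
    obtain ⟨g, hg⟩ := ((rectangle p h).pull_bijective i false).2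
      ((1 - bu) ^ 3 * (1 - bv) ^ 3 * quadratic ![j 0, j 1 + 3 * j 0,
      j 2 + 3 * j 0, j 3 + 3 * j 1 + 6 * j 0, j 4 + 3 * j 2 + 6 * j 0,
      j 5 + 3 * j 1 + 3 * j 2 + 9 * j 0])
    refine ⟨g, ((rectangle p h).mem_space_iff k i false g).2 ?_, by rw [hg, jet_rectangle],
      fun i' hi' => ?_⟩
    · rw [hg, mem_polySpace_rectangle]
      intro l
      have hq := (MvPolynomial.degreeOf_le_totalDegree _ l).trans (totalDegree_quadratic
        ![j 0, j 1 + 3 * j 0, j 2 + 3 * j 0, j 3 + 3 * j 1 + 6 * j 0, j 4 + 3 * j 2 + 6 * j 0,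
        j 5 + 3 * j 1 + 3 * j 2 + 9 * j 0])
      refine le_trans ?_ hk
      fin_cases l
      · exact degreeOf_mul_le_add (m := 3) (n := 2) (degreeOf_mul_le_add (m := 3) (n := 0)
          (degreeOf_pow_le_mul (degreeOf_sub_le_of_le (m := 1) (by simp) (by simp)) 3)
          (degreeOf_pow_le_mul (degreeOf_sub_le_of_le (m := 0) (by simp)
            (MvPolynomial.degreeOf_X_of_ne (by decide)).le) 3)) hq
      · exact degreeOf_mul_le_add (m := 3) (n := 2) (degreeOf_mul_le_add (m := 0) (n := 3)
          (degreeOf_pow_le_mul (degreeOf_sub_le_of_le (m := 0) (by simp)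
            (MvPolynomial.degreeOf_X_of_ne (by decide)).le) 3)
          (degreeOf_pow_le_mul (degreeOf_sub_le_of_le (m := 1) (by simp) (by simp)) 3)) hq
    · set q := quadratic _ with hq
      have e0 : (rectangle p h).pull i' false g = (rectangle p h).pull
        ((i', false) : Fin (rectangle p h).sides × Bool).1 ((i', false) : Fin _ × Bool).2 g := rfl
      have e1 : revHom (rectangle p h).rho (1 - bu) = bu := by simp [rho]
      have e2 : revHom (rectangle p h).rho (swapHom (1 - bv)) = bu := by simp [rho]
      have e3 : revHom (rectangle p h).rho (swapHom (revHom (rectangle p h).rho (1 - bv))) =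
        bu := by simp [rho]
      rcases flags_off_vertex_rectangle i i' hi' with e | e | e
      · rw [e0, e, pull_flagSwap, pull_flagRev, hg, jet_swapHom_eq_zero_iff]
        apply jet_eq_zero_of_u_pow_dvd
        simp only [map_mul, map_pow, e1]
        exact (dvd_mul_right _ _).mul_right _
      · rw [e0, e, pull_flagRev, pull_flagSwap, hg]
        apply jet_eq_zero_of_u_pow_dvd
        simp only [map_mul, map_pow, e2]
        exact (dvd_mul_left _ _).mul_right _
      · rw [e0, e, pull_flagSwap, pull_flagRev, pull_flagSwap, pull_flagRev, hg,
          jet_swapHom_eq_zero_iff]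
        apply jet_eq_zero_of_u_pow_dvd
        simp only [map_mul, map_pow, e3]
        exact (dvd_mul_left _ _).mul_right _

end Tile

end

end G1Spline

namespace G1Spline

noncomputable section

/-! ### Flag systems

The flags of a polygonal surface with the two involutions exchanging the edges at a corner
and crossing an interior edge. A flag fixed by `mate` is a flag on a boundary edge. -/

structure FlagSystem (X C V : Type*) where
  swap : X → X
  mate : X → X
  corner : X → C
  vertex : C → V
  /-- A distinguished flag at each vertex, on a boundary edge whenever possible. -/
  base : V → X
  swap_swap : ∀ x, swap (swap x) = x
  swap_ne : ∀ x, swap x ≠ x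
  mate_mate : ∀ x, mate (mate x) = x
  corner_eq_iff : ∀ x y, corner x = corner y ↔ y = x ∨ y = swap x
  corner_surjective : Function.Surjective corner
  vertex_mate : ∀ x, vertex (corner (mate x)) = vertex (corner x)
  vertex_induction : ∀ A : C → Prop, (∀ x, A (corner x) → A (corner (mate x))) →
    ∀ c c', vertex c = vertex c' → A c → A c'
  vertex_base : ∀ v, vertex (corner (base v)) = v
  mate_base : ∀ x, mate x = x →
    mate (base (vertex (corner x))) = base (vertex (corner x))

namespace FlagSystem

variable {X C V : Type*} (F : FlagSystem X C V)

def IsGlued (x : X) : Prop := F.mate x ≠ x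

theorem corner_swap (x : X) : F.corner (F.swap x) = F.corner x :=
  ((F.corner_eq_iff _ _).2 (Or.inr rfl)).symm

theorem isGlued_mate {x : X} (h : F.IsGlued x) : F.IsGlued (F.mate x) := fun e => h <| by
  rw [F.mate_mate] at e
  exact e.symm

theorem mate_injective : Function.Injective F.mate :=
  Function.LeftInverse.injective F.mate_mate

theorem isGlued_of_base {x : X} (h : F.IsGlued (F.base (F.vertex (F.corner x)))) : F.IsGlued x :=
  fun e => h (F.mate_base x e)

/-- Crossing the second edge of a flag. -/
def turn (x : X) : X := F.mate (F.swap x)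

theorem turn_injective : Function.Injective F.turn := fun _ _ h =>
  Function.LeftInverse.injective F.swap_swap (F.mate_injective h)

theorem swap_turn_of_swap_eq_turn {x y : X} (h : F.swap x = F.turn y) :
    F.swap (F.turn x) = y := by
  rw [turn, h, turn, F.mate_mate, F.swap_swap]

theorem turn_of_eq_swap_turn {x y : X} (h : x = F.swap (F.turn y)) : F.turn x = F.swap y := by
  rw [h, turn, F.swap_swap, turn, F.mate_mate]

/-- The flags met when going around a vertex. -/
def walk (v : V) (i : ℕ) : X := F.turn^[i] (F.base v)

@[simp] theorem walk_zero (v : V) : F.walk v 0 = F.base v := rfl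

theorem walk_succ (v : V) (i : ℕ) : F.walk v (i + 1) = F.turn (F.walk v i) :=
  Function.iterate_succ_apply' _ _ _

theorem mate_walk_succ (v : V) (i : ℕ) : F.mate (F.walk v (i + 1)) = F.swap (F.walk v i) := by
  rw [walk_succ, turn, F.mate_mate]

theorem vertex_walk (v : V) (i : ℕ) : F.vertex (F.corner (F.walk v i)) = v := by
  induction i with
  | zero => exact F.vertex_base v
  | succ i ih => rw [walk_succ, turn, F.vertex_mate, corner_swap, ih]

/-- Conjugation by `swap` inverts `turn`, so a coincidence between steps i and j yields one between
i + 1 and j - 1. The gap shrinks by two until `swap` fixes a flag or a flag at the vertex lies on a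
boundary edge, both impossible. Walks around interior vertices thus never reverse orientation. -/
theorem swap_walk_ne {v : V} (hv : F.IsGlued (F.base v)) (i j : ℕ) :
    F.swap (F.walk v i) ≠ F.walk v j := by
  suffices h : ∀ d i j, j = i + d → F.swap (F.walk v i) ≠ F.walk v j by
    rcases le_total i j with hij | hij
    · exact h (j - i) i j (by omega)
    · intro e
      refine h (i - j) j i (by omega) ?_
      rw [← e, F.swap_swap]
  intro d
  induction d using Nat.strong_induction_on with
  | _ d ih =>
    intro i j hj e
    match d, hj with
    | 0, hj =>
      rw [hj] at e
      exact F.swap_ne _ e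
    | 1, hj =>
      rw [hj, walk_succ, turn] at e
      refine F.isGlued_of_base (x := F.swap (F.walk v i)) ?_ e.symm
      rwa [corner_swap, vertex_walk]
    | d + 2, hj =>
      refine ih d (by omega) (i + 1) (i + 1 + d) rfl ?_
      rw [walk_succ]
      refine F.swap_turn_of_swap_eq_turn ?_
      rw [e, ← walk_succ]
      congr 1
      omega

/-- The valency of an interior vertex. -/
def valency (v : V) : ℕ := Function.minimalPeriod F.turn (F.base v)

theorem walk_add_valency (v : V) (i : ℕ) : F.walk v (i + F.valency v) = F.walk v i :=
  Function.iterate_add_minimalPeriod_eq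

theorem isGlued_walk {v : V} (hv : F.IsGlued (F.base v)) (i : ℕ) : F.IsGlued (F.walk v i) :=
  F.isGlued_of_base (by rwa [vertex_walk])

theorem walk_injOn_valency {v : V} (hv : F.IsGlued (F.base v)) {i j : ℕ} (hi : i < F.valency v)
    (hj : j < F.valency v) (h : F.corner (F.walk v i) = F.corner (F.walk v j)) : i = j := by
  rcases (F.corner_eq_iff _ _).1 h with e | e
  · exact Function.iterate_injOn_Iio_minimalPeriod hi hj e.symm
  · exact (F.swap_walk_ne hv _ _ e.symm).elim

variable [Finite X]

theorem exists_walk_period (v : V) : ∃ n, F.walk v (n + 1) = F.base v := by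
  obtain ⟨n, hn, h⟩ := F.turn_injective.mem_periodicPts (F.base v)
  refine ⟨n - 1, ?_⟩
  rw [Nat.sub_add_cancel hn]
  exact h

/-- The set of visited corners is closed under crossing either edge: forward is the next step,
backward the previous one. Behind the starting flag lies the last flag of the period, since `turn`
is injective on a finite set. -/
theorem exists_walk (c : C) : ∃ i, F.corner (F.walk (F.vertex c) i) = c := by
  refine F.vertex_induction (fun c' => ∃ i, F.corner (F.walk (F.vertex c) i) = c') ?_
    (F.corner (F.base (F.vertex c))) c (F.vertex_base _) ⟨0, rfl⟩
  rintro x ⟨i, hi⟩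
  rcases (F.corner_eq_iff _ _).1 hi with rfl | rfl
  · match i with
    | 0 =>
      obtain ⟨n, hn⟩ := F.exists_walk_period (F.vertex c)
      refine ⟨n, ?_⟩
      rw [walk_zero, ← hn, mate_walk_succ, corner_swap]
    | i + 1 => exact ⟨i, by rw [mate_walk_succ, corner_swap]⟩
  · exact ⟨i + 1, by rw [walk_succ, turn]⟩

open Classical in
/-- The position of a corner on the walk around its vertex. -/
def rank (c : C) : ℕ := Nat.find (F.exists_walk c)

/-- The flag through which the walk around the vertex first enters the corner. -/
def label (c : C) : X := F.walk (F.vertex c) (F.rank c)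

theorem corner_label (c : C) : F.corner (F.label c) = c := by
  classical exact Nat.find_spec (F.exists_walk c)

theorem rank_le {c : C} {i : ℕ} (h : F.corner (F.walk (F.vertex c) i) = c) : F.rank c ≤ i := by
  classical exact Nat.find_min' _ h

theorem label_injective : Function.Injective F.label :=
  Function.LeftInverse.injective F.corner_label

theorem eq_label_or (x : X) : x = F.label (F.corner x) ∨ x = F.swap (F.label (F.corner x)) :=
  (F.corner_eq_iff _ _).1 (F.corner_label _)

theorem vertex_label (c : C) : F.vertex (F.corner (F.label c)) = F.vertex c := by
  rw [corner_label]

/-- The corner across the edge of the label. -/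
def prev (c : C) : C := F.corner (F.mate (F.label c))

theorem vertex_prev (c : C) : F.vertex (F.prev c) = F.vertex c := by
  rw [prev, F.vertex_mate, vertex_label]

theorem isGlued_label_of_rank_ne {c : C} (h : F.rank c ≠ 0) : F.IsGlued (F.label c) := by
  obtain ⟨i, hi⟩ := Nat.exists_eq_succ_of_ne_zero h
  intro e
  rw [label, hi, Nat.succ_eq_add_one, mate_walk_succ] at e
  have := F.rank_le (c := c) (i := i) (by
    rw [← corner_swap, e, ← Nat.succ_eq_add_one, ← hi]
    exact F.corner_label c)
  omega

/-- The step before c is first reached stands in `prev c`. If that flag were not the label of its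
corner, the walk would already have passed through `prev c` in the opposite sense and met c earlier,
against minimality of the rank. At a boundary vertex this rules out the part of the walk after it
bounces off the far boundary edge. -/
theorem label_prev_of_rank_ne {c : C} (h : F.rank c ≠ 0) :
    F.rank (F.prev c) < F.rank c ∧ F.mate (F.label c) = F.swap (F.label (F.prev c)) := by
  obtain ⟨i, hi⟩ := Nat.exists_eq_succ_of_ne_zero h
  rw [Nat.succ_eq_add_one] at hi
  have hm : F.mate (F.label c) = F.swap (F.walk (F.vertex c) i) := by
    rw [label, hi, mate_walk_succ]
  have hp : F.prev c = F.corner (F.walk (F.vertex c) i) := by rw [prev, hm, corner_swap]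
  have hle : F.rank (F.prev c) ≤ i := F.rank_le (by rw [vertex_prev, hp])
  refine ⟨by omega, ?_⟩
  have hl : F.label (F.prev c) = F.walk (F.vertex c) (F.rank (F.prev c)) := by
    rw [label, vertex_prev]
  rw [hm]
  rcases (F.corner_eq_iff _ _).1 ((F.corner_label (F.prev c)).trans hp) with e | e
  · rw [← e]
  · exfalso
    have hc : F.corner (F.walk (F.vertex c) (i + 1)) = c := by
      rw [← hi]
      exact F.corner_label c
    rcases Nat.eq_zero_or_pos (F.rank (F.prev c)) with h0 | h0
    · rw [h0, walk_zero] at hl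
      by_cases hb : F.IsGlued (F.base (F.vertex c))
      · refine F.swap_walk_ne hb 0 i ?_
        rw [walk_zero, e, hl]
      · have : F.walk (F.vertex c) (i + 1) = F.base (F.vertex c) := by
          rw [walk_succ, e, hl, turn, F.swap_swap]
          exact not_not.1 hb
        have := F.rank_le (c := c) (i := 0) (by rw [walk_zero, ← this, hc])
        omega
    · obtain ⟨j, hj⟩ := Nat.exists_eq_succ_of_ne_zero h0.ne'
      rw [Nat.succ_eq_add_one] at hj
      rw [hl, hj, walk_succ] at e
      have hj' : F.corner (F.walk (F.vertex c) j) = c := by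
        rw [← F.corner_swap, ← F.turn_of_eq_swap_turn e, ← walk_succ, hc]
      have := F.rank_le hj'
      omega

theorem rank_corner_base (v : V) : F.rank (F.corner (F.base v)) = 0 :=
  Nat.le_zero.1 (F.rank_le (by rw [F.vertex_base, walk_zero]))

theorem label_corner_base (v : V) : F.label (F.corner (F.base v)) = F.base v := by
  rw [label, rank_corner_base, F.vertex_base, walk_zero]

theorem label_of_rank_eq_zero {c : C} (h : F.rank c = 0) : F.label c = F.base (F.vertex c) := by
  rw [label, h, walk_zero]

/-- For rank 0 a glued label means an interior vertex. The flag before the base is then the last of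
the period, and `swap_walk_ne` decides which of the two flags of its corner it is. -/
theorem mate_label {c : C} (h : F.IsGlued (F.label c)) :
    F.mate (F.label c) = F.swap (F.label (F.prev c)) := by
  by_cases h0 : F.rank c = 0
  · rw [F.label_of_rank_eq_zero h0] at h
    rcases F.eq_label_or (F.mate (F.label c)) with e | e
    · exfalso
      obtain ⟨n, hn⟩ := F.exists_walk_period (F.vertex c)
      rw [F.label_of_rank_eq_zero h0, label, F.vertex_mate, F.vertex_base, ← hn,
        mate_walk_succ] at e
      exact F.swap_walk_ne h _ _ e
    · exact e
  · exact (F.label_prev_of_rank_ne h0).2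

theorem prev_injOn {c c' : C} (h : F.IsGlued (F.label c)) (h' : F.IsGlued (F.label c'))
    (e : F.prev c = F.prev c') : c = c' := by
  apply F.label_injective
  apply F.mate_injective
  rw [F.mate_label h, F.mate_label h', e]

/-- If neither side of the edge were a label, both would be second flags of their corners, and
following the walk from either corner bounds each rank by the other plus one. All three possible
differences contradict that `swap` has no fixed flag or that the edge is glued. -/
theorem exists_label {x : X} (h : F.IsGlued x) :
    ∃ c, x = F.label c ∨ F.mate x = F.label c := by
  rcases F.eq_label_or x with e | e
  · exact ⟨_, Or.inl e⟩
  rcases F.eq_label_or (F.mate x) with e' | e'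
  · exact ⟨_, Or.inr e'⟩
  exfalso
  set v := F.vertex (F.corner x) with hv
  set i := F.rank (F.corner x) with hi
  set j := F.rank (F.corner (F.mate x)) with hj
  have h1 : x = F.swap (F.walk v i) := e
  have h2 : F.mate x = F.walk v (i + 1) := by rw [walk_succ, turn, ← h1]
  have h3 : F.walk v (i + 1) = F.swap (F.walk v j) := by
    rw [← h2, e', label, F.vertex_mate]
  have h4 : j ≤ i + 1 := F.rank_le (by rw [F.vertex_mate, ← hv, ← h2])
  have h5 : F.walk v (j + 1) = F.swap (F.walk v i) := by
    rw [walk_succ, turn, ← h3, mate_walk_succ]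
  have h6 : i ≤ j + 1 := F.rank_le (by rw [← hv, h5, ← h1])
  have h7 : j = i + 1 ∨ j = i ∨ j + 1 = i := by omega
  rcases h7 with h7 | h7 | h7
  · rw [h7] at h3
    exact F.swap_ne _ h3.symm
  · rw [h7, ← h2, ← h1] at h3
    exact h h3
  · rw [h7] at h5
    exact F.swap_ne _ h5.symm

/-- Every interior edge is entered exactly once by the walks. -/
theorem bijective_glued : Function.Bijective
    (fun y : {c // F.IsGlued (F.label c)} × Bool =>
      (⟨if y.2 then F.mate (F.label y.1) else F.label y.1, by
        split
        · exact F.isGlued_mate y.1.2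
        · exact y.1.2⟩ : {x // F.IsGlued x})) := by
  have key : ∀ c c' : C, F.IsGlued (F.label c) → F.mate (F.label c) ≠ F.label c' := by
    intro c c' hc e
    have h := F.mate_label hc
    have : c' = F.prev c := by rw [← F.corner_label c', ← e, prev]
    rw [e, this] at h
    exact F.swap_ne _ h.symm
  constructor
  · rintro ⟨⟨c, hc⟩, d⟩ ⟨⟨c', hc'⟩, d'⟩ e
    have e := congrArg Subtype.val e
    cases d <;> cases d' <;> simp only [Bool.false_eq_true, if_true, if_false] at e
    · simp only [F.label_injective e]
    · exact (key _ _ hc' e.symm).elim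
    · exact (key _ _ hc e).elim
    · simp only [F.label_injective (F.mate_injective e)]
  · rintro ⟨x, hx⟩
    obtain ⟨c, e | e⟩ := F.exists_label hx
    · exact ⟨(⟨c, e ▸ hx⟩, false), Subtype.ext e.symm⟩
    · refine ⟨(⟨c, e ▸ F.isGlued_mate hx⟩, true), Subtype.ext ?_⟩
      change F.mate (F.label c) = x
      rw [← e, F.mate_mate]

theorem card_glued : Nat.card {x // F.IsGlued x} = 2 * Nat.card {c // F.IsGlued (F.label c)} := by
  rw [← Nat.card_congr (Equiv.ofBijective _ F.bijective_glued), Nat.card_prod]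
  simp [mul_comm]

theorem card_rank_eq_zero : Nat.card {c // F.rank c = 0} = Nat.card V := by
  refine Nat.card_congr (Equiv.ofBijective (fun c => F.vertex c.1) ⟨?_, fun v => ?_⟩)
  · rintro ⟨c, hc⟩ ⟨c', hc'⟩ e
    refine Subtype.ext (F.label_injective ?_)
    rw [F.label_of_rank_eq_zero hc, F.label_of_rank_eq_zero hc']
    exact congrArg _ e
  · exact ⟨⟨_, F.rank_corner_base v⟩, F.vertex_base v⟩

theorem card_corner [Finite C] :
    Nat.card C = Nat.card V + Nat.card {c // F.rank c ≠ 0} := by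
  rw [← F.card_rank_eq_zero, ← Nat.card_sum]
  classical exact (Nat.card_congr (Equiv.sumCompl _)).symm

/-- For a property depending on the distinguished flags only. -/
theorem card_root (Q : X → Prop) :
    Nat.card {c // F.rank c = 0 ∧ Q (F.label c)} = Nat.card {v // Q (F.base v)} := by
  refine Nat.card_congr (Equiv.ofBijective
    (fun c => ⟨F.vertex c.1, F.label_of_rank_eq_zero c.2.1 ▸ c.2.2⟩) ⟨?_, fun v => ?_⟩)
  · rintro ⟨c, hc⟩ ⟨c', hc'⟩ e
    refine Subtype.ext (F.label_injective ?_)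
    rw [F.label_of_rank_eq_zero hc.1, F.label_of_rank_eq_zero hc'.1]
    exact congrArg (fun v => F.base v.1) e
  · exact ⟨⟨_, F.rank_corner_base v, by rw [label_corner_base]; exact v.2⟩,
      Subtype.ext (F.vertex_base v)⟩

/-- A label is glued at every corner of positive rank. At rank 0 it is the base flag, which is glued
exactly when the vertex is interior, by the choice of bases. -/
theorem card_glued_label [Finite C] : Nat.card {c // F.IsGlued (F.label c)} =
    Nat.card {c // F.rank c ≠ 0} + Nat.card {v // F.IsGlued (F.base v)} := by
  rw [← F.card_root, ← Nat.card_sum]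
  classical
  refine (Nat.card_congr (Equiv.ofBijective (Sum.elim
    (fun c => ⟨c.1, F.isGlued_label_of_rank_ne c.2⟩) (fun c => ⟨c.1, c.2.2⟩)) ⟨?_, ?_⟩)).symm
  · rintro (c | c) (c' | c') e <;> simp only [Sum.elim_inl, Sum.elim_inr, Subtype.mk.injEq] at e
    · rw [Subtype.ext e]
    · exact (c.2 (e ▸ c'.2.1)).elim
    · exact (c'.2 (e ▸ c.2.1)).elim
    · rw [Subtype.ext e]
  · rintro ⟨c, hc⟩
    by_cases h : F.rank c = 0
    · exact ⟨Sum.inr ⟨c, h, hc⟩, rfl⟩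
    · exact ⟨Sum.inl ⟨c, h⟩, rfl⟩

theorem card_flags (F : FlagSystem X C V) : Nat.card X = 2 * Nat.card C := by
  have : Function.Bijective (fun y : C × Bool =>
      if y.2 then F.swap (F.label y.1) else F.label y.1) := by
    constructor
    · rintro ⟨c, d⟩ ⟨c', d'⟩ e
      have hc : c = c' := by
        have := congrArg F.corner e
        cases d <;> cases d' <;> simpa [corner_swap, corner_label] using this
      subst hc
      cases d <;> cases d' <;> simp only [Bool.false_eq_true, if_true, if_false] at e ⊢
      · exact (F.swap_ne _ e.symm).elim
      · exact (F.swap_ne _ e).elim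
    · intro x
      rcases F.eq_label_or x with e | e
      · exact ⟨(F.corner x, false), e.symm⟩
      · exact ⟨(F.corner x, true), e.symm⟩
  rw [← Nat.card_congr (Equiv.ofBijective _ this), Nat.card_prod]
  simp [mul_comm]

/-! ### Interior vertices -/

theorem valency_pos (v : V) : 0 < F.valency v :=
  Function.minimalPeriod_pos_of_mem_periodicPts (F.turn_injective.mem_periodicPts _)

theorem label_corner_walk {v : V} (hv : F.IsGlued (F.base v)) (i : ℕ) :
    F.label (F.corner (F.walk v i)) = F.walk v i := by
  rcases F.eq_label_or (F.walk v i) with e | e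
  · exact e.symm
  · rw [label, vertex_walk] at e
    exact (F.swap_walk_ne hv _ _ e.symm).elim

theorem rank_corner_walk {v : V} (hv : F.IsGlued (F.base v)) {i : ℕ} (hi : i < F.valency v) :
    F.rank (F.corner (F.walk v i)) = i := by
  have h1 : F.rank (F.corner (F.walk v i)) ≤ i := F.rank_le (by rw [vertex_walk])
  refine F.walk_injOn_valency hv (h1.trans_lt hi) hi ?_
  have := F.corner_label (F.corner (F.walk v i))
  rwa [label, vertex_walk] at this

end FlagSystem

end

end G1Spline

namespace G1Spline

noncomputable section

/-! ### First order conditions at the end of an edge -/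

/-- The conditions which an edge with the data `z = (a, b, c)` imposes on the two-jets, at its
origin, of a `G¹` function: the first three express continuity, the other two the first order
compatibility of the normal derivatives. -/
def edgeCond (z : Fin 3 → ℝ[X]) (j j' : Fin 6 → ℝ) : Fin 5 → ℝ :=
  ![j 0 - j' 0, j 1 - j' 1, j 3 - j' 3,
    (z 0).coeff 0 * j 2 - (z 1).coeff 0 * j' 1 - (z 2).coeff 0 * j' 2,
    (z 0).coeff 0 * j 5 + (z 0).coeff 1 * j 2 - 2 * (z 1).coeff 0 * j' 3 - (z 1).coeff 1 * j' 1
      - (z 2).coeff 0 * j' 5 - (z 2).coeff 1 * j' 2]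

/-- The effect on two-jets of exchanging the coordinates. -/
def swapJet (j : Fin 6 → ℝ) : Fin 6 → ℝ := ![j 0, j 2, j 1, j 4, j 3, j 5]

theorem swapJet_swapJet (j : Fin 6 → ℝ) : swapJet (swapJet j) = j := by
  ext i; fin_cases i <;> rfl

theorem swapJet_add (j j' : Fin 6 → ℝ) : swapJet (j + j') = swapJet j + swapJet j' := by
  ext i; fin_cases i <;> rfl

theorem swapJet_smul (x : ℝ) (j : Fin 6 → ℝ) : swapJet (x • j) = x • swapJet j := by
  ext i; fin_cases i <;> rfl

theorem edgeCond_add (z : Fin 3 → ℝ[X]) (i i' j j' : Fin 6 → ℝ) :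
    edgeCond z (i + j) (i' + j') = edgeCond z i i' + edgeCond z j j' := by
  ext n; fin_cases n <;> simp [edgeCond] <;> ring

theorem edgeCond_smul (z : Fin 3 → ℝ[X]) (x : ℝ) (j j' : Fin 6 → ℝ) :
    edgeCond z (x • j) (x • j') = x • edgeCond z j j' := by
  ext n; fin_cases n <;> simp [edgeCond] <;> ring

theorem edgeCond_eq_zero {z : Fin 3 → ℝ[X]} {j j' : Fin 6 → ℝ} : edgeCond z j j' = 0 ↔
    j 0 = j' 0 ∧ j 1 = j' 1 ∧ j 3 = j' 3 ∧
    (z 0).coeff 0 * j 2 = (z 1).coeff 0 * j' 1 + (z 2).coeff 0 * j' 2 ∧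
    (z 0).coeff 0 * j 5 + (z 0).coeff 1 * j 2 = 2 * (z 1).coeff 0 * j' 3 + (z 1).coeff 1 * j' 1 +
      (z 2).coeff 0 * j' 5 + (z 2).coeff 1 * j' 2 := by
  constructor
  · intro h
    have h0 := congrFun h 0
    have h1 := congrFun h 1
    have h2 := congrFun h 2
    have h3 := congrFun h 3
    have h4 := congrFun h 4
    simp [edgeCond] at h0 h1 h2 h3 h4
    exact ⟨by linarith, by linarith, by linarith, by linarith, by linarith⟩
  · rintro ⟨h0, h1, h2, h3, h4⟩
    ext n
    fin_cases n <;> simp [edgeCond] <;> linarith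

/-- Reading aq = bp' + cq' from the other side replaces (a, b, c) by (c, -b, a), so each edge need
only be tested from one side. -/
theorem edgeCond_mate {z : Fin 3 → ℝ[X]} {j j' : Fin 6 → ℝ} (h : edgeCond z j j' = 0) :
    edgeCond ![z 2, -z 1, z 0] j' j = 0 := by
  rw [edgeCond_eq_zero] at h ⊢
  obtain ⟨h0, h1, h2, h3, h4⟩ := h
  simp only [Matrix.cons_val_zero, Matrix.cons_val_one, Matrix.cons_val, coeff_neg]
  refine ⟨h0.symm, h1.symm, h2.symm, ?_, ?_⟩
  · rw [h1]; linarith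
  · rw [h1, h2]; linarith

/-- The conditions are triangular in the unknown jet, with pivots 1 and a(0). The entry 4, the
second derivative across the edge, does not occur and remains free. -/
theorem exists_edgeCond {z : Fin 3 → ℝ[X]} (hz : (z 0).coeff 0 ≠ 0) (j' : Fin 6 → ℝ)
    (s : Fin 5 → ℝ) : ∃ j, edgeCond z j j' = s := by
  set q := (s 3 + (z 1).coeff 0 * j' 1 + (z 2).coeff 0 * j' 2) / (z 0).coeff 0 with hq
  refine ⟨![s 0 + j' 0, s 1 + j' 1, q, s 2 + j' 3, 0,
    (s 4 - (z 0).coeff 1 * q + 2 * (z 1).coeff 0 * j' 3 + (z 1).coeff 1 * j' 1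
      + (z 2).coeff 0 * j' 5 + (z 2).coeff 1 * j' 2) / (z 0).coeff 0], ?_⟩
  ext n
  fin_cases n <;> simp [edgeCond]
  · rw [hq]; field_simp; ring
  · field_simp; ring

/-- Changing pure second derivatives touches only the conditions 2 and 4. This freedom is what later
satisfies the closing edge of an interior vertex without disturbing the other edges. -/
theorem edgeCond_add_second_order (z : Fin 3 → ℝ[X]) (j j' : Fin 6 → ℝ) (x y x' y' : ℝ) :
    edgeCond z (j + ![0, 0, 0, x, y, 0]) (swapJet (j' + ![0, 0, 0, x', y', 0])) =
      edgeCond z j (swapJet j') + ![0, 0, x - y', 0, -2 * (z 1).coeff 0 * y'] := by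
  ext n
  fin_cases n <;> simp [edgeCond, swapJet] <;> ring

/-- The transformation of gradients across an edge, at its origin. -/
def transition (z : Fin 3 → ℝ[X]) : Matrix (Fin 2) (Fin 2) ℝ :=
  !![0, 1; (z 2).coeff 0 / (z 0).coeff 0, (z 1).coeff 0 / (z 0).coeff 0]

/-- The derivative at the origin of a quotient of polynomials. -/
def slope (p q : ℝ[X]) : ℝ :=
  (p.coeff 1 * q.coeff 0 - p.coeff 0 * q.coeff 1) / q.coeff 0 ^ 2

namespace FlagSystem

variable {X C V : Type*} (F : FlagSystem X C V)

/-- Families of two-jets, one for each flag, which are compatible with the exchange of the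
coordinates. -/
def jetSpace : Submodule ℝ (X → Fin 6 → ℝ) where
  carrier := {J | ∀ x, J (F.swap x) = swapJet (J x)}
  zero_mem' x := by ext i; fin_cases i <;> rfl
  add_mem' h h' x := by simp only [Pi.add_apply, h x, h' x, swapJet_add]
  smul_mem' r J h x := by simp only [Pi.smul_apply, h x, swapJet_smul]

/-- The conditions on the two-jets of a `G¹` function along all interior edges. -/
def compatibleJets (z : X → Fin 3 → ℝ[X]) : Submodule ℝ (X → Fin 6 → ℝ) where
  carrier := {J | J ∈ F.jetSpace ∧
    ∀ x, F.IsGlued x → edgeCond (z x) (J x) (J (F.mate x)) = 0}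
  zero_mem' := ⟨Submodule.zero_mem _, fun x _ => by
    ext n; fin_cases n <;> simp [edgeCond]⟩
  add_mem' h h' := ⟨Submodule.add_mem _ h.1 h'.1, fun x hx => by
    simp only [Pi.add_apply, edgeCond_add, h.2 x hx, h'.2 x hx, add_zero]⟩
  smul_mem' r J h := ⟨Submodule.smul_mem _ r h.1, fun x hx => by
    simp only [Pi.smul_apply, edgeCond_smul, h.2 x hx, smul_zero]⟩

theorem mem_compatibleJets {z : X → Fin 3 → ℝ[X]} {J : X → Fin 6 → ℝ} :
    J ∈ F.compatibleJets z ↔ J ∈ F.jetSpace ∧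
      ∀ x, F.IsGlued x → edgeCond (z x) (J x) (J (F.mate x)) = 0 := Iff.rfl

/-- The product of the transitions met on the first steps of the walk around a vertex. -/
def turnProd (z : X → Fin 3 → ℝ[X]) (v : V) : ℕ → Matrix (Fin 2) (Fin 2) ℝ
  | 0 => 1
  | i + 1 => transition (z (F.walk v (i + 1))) * turnProd z v i

/-- The data at the origins of the edges satisfy the compatibility conditions around interior
vertices. -/
structure IsCompatible (z : X → Fin 3 → ℝ[X]) : Prop where
  ne_zero : ∀ x, F.IsGlued x → (z x 0).coeff 0 ≠ 0
  mate : ∀ x, F.IsGlued x → z (F.mate x) = ![z x 2, -z x 1, z x 0]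
  turnProd_eq_one : ∀ v, F.IsGlued (F.base v) → F.turnProd z v (F.valency v) = 1
  valency_of_joining : ∀ v, F.IsGlued (F.base v) → (z (F.base v) 1).coeff 0 = 0 →
    F.valency v = 4 ∧ ∀ i, (z (F.walk v i) 1).coeff 0 = 0
  crossing : ∀ v, F.IsGlued (F.base v) → (z (F.base v) 1).coeff 0 = 0 →
    ∀ z' : ℕ → Fin 3 → ℝ[X], (∀ i, z' i = z (F.walk v (i + 1))) →
      slope (z' 0 1) (z' 0 0) + slope (z' 1 2) (z' 1 0) * ((z' 1 0).coeff 0 / (z' 1 2).coeff 0) =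
        -((z' 0 2).coeff 0 / (z' 0 0).coeff 0) * (slope (z' 2 1) (z' 2 0) +
          slope (z' 3 2) (z' 3 0) * ((z' 3 0).coeff 0 / (z' 3 2).coeff 0)) ∧
      slope (z' 1 1) (z' 1 0) + slope (z' 2 2) (z' 2 0) * ((z' 2 0).coeff 0 / (z' 2 2).coeff 0) =
        -((z' 1 2).coeff 0 / (z' 1 0).coeff 0) * (slope (z' 3 1) (z' 3 0) +
          slope (z' 0 2) (z' 0 0) * ((z' 0 0).coeff 0 / (z' 0 2).coeff 0))

variable {F} {z : X → Fin 3 → ℝ[X]}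

theorem IsCompatible.ne_zero' (h : F.IsCompatible z) {x : X} (hx : F.IsGlued x) :
    (z x 2).coeff 0 ≠ 0 := by
  have := h.ne_zero _ (F.isGlued_mate hx)
  rwa [h.mate x hx] at this

variable [Finite X]

theorem restrict_labels_bijective : Function.Bijective
    ((LinearMap.funLeft ℝ (Fin 6 → ℝ) F.label).domRestrict F.jetSpace) := by
  classical
  constructor
  · rintro ⟨J, hJ⟩ ⟨J', hJ'⟩ e
    have e : ∀ c, J (F.label c) = J' (F.label c) := fun c => congrFun e c
    refine Subtype.ext (funext fun x => ?_)
    rcases F.eq_label_or x with h | h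
    · rw [h]
      exact e _
    · change J x = J' x
      rw [h, hJ, hJ', e]
  · intro h
    refine ⟨⟨fun x => if x = F.label (F.corner x) then h (F.corner x)
      else swapJet (h (F.corner x)), fun x => ?_⟩, ?_⟩
    · beta_reduce
      rw [F.corner_swap]
      rcases F.eq_label_or x with e | e
      · rw [if_pos e, if_neg]
        exact fun e' => F.swap_ne x (e'.trans e.symm)
      · rw [if_neg (fun e' => F.swap_ne _ (e.symm.trans e')), if_pos, swapJet_swapJet]
        rw [e, F.swap_swap, F.corner_swap, F.corner_label]
    · ext1 c
      change ite _ _ _ = _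
      rw [F.corner_label, if_pos rfl]

/-- Jets are chosen along the walks, by induction on the rank: each condition determines the jet at
a corner from that at its predecessor, which has smaller rank. -/
theorem exists_labelCond (hz : F.IsCompatible z) (s : C → Fin 5 → ℝ) (N : ℕ) :
    ∃ h : C → Fin 6 → ℝ, ∀ c, F.rank c ≠ 0 → F.rank c ≤ N →
      edgeCond (z (F.label c)) (h c) (swapJet (h (F.prev c))) = s c := by
  induction N with
  | zero => exact ⟨0, fun c h0 h1 => (h0 (Nat.le_zero.1 h1)).elim⟩
  | succ N ih =>
    obtain ⟨h, hh⟩ := ih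
    have key : ∀ c, ∃ j, F.rank c ≠ 0 →
        edgeCond (z (F.label c)) j (swapJet (h (F.prev c))) = s c := fun c => by
      by_cases h0 : F.rank c = 0
      · exact ⟨0, fun h' => (h' h0).elim⟩
      · obtain ⟨j, hj⟩ := exists_edgeCond (hz.ne_zero _ (F.isGlued_label_of_rank_ne h0))
          (swapJet (h (F.prev c))) (s c)
        exact ⟨j, fun _ => hj⟩
    choose H hH using key
    refine ⟨fun c => if F.rank c ≤ N then h c else H c, fun c h0 h1 => ?_⟩
    have h2 := (F.label_prev_of_rank_ne h0).1
    beta_reduce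
    rw [if_pos (show F.rank (F.prev c) ≤ N by omega)]
    split
    · exact hh c h0 ‹_›
    · exact hH c h0

variable [Finite C]

theorem finrank_jetSpace : Module.finrank ℝ F.jetSpace = 6 * Nat.card C := by
  have := Fintype.ofFinite C
  rw [(LinearEquiv.ofBijective _ (F.restrict_labels_bijective)).finrank_eq]
  simp [Module.finrank_pi_fintype, mul_comm]

theorem finite_jetSpace : Module.Finite ℝ F.jetSpace :=
  Module.Finite.equiv (LinearEquiv.ofBijective _ (F.restrict_labels_bijective)).symm

variable (F z) in
/-- The index set for independent conditions on two-jets. -/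
abbrev CondIndex : Type _ :=
  ({c // F.rank c ≠ 0} × Fin 5) ⊕ {c // F.rank c = 0 ∧ F.IsGlued (F.label c)} ⊕
    {c // F.rank c = 0 ∧ F.IsGlued (F.label c) ∧ (z (F.label c) 1).coeff 0 ≠ 0}

variable (F z) in
/-- The conditions for the edge of the label of a corner. -/
def labelCond (c : C) : (X → Fin 6 → ℝ) →ₗ[ℝ] (Fin 5 → ℝ) where
  toFun J := edgeCond (z (F.label c)) (J (F.label c)) (J (F.mate (F.label c)))
  map_add' J J' := by simp only [Pi.add_apply, edgeCond_add]
  map_smul' r J := by simp only [Pi.smul_apply, edgeCond_smul, RingHom.id_apply]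

variable (F z) in
/-- A maximal system of independent conditions. -/
def conditions : (X → Fin 6 → ℝ) →ₗ[ℝ] (CondIndex F z → ℝ) :=
  LinearMap.pi (Sum.elim (fun y => LinearMap.proj y.2 ∘ₗ F.labelCond z y.1)
    (Sum.elim (fun c => LinearMap.proj 2 ∘ₗ F.labelCond z c)
      (fun c => LinearMap.proj 4 ∘ₗ F.labelCond z c)))

/-- After the conditions at positive rank are solved, each interior root is corrected by x in the
entry 3 of its own jet and by y in the entry 4 of its predecessor's jet. Among the label conditions
these entries enter only the one on the closing edge. The value y meets the mixed condition when
b(0) ≠ 0, and x then meets the remaining one. -/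
theorem map_conditions (hz : F.IsCompatible z) : F.jetSpace.map (F.conditions z) = ⊤ := by
  classical
  rw [eq_top_iff]
  rintro s -
  obtain ⟨N, hN⟩ : ∃ N, ∀ c, F.rank c ≤ N := by
    obtain ⟨N, hN⟩ := (Set.finite_range F.rank).bddAbove
    exact ⟨N, fun c => hN ⟨c, rfl⟩⟩
  obtain ⟨h, hh⟩ := exists_labelCond hz
    (fun c n => if h0 : F.rank c ≠ 0 then s (Sum.inl (⟨c, h0⟩, n)) else 0) N
  have root : ∀ c, ∃ x y : ℝ,
      (∀ hc : F.rank c = 0 ∧ F.IsGlued (F.label c),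
        edgeCond (z (F.label c)) (h c) (swapJet (h (F.prev c))) 2 + (x - y) =
          s (Sum.inr (Sum.inl ⟨c, hc⟩))) ∧
      (∀ hc : F.rank c = 0 ∧ F.IsGlued (F.label c) ∧ (z (F.label c) 1).coeff 0 ≠ 0,
        edgeCond (z (F.label c)) (h c) (swapJet (h (F.prev c))) 4 +
          (-2 * (z (F.label c) 1).coeff 0 * y) = s (Sum.inr (Sum.inr ⟨c, hc⟩))) := by
    intro c
    have h1 : ∃ y : ℝ, ∀ hc : F.rank c = 0 ∧ F.IsGlued (F.label c) ∧
        (z (F.label c) 1).coeff 0 ≠ 0,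
        edgeCond (z (F.label c)) (h c) (swapJet (h (F.prev c))) 4 +
          (-2 * (z (F.label c) 1).coeff 0 * y) = s (Sum.inr (Sum.inr ⟨c, hc⟩)) := by
      by_cases hc : F.rank c = 0 ∧ F.IsGlued (F.label c) ∧ (z (F.label c) 1).coeff 0 ≠ 0
      · refine ⟨(s (Sum.inr (Sum.inr ⟨c, hc⟩)) -
          edgeCond (z (F.label c)) (h c) (swapJet (h (F.prev c))) 4) /
          (-2 * (z (F.label c) 1).coeff 0), fun _ => ?_⟩
        have := hc.2.2
        field_simp
        ring
      · exact ⟨0, fun h' => (hc h').elim⟩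
    obtain ⟨y, hy⟩ := h1
    by_cases hc : F.rank c = 0 ∧ F.IsGlued (F.label c)
    · exact ⟨s (Sum.inr (Sum.inl ⟨c, hc⟩)) -
        edgeCond (z (F.label c)) (h c) (swapJet (h (F.prev c))) 2 + y, y,
        fun _ => by ring, hy⟩
    · exact ⟨0, y, fun h' => (hc h').elim, hy⟩
  choose x y hx hy using root
  -- The correction y belongs to the root but acts at its predecessor. Injectivity of `prev` on
  -- corners with glued label makes the transfer well defined and keeps it away from the other
  -- conditions.
  set η : C → ℝ := fun d => if hd : ∃ c, F.rank c = 0 ∧ F.IsGlued (F.label c) ∧ F.prev c = d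
    then y hd.choose else 0 with hη
  set ξ : C → ℝ := fun c => if F.rank c = 0 then x c else 0 with hξ
  have hη1 : ∀ c, F.rank c = 0 → F.IsGlued (F.label c) → η (F.prev c) = y c := by
    intro c h0 hg
    have hd : ∃ c', F.rank c' = 0 ∧ F.IsGlued (F.label c') ∧ F.prev c' = F.prev c :=
      ⟨c, h0, hg, rfl⟩
    simp only [hη]
    rw [dif_pos hd, F.prev_injOn hd.choose_spec.2.1 hg hd.choose_spec.2.2]
  have hη2 : ∀ c, F.rank c ≠ 0 → η (F.prev c) = 0 := by
    intro c h0
    simp only [hη]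
    rw [dif_neg]
    rintro ⟨c', h0', hg', e⟩
    exact h0 (F.prev_injOn hg' (F.isGlued_label_of_rank_ne h0) e ▸ h0')
  obtain ⟨⟨J, hJ⟩, hJh⟩ := (F.restrict_labels_bijective).2
    (fun c => h c + ![0, 0, 0, ξ c, η c, 0])
  have hJ1 : ∀ c, J (F.label c) = h c + ![0, 0, 0, ξ c, η c, 0] := fun c => congrFun hJh c
  have hJ2 : ∀ c, F.IsGlued (F.label c) → F.labelCond z c J =
      edgeCond (z (F.label c)) (h c) (swapJet (h (F.prev c))) +
        ![0, 0, ξ c - η (F.prev c), 0, -2 * (z (F.label c) 1).coeff 0 * η (F.prev c)] := by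
    intro c hc
    change edgeCond _ _ _ = _
    rw [F.mate_label hc, hJ, hJ1, hJ1, edgeCond_add_second_order]
  refine ⟨J, hJ, ?_⟩
  ext i
  rcases i with ⟨⟨c, h0⟩, n⟩ | ⟨c, hc⟩ | ⟨c, hc⟩
  · change F.labelCond z c J n = _
    rw [hJ2 c (F.isGlued_label_of_rank_ne h0), hh c h0 (hN c), hη2 c h0]
    simp only [hξ, if_neg h0, dif_pos h0]
    fin_cases n <;> simp
  · change F.labelCond z c J 2 = _
    rw [hJ2 c hc.2, hη1 c hc.1 hc.2, ← hx c hc]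
    simp only [hξ, if_pos hc.1]
    simp
  · change F.labelCond z c J 4 = _
    rw [hJ2 c hc.2.1, hη1 c hc.1 hc.2.1, ← hy c hc]
    simp

end FlagSystem

end

end G1Spline

/-! ### Closing conditions at interior vertices and the dimension of compatible jets -/

namespace G1Spline

noncomputable section

theorem transition_mulVec {z : Fin 3 → ℝ[X]} (hz : (z 0).coeff 0 ≠ 0) {j j' : Fin 6 → ℝ} :
    (j 1 = j' 2 ∧ (z 0).coeff 0 * j 2 = (z 1).coeff 0 * j' 2 + (z 2).coeff 0 * j' 1) ↔
      transition z *ᵥ ![j' 1, j' 2] = ![j 1, j 2] := by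
  have e : transition z *ᵥ ![j' 1, j' 2] = ![j' 2,
      ((z 2).coeff 0 / (z 0).coeff 0) * j' 1 + ((z 1).coeff 0 / (z 0).coeff 0) * j' 2] := by
    ext i; fin_cases i <;> simp [transition, Matrix.mulVec, dotProduct]
  rw [e]
  constructor
  · rintro ⟨h1, h2⟩
    rw [h1]
    congr 2
    field_simp
    linarith
  · intro h
    have h1 := congrFun h 0
    have h2 := congrFun h 1
    simp only [Matrix.cons_val_zero, Matrix.cons_val_one] at h1 h2
    refine ⟨h1.symm, ?_⟩
    rw [← h2]
    field_simp
    ring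

/-- For b(0) = 0 the pure second derivative drops out, and the mixed derivative is carried across
the edge using only gradients and the first derivatives of β and γ. -/
theorem mixed_of_joining {z : Fin 3 → ℝ[X]} (hz : (z 0).coeff 0 ≠ 0) (hb : (z 1).coeff 0 = 0)
    {j j' : Fin 6 → ℝ} (h : (z 0).coeff 0 * j 2 = (z 1).coeff 0 * j' 2 + (z 2).coeff 0 * j' 1) :
    (z 0).coeff 0 * j 5 + (z 0).coeff 1 * j 2 = 2 * (z 1).coeff 0 * j' 4 + (z 1).coeff 1 * j' 2 +
        (z 2).coeff 0 * j' 5 + (z 2).coeff 1 * j' 1 ↔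
      j 5 = slope (z 1) (z 0) * j' 2 + (z 2).coeff 0 / (z 0).coeff 0 * j' 5 +
        slope (z 2) (z 0) * j' 1 := by
  have h2 : j 2 = (z 2).coeff 0 * j' 1 / (z 0).coeff 0 := by
    rw [hb, zero_mul, zero_add] at h
    field_simp
    linarith
  rw [slope, slope, h2, hb]
  constructor
  · intro e
    field_simp at e ⊢
    linear_combination e
  · intro e
    rw [e]
    field_simp
    ring

/-- The mixed second derivatives match after a full turn around a crossing vertex. -/
theorem crossing_identity {γ₀ γ₁ γ₂ γ₃ b₀ b₁ b₂ b₃ c₀ c₁ c₂ c₃ p q m₀ m₁ m₂ m₃ : ℝ}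
    (h₀ : γ₀ ≠ 0) (h₁ : γ₁ ≠ 0) (h₂ : γ₂ ≠ 0) (h₃ : γ₃ ≠ 0)
    (h₀₂ : γ₂ * γ₀ = 1) (h₁₃ : γ₃ * γ₁ = 1)
    (hq : b₀ + c₁ * (1 / γ₁) = -γ₀ * (b₂ + c₃ * (1 / γ₃)))
    (hp : b₁ + c₂ * (1 / γ₂) = -γ₁ * (b₃ + c₀ * (1 / γ₀)))
    (hm₁ : m₁ = b₀ * q + γ₀ * m₀ + c₀ * p)
    (hm₂ : m₂ = b₁ * (γ₀ * p) + γ₁ * m₁ + c₁ * q)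
    (hm₃ : m₃ = b₂ * (γ₁ * q) + γ₂ * m₂ + c₂ * (γ₀ * p)) :
    m₀ = b₃ * (γ₂ * (γ₀ * p)) + γ₃ * m₃ + c₃ * (γ₁ * q) := by
  have e₂ : γ₂ = 1 / γ₀ := by field_simp; linarith
  have e₃ : γ₃ = 1 / γ₁ := by field_simp; linarith
  subst e₂ e₃
  subst hm₁
  subst hm₂
  subst hm₃
  have hb₀ : b₀ = -γ₀ * (b₂ + c₃ * (1 / (1 / γ₁))) - c₁ * (1 / γ₁) := by linarith
  have hb₁ : b₁ = -γ₁ * (b₃ + c₀ * (1 / γ₀)) - c₂ * (1 / (1 / γ₀)) := by linarith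
  rw [hb₀, hb₁]
  field_simp
  ring

namespace FlagSystem

variable {X C V : Type*} {F : FlagSystem X C V} {z : X → Fin 3 → ℝ[X]}

theorem edgeCond_walk {J : X → Fin 6 → ℝ} (hJ : J ∈ F.jetSpace) (v : V) (i : ℕ) :
    edgeCond (z (F.walk v (i + 1))) (J (F.walk v (i + 1))) (J (F.mate (F.walk v (i + 1)))) = 0 ↔
    J (F.walk v (i + 1)) 0 = J (F.walk v i) 0 ∧ J (F.walk v (i + 1)) 1 = J (F.walk v i) 2 ∧
    J (F.walk v (i + 1)) 3 = J (F.walk v i) 4 ∧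
    (z (F.walk v (i + 1)) 0).coeff 0 * J (F.walk v (i + 1)) 2 =
      (z (F.walk v (i + 1)) 1).coeff 0 * J (F.walk v i) 2 +
      (z (F.walk v (i + 1)) 2).coeff 0 * J (F.walk v i) 1 ∧
    (z (F.walk v (i + 1)) 0).coeff 0 * J (F.walk v (i + 1)) 5 +
        (z (F.walk v (i + 1)) 0).coeff 1 * J (F.walk v (i + 1)) 2 =
      2 * (z (F.walk v (i + 1)) 1).coeff 0 * J (F.walk v i) 4 +
      (z (F.walk v (i + 1)) 1).coeff 1 * J (F.walk v i) 2 +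
      (z (F.walk v (i + 1)) 2).coeff 0 * J (F.walk v i) 5 +
      (z (F.walk v (i + 1)) 2).coeff 1 * J (F.walk v i) 1 := by
  rw [F.mate_walk_succ, hJ, edgeCond_eq_zero]
  rfl

variable [Finite X]

theorem labelCond_apply (c : C) (J : X → Fin 6 → ℝ) : F.labelCond z c J =
    edgeCond (z (F.label c)) (J (F.label c)) (J (F.mate (F.label c))) := rfl

/-- The conditions around an interior vertex which follow from the remaining ones. -/
theorem closing_conditions (hz : F.IsCompatible z) {J : X → Fin 6 → ℝ} (hJ : J ∈ F.jetSpace)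
    {v : V} (hv : F.IsGlued (F.base v))
    (h : ∀ c, F.rank c ≠ 0 → edgeCond (z (F.label c)) (J (F.label c))
      (J (F.mate (F.label c))) = 0)
    (h2 : edgeCond (z (F.base v)) (J (F.base v)) (J (F.mate (F.base v))) 2 = 0)
    (h4 : (z (F.base v) 1).coeff 0 ≠ 0 →
      edgeCond (z (F.base v)) (J (F.base v)) (J (F.mate (F.base v))) 4 = 0) :
    edgeCond (z (F.base v)) (J (F.base v)) (J (F.mate (F.base v))) = 0 := by
  obtain ⟨n, hn⟩ := Nat.exists_eq_succ_of_ne_zero (F.valency_pos v).ne'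
  rw [Nat.succ_eq_add_one] at hn
  have hbase : F.walk v (n + 1) = F.base v := by
    have := F.walk_add_valency v 0
    rwa [zero_add, hn] at this
  have step : ∀ i < n, edgeCond (z (F.walk v (i + 1))) (J (F.walk v (i + 1)))
      (J (F.mate (F.walk v (i + 1)))) = 0 := by
    intro i hi
    have := h (F.corner (F.walk v (i + 1))) (by rw [F.rank_corner_walk hv (by omega)]; omega)
    rwa [F.label_corner_walk hv] at this
  have step' : ∀ i < n, _ := fun i hi => (edgeCond_walk hJ v i).1 (step i hi)
  have hz0 : ∀ i, (z (F.walk v i) 0).coeff 0 ≠ 0 := fun i => hz.ne_zero _ (F.isGlued_walk hv i)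
  have hgrad : ∀ i ≤ n, F.turnProd z v i *ᵥ ![J (F.base v) 1, J (F.base v) 2] =
      ![J (F.walk v i) 1, J (F.walk v i) 2] := by
    intro i
    induction i with
    | zero => intro _; simp [turnProd]
    | succ i ih =>
      intro hi
      rw [turnProd, ← Matrix.mulVec_mulVec, ih (by omega)]
      obtain ⟨-, s1, -, s3, -⟩ := step' i (by omega)
      exact (transition_mulVec (hz0 _)).1 ⟨s1, s3⟩
  have hval : ∀ i ≤ n, J (F.walk v i) 0 = J (F.base v) 0 := by
    intro i
    induction i with
    | zero => intro _; rfl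
    | succ i ih =>
      intro hi
      rw [(step' i (by omega)).1, ih (by omega)]
  -- The gradient is carried by the product of transitions, which is the identity after a full turn,
  -- so the closing edge imposes nothing on value and gradient.
  have hlast := hz.turnProd_eq_one v hv
  rw [hn] at hlast
  have hgrad' : transition (z (F.walk v (n + 1))) *ᵥ ![J (F.walk v n) 1, J (F.walk v n) 2] =
      ![J (F.walk v (n + 1)) 1, J (F.walk v (n + 1)) 2] := by
    rw [← hgrad n le_rfl, Matrix.mulVec_mulVec, ← turnProd, hlast, Matrix.one_mulVec, hbase]
  obtain ⟨g1, g2⟩ := (transition_mulVec (hz0 _)).2 hgrad'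
  rw [← hbase] at h2 h4 ⊢
  have h2' : J (F.walk v (n + 1)) 3 = J (F.walk v n) 4 := by
    rw [F.mate_walk_succ, hJ] at h2
    simpa [edgeCond, swapJet, sub_eq_zero] using h2
  refine (edgeCond_walk hJ v n).2 ⟨by rw [hval n le_rfl, hbase], g1, h2', g2, ?_⟩
  -- If b(0) ≠ 0, the mixed condition is one of the imposed ones. If b(0) = 0, the vertex has four
  -- joining edges; the mixed derivative is carried across three of them, and the crossing condition
  -- makes it fit at the fourth.
  by_cases hb : (z (F.walk v (n + 1)) 1).coeff 0 = 0
  · rw [hbase] at hb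
    obtain ⟨hfour, hjoin⟩ := hz.valency_of_joining v hv hb
    obtain rfl : n = 3 := by omega
    obtain ⟨cq, cp⟩ := hz.crossing v hv hb _ (fun i => rfl)
    have hzz : ∀ i, (z (F.walk v i) 2).coeff 0 ≠ 0 :=
      fun i => hz.ne_zero' (F.isGlued_walk hv i)
    have hm : ∀ i < 3, _ := fun i hi => (mixed_of_joining (hz0 _) (hjoin _)
      (step' i hi).2.2.2.1).1 (step' i hi).2.2.2.2
    have hq : ∀ i < 3, J (F.walk v (i + 1)) 2 =
        (z (F.walk v (i + 1)) 2).coeff 0 / (z (F.walk v (i + 1)) 0).coeff 0 *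
          J (F.walk v i) 1 := by
      intro i hi
      have := (step' i hi).2.2.2.1
      rw [hjoin, zero_mul, zero_add] at this
      have := hz0 (i + 1)
      field_simp
      linarith
    have hp : ∀ i < 3, J (F.walk v (i + 1)) 1 = J (F.walk v i) 2 := fun i hi => (step' i hi).2.1
    rw [mixed_of_joining (hz0 _) (hjoin _) g2]
    have ht : ∀ i, transition (z (F.walk v (i + 1))) =
        !![0, 1; (z (F.walk v (i + 1)) 2).coeff 0 / (z (F.walk v (i + 1)) 0).coeff 0, 0] := by
      intro i
      rw [transition, hjoin, zero_div]
    simp only [turnProd, ht, mul_one, Matrix.mul_fin_two] at hlast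
    have t0 := congrFun (congrFun hlast 0) 0
    have t1 := congrFun (congrFun hlast 1) 1
    simp at t0 t1
    have hm0 := hm 0 (by norm_num)
    have hm1 := hm 1 (by norm_num)
    have hm2 := hm 2 (by norm_num)
    have hq0 := hq 0 (by norm_num)
    have hq1 := hq 1 (by norm_num)
    have hq2 := hq 2 (by norm_num)
    have hp0 := hp 0 (by norm_num)
    have hp1 := hp 1 (by norm_num)
    have hp2 := hp 2 (by norm_num)
    simp only [zero_add, Nat.reduceAdd] at *
    rw [hp0] at hq1 hm1
    rw [hp1, hq0] at hq2 hm2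
    rw [hq0] at hm1
    rw [hq1] at hm2 hp2
    rw [hp2, hq2]
    have hd : ∀ i, (z (F.walk v i) 0).coeff 0 / (z (F.walk v i) 2).coeff 0 =
      1 / ((z (F.walk v i) 2).coeff 0 / (z (F.walk v i) 0).coeff 0) := fun i => by
        rw [one_div_div]
    rw [hd, hd] at cq cp
    have := crossing_identity (div_ne_zero (hzz 1) (hz0 1)) (div_ne_zero (hzz 2) (hz0 2))
      (div_ne_zero (hzz 3) (hz0 3)) (div_ne_zero (hzz 4) (hz0 4)) t0 t1 cq cp hm0 hm1 hm2
    rw [hbase] at this ⊢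
    exact this
  · have := h4 hb
    rw [F.mate_walk_succ, hJ] at this
    simp [edgeCond, swapJet] at this
    linarith

theorem inf_ker_conditions (hz : F.IsCompatible z) :
    F.jetSpace ⊓ LinearMap.ker (F.conditions z) = F.compatibleJets z := by
  ext J
  rw [Submodule.mem_inf, LinearMap.mem_ker, mem_compatibleJets]
  refine and_congr_right fun hJ => ⟨fun h => ?_, fun h => ?_⟩
  · have h1 : ∀ c, F.rank c ≠ 0 → edgeCond (z (F.label c)) (J (F.label c))
        (J (F.mate (F.label c))) = 0 := fun c hc => by
      ext n
      exact congrFun h (Sum.inl (⟨c, hc⟩, n))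
    have key : ∀ c, F.IsGlued (F.label c) → edgeCond (z (F.label c)) (J (F.label c))
        (J (F.mate (F.label c))) = 0 := by
      intro c hc
      by_cases h0 : F.rank c = 0
      · have h2 := congrFun h (Sum.inr (Sum.inl ⟨c, h0, hc⟩))
        have h4 : ∀ hb, _ := fun hb => congrFun h (Sum.inr (Sum.inr ⟨c, h0, hc, hb⟩))
        change F.labelCond z c J 2 = 0 at h2
        change ∀ hb : (z (F.label c) 1).coeff 0 ≠ 0, F.labelCond z c J 4 = 0 at h4
        rw [labelCond_apply] at h2 h4
        rw [F.label_of_rank_eq_zero h0] at h2 h4 hc ⊢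
        exact closing_conditions hz hJ hc h1 h2 h4
      · exact h1 c h0
    intro x hx
    -- Each glued flag or its mate is a label, and the conditions are symmetric under exchange of
    -- the two sides.
    obtain ⟨c, e | e⟩ := F.exists_label hx
    · rw [e] at hx ⊢
      exact key c hx
    · have := F.isGlued_mate hx
      rw [e] at this
      have h3 := edgeCond_mate (key c this)
      rw [← hz.mate _ this, ← e, F.mate_mate] at h3
      exact h3
  · ext i
    rcases i with ⟨⟨c, h0⟩, n⟩ | ⟨c, hc⟩ | ⟨c, hc⟩
    · exact congrFun (h _ (F.isGlued_label_of_rank_ne h0)) n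
    · exact congrFun (h _ hc.2) 2
    · exact congrFun (h _ hc.2.1) 4

variable [Finite C] [Finite V]

/-- Six coefficients per corner, minus five conditions per corner of positive rank and two per
interior vertex, where the second is absent if the base edge is joining. -/
theorem finrank_compatibleJets (hz : F.IsCompatible z) :
    Module.finrank ℝ (F.compatibleJets z) + 5 * Nat.card {c // F.rank c ≠ 0} +
      2 * Nat.card {v // F.IsGlued (F.base v)} =
    6 * Nat.card C + Nat.card {v // F.IsGlued (F.base v) ∧ (z (F.base v) 1).coeff 0 = 0} := by
  have := F.finite_jetSpace
  have := Fintype.ofFinite (CondIndex F z)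
  have h := finrank_map_add_finrank_inf_ker (F.conditions z) F.jetSpace
  rw [map_conditions hz, inf_ker_conditions hz, finrank_top, Module.finrank_fintype_fun_eq_card,
    ← Nat.card_eq_fintype_card, CondIndex, Nat.card_sum, Nat.card_sum, Nat.card_prod,
    Nat.card_fin, F.card_root F.IsGlued,
    F.card_root (fun x => F.IsGlued x ∧ (z x 1).coeff 0 ≠ 0), finrank_jetSpace] at h
  have h' : Nat.card {v // F.IsGlued (F.base v)} =
      Nat.card {v // F.IsGlued (F.base v) ∧ (z (F.base v) 1).coeff 0 = 0} +
      Nat.card {v // F.IsGlued (F.base v) ∧ (z (F.base v) 1).coeff 0 ≠ 0} := by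
    classical
    have := Fintype.ofFinite V
    simp only [Nat.card_eq_fintype_card, Fintype.card_subtype]
    rw [← Finset.card_filter_add_card_filter_not
      (s := Finset.univ.filter fun v => F.IsGlued (F.base v))
      (fun v => (z (F.base v) 1).coeff 0 = 0), Finset.filter_filter, Finset.filter_filter]
  omega

end FlagSystem

end

end G1Spline

namespace G1Spline

noncomputable section

variable {K₀ K₁ : Type*}

/-! ### The flags of a surface -/

namespace Flag

variable {Ω : K₀ → Tile}

theorem swap_swap (f : Flag Ω) : f.swap.swap = f := by
  simp [swap]

theorem swap_ne (f : Flag Ω) : f.swap ≠ f := fun h => by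
  have := congrArg dir h
  simp [swap] at this

theorem rev_rev (f : Flag Ω) : f.rev.rev = f := by
  obtain ⟨l, i, d⟩ := f
  cases d
  · exact congrArg (fun j => (⟨l, j, false⟩ : Flag Ω)) (add_sub_cancel_right i 1)
  · exact congrArg (fun j => (⟨l, j, true⟩ : Flag Ω)) (sub_add_cancel i 1)

theorem rev_ne (f : Flag Ω) : f.rev ≠ f := fun h => by
  have := congrArg dir h
  simp [rev] at this

theorem corner_swap (f : Flag Ω) : f.swap.corner = f.corner := rfl

theorem edge_rev (f : Flag Ω) : f.rev.edge = f.edge := by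
  obtain ⟨l, i, d⟩ := f
  cases d
  · exact congrArg (fun j => (⟨l, j⟩ : PolyEdge Ω)) (add_sub_cancel_right i 1)
  · simp [rev, edge]

theorem corner_eq_iff (f g : Flag Ω) : f.corner = g.corner ↔ g = f ∨ g = f.swap := by
  constructor
  · intro h
    obtain ⟨l, i, d⟩ := f
    obtain ⟨l', i', d'⟩ := g
    obtain ⟨rfl, h⟩ := Sigma.mk.inj_iff.1 h
    obtain rfl := eq_of_heq h
    cases d <;> cases d' <;> simp [swap]
  · rintro (rfl | rfl) <;> rfl

theorem edge_eq_iff (f g : Flag Ω) : f.edge = g.edge ↔ g = f ∨ g = f.rev := by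
  constructor
  · intro h
    obtain ⟨l, i, d⟩ := f
    obtain ⟨l', i', d'⟩ := g
    obtain ⟨rfl, h⟩ := Sigma.mk.inj_iff.1 h
    have h := eq_of_heq h
    cases d <;> cases d' <;> simp [rev] at h ⊢
    · exact h.symm
    · rw [h, sub_add_cancel]
    · rw [h]
    · exact h.symm
  · rintro (rfl | rfl)
    · rfl
    · exact (edge_rev f).symm

/-- A flag is determined by its edge and its direction. -/
def equivEdge : Flag Ω ≃ PolyEdge Ω × Bool where
  toFun f := (f.edge, f.dir)
  invFun y := ⟨y.1.1, if y.2 then y.1.2 + 1 else y.1.2, y.2⟩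
  left_inv f := by
    obtain ⟨l, i, d⟩ := f
    cases d
    · simp [edge]
    · exact congrArg (fun j => (⟨l, j, true⟩ : Flag Ω)) (sub_add_cancel i 1)
  right_inv y := by
    obtain ⟨⟨l, i⟩, d⟩ := y
    cases d
    · simp [edge]
    · exact congrArg (fun j => ((⟨l, j⟩, true) : PolyEdge Ω × Bool)) (add_sub_cancel_right i 1)

instance [Finite K₀] : Finite (Flag Ω) := Finite.of_equiv _ (equivEdge (Ω := Ω)).symm

end Flag

namespace GluedSurface

variable (S : GluedSurface K₀ K₁)

theorem src_oriented (k : K₁) (x y : Bool) : (S.oriented (k, x, y)).src =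
    if y then (if x then (S.gluing k).tgt.rev else (S.gluing k).src.rev)
    else (if x then (S.gluing k).tgt else (S.gluing k).src) := by
  cases x <;> cases y <;> rfl

theorem tgt_oriented (k : K₁) (x y : Bool) :
    (S.oriented (k, x, y)).tgt = (S.oriented (k, !x, y)).src := by
  cases x <;> cases y <;> rfl

theorem src_oriented_rev (k : K₁) (x y : Bool) :
    (S.oriented (k, x, !y)).src = (S.oriented (k, x, y)).src.rev := by
  cases x <;> cases y <;> simp [src_oriented, Flag.rev_rev]

theorem edge_src_oriented (k : K₁) (x y : Bool) : (S.oriented (k, x, y)).src.edge =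
    Sum.elim (fun k => (S.gluing k).src.edge) (fun k => (S.gluing k).tgt.edge)
      (if x then Sum.inr k else Sum.inl k) := by
  cases x <;> cases y <;> simp [src_oriented, Flag.edge_rev]

/-- Since a polygon edge is glued at most once, a flag on an interior edge determines the gluing,
the side and the endpoint from which it is read. -/
theorem src_oriented_injective : Function.Injective fun o => (S.oriented o).src := by
  rintro ⟨k, x, y⟩ ⟨k', x', y'⟩ h
  have he := congrArg Flag.edge h
  simp only [edge_src_oriented] at he
  have hk := S.paired_once he
  have h1 : k = k' ∧ x = x' := by
    cases x <;> cases x' <;> simp at hk ⊢ <;> exact hk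
  obtain ⟨rfl, rfl⟩ := h1
  by_cases hy : y = y'
  · rw [hy]
  · obtain rfl : y' = !y := by cases y <;> cases y' <;> simp_all
    simp only [src_oriented_rev] at h
    exact (Flag.rev_ne _ h.symm).elim

theorem isGluedEdge_edge_iff (f : Flag S.Ω) :
    S.IsGluedEdge f.edge ↔ ∃ o, (S.oriented o).src = f := by
  constructor
  · rintro ⟨k, h | h⟩
    · rcases (Flag.edge_eq_iff _ _).1 h.symm with e | e
      · exact ⟨(k, false, false), e.symm⟩
      · exact ⟨(k, false, true), e.symm⟩
    · rcases (Flag.edge_eq_iff _ _).1 h.symm with e | e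
      · exact ⟨(k, true, false), e.symm⟩
      · exact ⟨(k, true, true), e.symm⟩
  · rintro ⟨⟨k, x, y⟩, rfl⟩
    refine ⟨k, ?_⟩
    rw [edge_src_oriented]
    cases x
    · exact Or.inl rfl
    · exact Or.inr rfl

open Classical in
/-- The flag on the other side of an interior edge; a flag on a boundary edge is fixed. -/
def mate (f : Flag S.Ω) : Flag S.Ω :=
  if h : ∃ o, (S.oriented o).src = f then (S.oriented h.choose).tgt else f

theorem mate_src (o : K₁ × Bool × Bool) : S.mate (S.oriented o).src = (S.oriented o).tgt := by
  have h : ∃ o', (S.oriented o').src = (S.oriented o).src := ⟨o, rfl⟩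
  rw [mate, dif_pos h, S.src_oriented_injective h.choose_spec]

theorem mate_tgt (o : K₁ × Bool × Bool) : S.mate (S.oriented o).tgt = (S.oriented o).src := by
  obtain ⟨k, x, y⟩ := o
  rw [tgt_oriented, mate_src, tgt_oriented, Bool.not_not]

theorem mate_of_not_exists {f : Flag S.Ω} (h : ¬ ∃ o, (S.oriented o).src = f) :
    S.mate f = f := by
  rw [mate, dif_neg h]

theorem mate_mate (f : Flag S.Ω) : S.mate (S.mate f) = f := by
  by_cases h : ∃ o, (S.oriented o).src = f
  · obtain ⟨o, rfl⟩ := h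
    rw [mate_src, mate_tgt]
  · rw [S.mate_of_not_exists h, S.mate_of_not_exists h]

theorem mate_ne_iff (f : Flag S.Ω) : S.mate f ≠ f ↔ ∃ o, (S.oriented o).src = f := by
  refine ⟨fun h => by_contra fun h' => h (S.mate_of_not_exists h'), ?_⟩
  rintro ⟨⟨k, x, y⟩, rfl⟩ h
  rw [mate_src, tgt_oriented] at h
  have := S.src_oriented_injective h
  simp at this

/-- A flag on an interior edge which is not joining at its origin. -/
def IsOblique (f : Flag S.Ω) : Prop :=
  ∃ o, (S.oriented o).src = f ∧ ¬ (S.oriented o).IsJoining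

/-- A base on a boundary edge is preferred, so that the walk starts at an end of a boundary chain.
At interior vertices an oblique base is preferred, so that a joining base means that all edges at
the vertex are joining. -/
theorem exists_base (v : S.Vertex) : ∃ f : Flag S.Ω, Quot.mk _ f.corner = v ∧
    ((∃ g : Flag S.Ω, Quot.mk _ g.corner = v ∧ S.mate g = g) → S.mate f = f) ∧
    ((∀ g : Flag S.Ω, Quot.mk _ g.corner = v → S.mate g ≠ g) →
      (∃ g : Flag S.Ω, Quot.mk _ g.corner = v ∧ S.IsOblique g) → S.IsOblique f) := by
  by_cases h1 : ∃ g : Flag S.Ω, Quot.mk _ g.corner = v ∧ S.mate g = g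
  · obtain ⟨g, hg, hg'⟩ := h1
    exact ⟨g, hg, fun _ => hg', fun h => (h g hg hg').elim⟩
  by_cases h2 : ∃ g : Flag S.Ω, Quot.mk _ g.corner = v ∧ S.IsOblique g
  · obtain ⟨g, hg, hg'⟩ := h2
    exact ⟨g, hg, fun h => (h1 h).elim, fun _ _ => hg'⟩
  · obtain ⟨c, hc⟩ := Quot.exists_rep v
    exact ⟨⟨c.1, c.2, false⟩, hc, fun h => (h1 h).elim, fun _ h => (h2 h).elim⟩

/-- The flag system of a surface. -/
def flagSystem : FlagSystem (Flag S.Ω) (Corner S.Ω) S.Vertex where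
  swap := Flag.swap
  mate := S.mate
  corner := Flag.corner
  vertex := Quot.mk _
  base v := (S.exists_base v).choose
  swap_swap := Flag.swap_swap
  swap_ne := Flag.swap_ne
  mate_mate := S.mate_mate
  corner_eq_iff := Flag.corner_eq_iff
  corner_surjective c := ⟨⟨c.1, c.2, false⟩, rfl⟩
  vertex_mate f := by
    by_cases h : ∃ o, (S.oriented o).src = f
    · obtain ⟨o, rfl⟩ := h
      rw [mate_src]
      exact (Quot.sound ⟨o, rfl, rfl⟩).symm
    · rw [S.mate_of_not_exists h]
  vertex_induction A hA c c' h hc := by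
    have key : ∀ c c', Relation.EqvGen (fun P Q : Corner S.Ω =>
        ∃ o, P = (S.oriented o).src.corner ∧ Q = (S.oriented o).tgt.corner) c c' →
        (A c ↔ A c') := by
      intro c c' h
      induction h with
      | rel c c' h =>
        obtain ⟨o, rfl, rfl⟩ := h
        refine ⟨fun h => ?_, fun h => ?_⟩
        · have := hA _ h
          rwa [mate_src] at this
        · have := hA _ h
          rwa [mate_tgt] at this
      | refl => rfl
      | symm _ _ _ ih => exact ih.symm
      | trans _ _ _ _ _ ih ih' => exact ih.trans ih'
    exact (key c c' (Quot.eqvGen_exact h)).1 hc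
  vertex_base v := (S.exists_base v).choose_spec.1
  mate_base f h := (S.exists_base _).choose_spec.2.1 ⟨f, rfl, h⟩

theorem isGlued_iff (f : Flag S.Ω) :
    S.flagSystem.IsGlued f ↔ ∃ o, (S.oriented o).src = f := S.mate_ne_iff f

theorem isOblique_base {v : S.Vertex} (hv : S.flagSystem.IsGlued (S.flagSystem.base v))
    {f : Flag S.Ω} (hf : S.flagSystem.vertex f.corner = v) (h : S.IsOblique f) :
    S.IsOblique (S.flagSystem.base v) := by
  refine (S.exists_base v).choose_spec.2.2 (fun g hg => ?_) ⟨f, hf, h⟩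
  refine S.flagSystem.isGlued_of_base (x := g) ?_
  rwa [show S.flagSystem.vertex (S.flagSystem.corner g) = v from hg]

theorem card_isGlued [Fintype K₁] :
    Nat.card {f // S.flagSystem.IsGlued f} = 4 * Fintype.card K₁ := by
  have : Function.Bijective (fun o => (⟨(S.oriented o).src, (S.isGlued_iff _).2 ⟨o, rfl⟩⟩ :
      {f // S.flagSystem.IsGlued f})) :=
    ⟨fun o o' h => S.src_oriented_injective (congrArg Subtype.val h), fun ⟨f, hf⟩ => by
      obtain ⟨o, ho⟩ := (S.isGlued_iff _).1 hf
      exact ⟨o, Subtype.ext ho⟩⟩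
  rw [← Nat.card_congr (Equiv.ofBijective _ this)]
  simp
  ring

theorem card_not_isGlued :
    Nat.card {f // ¬ S.flagSystem.IsGlued f} = 2 * Nat.card S.BoundaryEdge := by
  have key : ∀ f : Flag S.Ω, ¬ S.flagSystem.IsGlued f ↔ ¬ S.IsGluedEdge f.edge := fun f => by
    rw [isGlued_iff, isGluedEdge_edge_iff]
  have : Function.Bijective (fun f : {f // ¬ S.flagSystem.IsGlued f} =>
      ((⟨f.1.edge, (key f.1).1 f.2⟩ : S.BoundaryEdge), f.1.dir)) := by
    constructor
    · rintro ⟨f, hf⟩ ⟨g, hg⟩ h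
      refine Subtype.ext (Flag.equivEdge.injective ?_)
      exact Prod.ext (congrArg (fun y => y.1.1) h) (congrArg (fun y => y.2) h)
    · rintro ⟨⟨t, ht⟩, d⟩
      obtain ⟨f, hf⟩ := Flag.equivEdge.surjective (t, d)
      obtain rfl : f.edge = t := congrArg Prod.fst hf
      obtain rfl : f.dir = d := congrArg Prod.snd hf
      exact ⟨⟨f, (key f).2 ht⟩, rfl⟩
  rw [Nat.card_congr (Equiv.ofBijective _ this), Nat.card_prod]
  simp [mul_comm]

variable [Finite K₀]

/-- Flags are counted twice: two per corner, and four per interior edge plus two per boundary edge.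
-/
theorem card_corners [Fintype K₁] :
    Nat.card (Corner S.Ω) = 2 * Fintype.card K₁ + Nat.card S.BoundaryEdge := by
  have h1 := S.flagSystem.card_flags
  have h2 : Nat.card (Flag S.Ω) = Nat.card {f // S.flagSystem.IsGlued f} +
      Nat.card {f // ¬ S.flagSystem.IsGlued f} := by
    classical
    rw [← Nat.card_sum]
    exact (Nat.card_congr (Equiv.sumCompl fun f => S.flagSystem.IsGlued f)).symm
  rw [card_isGlued, card_not_isGlued] at h2
  omega

/-- An interior edge has two ends, and each end is entered by exactly one glued label. -/
theorem two_mul_card_edges [Fintype K₁] : 2 * Fintype.card K₁ =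
    Nat.card {c // S.flagSystem.rank c ≠ 0} +
      Nat.card {v // S.flagSystem.IsGlued (S.flagSystem.base v)} := by
  have h1 := S.flagSystem.card_glued
  rw [card_isGlued, FlagSystem.card_glued_label] at h1
  omega

theorem finite_vertex : Finite S.Vertex :=
  Finite.of_surjective _ Quot.mk_surjective

end GluedSurface

theorem card_corner_eq [Fintype K₀] (Ω : K₀ → Tile) : Nat.card (Corner Ω) =
    3 * Nat.card {l // (Ω l).IsTri} + 4 * Nat.card {l // (Ω l).IsRect} := by
  classical
  rw [Nat.card_sigma]
  simp only [Nat.card_eq_fintype_card, Fintype.card_fin, Fintype.card_subtype,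
    Finset.card_filter, Finset.mul_sum, ← Finset.sum_add_distrib]
  refine Finset.sum_congr rfl fun l _ => ?_
  cases Ω l <;> simp [Tile.sides, Tile.IsTri, Tile.IsRect]

end

end G1Spline

namespace G1Spline

noncomputable section

variable {K₀ K₁ : Type*}

/-! ### Rational gluing data in all orientations -/

namespace G1PolygonalSurface

variable (S : G1PolygonalSurface K₀ K₁) (a b c : K₁ → ℝ[X])

/-- The coefficient `ρ` on the two sides of an interior edge. -/
def rho₁ (k : K₁) : ℝ := (S.Ω (S.gluing k).src.tile).rho

/-- The coefficient `ρ` on the second side of an interior edge. -/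
def rho₂ (k : K₁) : ℝ := (S.Ω (S.gluing k).tgt.tile).rho

/-- The polynomials `(a, b, c)` with `β = b / a` and `γ = c / a` for an oriented interior edge. -/
def triple : K₁ × Bool × Bool → Fin 3 → ℝ[X]
  | (k, false, false) => ![a k, b k, c k]
  | (k, true, false) => ![c k, -b k, a k]
  | (k, false, true) => ![flip (a k), C (S.rho₁ k) * flip (a k) - flip (b k) -
      C (S.rho₂ k) * flip (c k), flip (c k)]
  | (k, true, true) => ![flip (c k), -(C (S.rho₁ k) * flip (a k) - flip (b k) -
      C (S.rho₂ k) * flip (c k)), flip (a k)]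

theorem triple_not (k : K₁) (x y : Bool) : S.triple a b c (k, !x, y) =
    ![S.triple a b c (k, x, y) 2, -S.triple a b c (k, x, y) 1, S.triple a b c (k, x, y) 0] := by
  cases x <;> cases y <;> simp [triple]

open Classical in
/-- The polynomials `(a, b, c)` for the edge of a flag, with respect to the coordinates given by
the flag. -/
def flagTriple (f : Flag S.Ω) : Fin 3 → ℝ[X] :=
  if h : ∃ o, (S.oriented o).src = f then S.triple a b c h.choose else 0

theorem flagTriple_src (o : K₁ × Bool × Bool) :
    S.flagTriple a b c (S.oriented o).src = S.triple a b c o := by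
  have h : ∃ o', (S.oriented o').src = (S.oriented o).src := ⟨o, rfl⟩
  rw [flagTriple, dif_pos h, S.src_oriented_injective h.choose_spec]

theorem flagTriple_mate {f : Flag S.Ω} (hf : S.flagSystem.IsGlued f) :
    S.flagTriple a b c (S.flagSystem.mate f) = ![S.flagTriple a b c f 2,
      -S.flagTriple a b c f 1, S.flagTriple a b c f 0] := by
  obtain ⟨⟨k, x, y⟩, rfl⟩ := (S.isGlued_iff f).1 hf
  change S.flagTriple a b c (S.mate _) = _
  rw [S.mate_src, S.tgt_oriented, flagTriple_src, flagTriple_src, triple_not]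

variable {S a b c}

theorem triple_spec (h : S.IsRationalWith a b c) (o : K₁ × Bool × Bool) {t : ℝ}
    (ht : t ∈ Set.Icc (0 : ℝ) 1) : (S.triple a b c o 0).eval t ≠ 0 ∧
      (S.oriented o).β t = (S.triple a b c o 1).eval t / (S.triple a b c o 0).eval t ∧
      (S.oriented o).γ t = (S.triple a b c o 2).eval t / (S.triple a b c o 0).eval t ∧
      (S.oriented o).γ t < 0 := by
  obtain ⟨k, x, y⟩ := o
  have hs : 1 - t ∈ Set.Icc (0 : ℝ) 1 := ⟨by linarith [ht.2], by linarith [ht.1]⟩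
  have key : ∀ s ∈ Set.Icc (0 : ℝ) 1, (a k).eval s ≠ 0 ∧ (c k).eval s ≠ 0 ∧
      (S.gluing k).β s = (b k).eval s / (a k).eval s ∧
      (S.gluing k).γ s = (c k).eval s / (a k).eval s ∧ (S.gluing k).γ s < 0 := by
    intro s hs
    obtain ⟨h1, h2, h3⟩ := (h k).2 s hs
    have h4 := S.γ_neg k s hs
    refine ⟨h1, fun h0 => ?_, h2, h3, h4⟩
    rw [h3, h0, zero_div] at h4
    exact h4.false
  obtain ⟨a0, c0, e1, e2, e3⟩ := key t ht
  obtain ⟨a0', c0', e1', e2', e3'⟩ := key (1 - t) hs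
  cases x <;> cases y
  · exact ⟨a0, e1, e2, e3⟩
  · refine ⟨by simpa [triple, eval_flip] using a0', ?_, ?_, e3'⟩
    · simp only [GluedSurface.oriented, EdgeGluing.rev, triple, e1', e2', rho₁, rho₂,
        Matrix.cons_val_zero, Matrix.cons_val_one, eval_sub, eval_mul, eval_C, eval_flip]
      field_simp
    · simp only [GluedSurface.oriented, EdgeGluing.rev, triple, e2',
        Matrix.cons_val_zero, Matrix.cons_val, eval_flip]
  · refine ⟨c0, ?_, ?_, ?_⟩
    · simp only [GluedSurface.oriented, EdgeGluing.symm, triple, e1, e2,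
        Matrix.cons_val_zero, Matrix.cons_val_one, eval_neg]
      field_simp
    · simp only [GluedSurface.oriented, EdgeGluing.symm, triple, e2,
        Matrix.cons_val_zero, Matrix.cons_val]
      field_simp
    · exact one_div_neg.2 e3
  · refine ⟨by simpa [triple, eval_flip] using c0', ?_, ?_, one_div_neg.2 e3'⟩
    · simp only [GluedSurface.oriented, EdgeGluing.rev, EdgeGluing.symm, triple, e1', e2', rho₁,
        rho₂, Matrix.cons_val_zero, Matrix.cons_val_one, eval_sub, eval_mul, eval_C, eval_flip,
        eval_neg]
      field_simp
      ring
    · simp only [GluedSurface.oriented, EdgeGluing.rev, EdgeGluing.symm, triple, e2',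
        Matrix.cons_val_zero, Matrix.cons_val, eval_flip]
      field_simp

theorem triple_spec_zero (h : S.IsRationalWith a b c) (o : K₁ × Bool × Bool) :
    (S.triple a b c o 0).coeff 0 ≠ 0 ∧
      (S.oriented o).β 0 = (S.triple a b c o 1).coeff 0 / (S.triple a b c o 0).coeff 0 ∧
      (S.oriented o).γ 0 = (S.triple a b c o 2).coeff 0 / (S.triple a b c o 0).coeff 0 ∧
      (S.oriented o).γ 0 < 0 := by
  simp only [coeff_zero_eq_eval_zero]
  exact triple_spec h o ⟨le_rfl, zero_le_one⟩

theorem isJoining_iff (h : S.IsRationalWith a b c) (o : K₁ × Bool × Bool) :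
    (S.oriented o).IsJoining ↔ (S.triple a b c o 1).coeff 0 = 0 := by
  obtain ⟨h0, h1, -⟩ := triple_spec_zero h o
  rw [EdgeGluing.IsJoining, h1, div_eq_zero_iff, or_iff_left h0]

theorem mat_eq_transition (h : S.IsRationalWith a b c) (o : K₁ × Bool × Bool) :
    (S.oriented o).mat = transition (S.triple a b c o) := by
  obtain ⟨-, h1, h2, -⟩ := triple_spec_zero h o
  rw [EdgeGluing.mat, transition, h1, h2]

theorem hasDerivWithinAt_div {p q : ℝ[X]} (hq : q.coeff 0 ≠ 0) {f : ℝ → ℝ}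
    (hf : ∀ t ∈ Set.Icc (0 : ℝ) 1, f t = p.eval t / q.eval t) :
    HasDerivWithinAt f (slope p q) (Set.Icc 0 1) 0 := by
  have hq' : q.eval 0 ≠ 0 := by rwa [← coeff_zero_eq_eval_zero]
  have := ((p.hasDerivAt 0).div (q.hasDerivAt 0) hq').hasDerivWithinAt (s := Set.Icc 0 1)
  refine HasDerivWithinAt.congr (f' := slope p q) (this.congr_deriv ?_) (fun t ht => hf t ht)
    (hf 0 ⟨le_rfl, zero_le_one⟩)
  simp only [← coeff_zero_eq_eval_zero, coeff_derivative]
  simp [slope]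

theorem hasDerivWithinAt_oriented (h : S.IsRationalWith a b c) (o : K₁ × Bool × Bool) :
    HasDerivWithinAt (S.oriented o).β (slope (S.triple a b c o 1) (S.triple a b c o 0))
      (Set.Icc 0 1) 0 ∧
    HasDerivWithinAt (S.oriented o).γ (slope (S.triple a b c o 2) (S.triple a b c o 0))
      (Set.Icc 0 1) 0 :=
  ⟨hasDerivWithinAt_div (triple_spec_zero h o).1 fun _ ht => (triple_spec h o ht).2.1,
    hasDerivWithinAt_div (triple_spec_zero h o).1 fun _ ht => (triple_spec h o ht).2.2.1⟩

theorem turnProd_eq_transProd (h : S.IsRationalWith a b c) {v : S.Vertex}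
    {e : ℕ → K₁ × Bool × Bool}
    (he : ∀ i, (S.oriented (e i)).src = S.flagSystem.walk v (i + 1)) (n : ℕ) :
    S.flagSystem.turnProd (S.flagTriple a b c) v n = S.transProd e n := by
  induction n with
  | zero => rfl
  | succ n ih =>
    rw [FlagSystem.turnProd, ih, ← he, flagTriple_src, ← mat_eq_transition h,
      GluedSurface.transProd]

theorem joining_base_iff (h : S.IsRationalWith a b c) {v : S.Vertex}
    (hv : S.flagSystem.IsGlued (S.flagSystem.base v)) :
    (S.flagTriple a b c (S.flagSystem.base v) 1).coeff 0 = 0 ↔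
      ∀ f : Flag S.Ω, S.flagSystem.vertex f.corner = v →
        (S.flagTriple a b c f 1).coeff 0 = 0 := by
  refine ⟨fun h0 f hf => ?_, fun h' => h' _ (S.flagSystem.vertex_base v)⟩
  by_contra hne
  have hg : S.flagSystem.IsGlued f := S.flagSystem.isGlued_of_base (x := f) (by
    rwa [show S.flagSystem.vertex (S.flagSystem.corner f) = v from hf])
  obtain ⟨o, rfl⟩ := (S.isGlued_iff f).1 hg
  rw [flagTriple_src, ← isJoining_iff h] at hne
  obtain ⟨o', ho', hne'⟩ := S.isOblique_base hv hf ⟨o, rfl, hne⟩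
  rw [← ho', flagTriple_src, ← isJoining_iff h] at h0
  exact hne' h0

/-- Joining transitions are antidiagonal. For n = 1 and n = 3 the product has zero diagonal, and for
n = 2 its diagonal is negative, so it is not the identity. For n > 4 the product of the first four
is diagonal with positive entries γγ', contradicting the sector condition after four steps. -/
theorem valency_of_joining (h : S.IsRationalWith a b c) {n : ℕ} {e : ℕ → K₁ × Bool × Bool}
    (he : S.IsVertexCycle n e) (hj : ∀ i, (S.oriented (e i)).IsJoining) : n = 4 := by
  have hid := S.vertex_identity n e he
  have hsec := S.vertex_sectors n e he
  have hn := he.1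
  have hm : ∀ i, (S.oriented (e i)).mat = !![0, 1; (S.oriented (e i)).γ 0, 0] := fun i => by
    rw [EdgeGluing.mat, hj i]
  have hγ : ∀ i, (S.oriented (e i)).γ 0 < 0 := fun i => (triple_spec_zero h (e i)).2.2.2
  by_contra h4
  rcases (show n = 1 ∨ n = 2 ∨ n = 3 ∨ 4 < n by omega) with rfl | rfl | rfl | h5
  · simp only [GluedSurface.transProd, hm, mul_one] at hid
    simpa using congrFun (congrFun hid 0) 0
  · simp only [GluedSurface.transProd, hm, mul_one, Matrix.mul_fin_two] at hid
    have := congrFun (congrFun hid 0) 0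
    simp at this
    linarith [hγ 0]
  · simp only [GluedSurface.transProd, hm, mul_one, Matrix.mul_fin_two] at hid
    simpa using congrFun (congrFun hid 0) 0
  · obtain ⟨i, hi⟩ := (hsec 4 (by norm_num) h5).2
    simp only [GluedSurface.transProd, hm, mul_one, Matrix.mul_fin_two] at hi
    have := mul_pos_of_neg_of_neg (hγ 2) (hγ 0)
    have := mul_pos_of_neg_of_neg (hγ 3) (hγ 1)
    fin_cases i <;> simp at hi <;> linarith

variable [Finite K₀]

variable (S) in
theorem exists_vertexCycle {v : S.Vertex} (hv : S.flagSystem.IsGlued (S.flagSystem.base v)) :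
    ∃ e, (∀ i, (S.oriented (e i)).src = S.flagSystem.walk v (i + 1)) ∧
      S.IsVertexCycle (S.flagSystem.valency v) e := by
  have h : ∀ i, ∃ o, (S.oriented o).src = S.flagSystem.walk v (i + 1) := fun i =>
    (S.isGlued_iff _).1 (S.flagSystem.isGlued_walk hv _)
  choose e he using h
  refine ⟨e, he, S.flagSystem.valency_pos v, fun i => ?_, fun i => ?_, fun i hi j hj hij => ?_⟩
  · apply S.src_oriented_injective
    beta_reduce
    rw [he, he, add_right_comm, FlagSystem.walk_add_valency]
  · rw [← S.mate_src, he, he]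
    exact S.flagSystem.mate_walk_succ v (i + 1)
  · beta_reduce at hij
    rw [he, he] at hij
    rcases (S.flagSystem.corner_eq_iff _ _).1 hij with e' | e'
    · rw [FlagSystem.walk_succ, FlagSystem.walk_succ] at e'
      exact (S.flagSystem.walk_injOn_valency hv hi hj
        (congrArg _ (S.flagSystem.turn_injective e'.symm)))
    · exact (S.flagSystem.swap_walk_ne hv _ _ e'.symm).elim

theorem isCompatible (h : S.IsRationalWith a b c) :
    S.flagSystem.IsCompatible (S.flagTriple a b c) := by
  have hjoin : ∀ v, S.flagSystem.IsGlued (S.flagSystem.base v) →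
      (S.flagTriple a b c (S.flagSystem.base v) 1).coeff 0 = 0 →
      ∀ i, (S.flagTriple a b c (S.flagSystem.walk v i) 1).coeff 0 = 0 := fun v hv h0 i =>
    (joining_base_iff h hv).1 h0 _ (S.flagSystem.vertex_walk v i)
  have hval : ∀ v, S.flagSystem.IsGlued (S.flagSystem.base v) →
      (S.flagTriple a b c (S.flagSystem.base v) 1).coeff 0 = 0 →
      ∀ e : ℕ → K₁ × Bool × Bool,
      (∀ i, (S.oriented (e i)).src = S.flagSystem.walk v (i + 1)) →
      (∀ i, (S.oriented (e i)).IsJoining) := by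
    intro v hv h0 e he i
    rw [isJoining_iff h, ← flagTriple_src, he]
    exact hjoin v hv h0 _
  refine ⟨fun f hf => ?_, fun f hf => S.flagTriple_mate a b c hf, fun v hv => ?_,
    fun v hv h0 => ⟨?_, hjoin v hv h0⟩, fun v hv h0 z' hz' => ?_⟩
  · obtain ⟨o, rfl⟩ := (S.isGlued_iff f).1 hf
    rw [flagTriple_src]
    exact (triple_spec_zero h o).1
  · obtain ⟨e, he, hc⟩ := S.exists_vertexCycle hv
    rw [turnProd_eq_transProd h he]
    exact S.vertex_identity _ e hc
  · obtain ⟨e, he, hc⟩ := S.exists_vertexCycle hv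
    exact valency_of_joining h hc (hval v hv h0 e he)
  · obtain ⟨e, he, hc⟩ := S.exists_vertexCycle hv
    have hj := hval v hv h0 e he
    rw [valency_of_joining h hc hj] at hc
    obtain rfl : z' = fun i => S.triple a b c (e i) := by
      ext1 i
      rw [hz', ← he, flagTriple_src]
    have := S.crossing e ⟨hc, fun i _ => hj i⟩ _ _ fun i _ => hasDerivWithinAt_oriented h (e i)
    simp only [(triple_spec_zero h _).2.2.1, div_div_eq_mul_div] at this
    simp only [← mul_div_assoc]
    exact this

/-- A crossing cycle is closed under crossing either edge at its corners, so it exhausts the vertex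
class and contains the base corner. Conversely, a joining base forces all edges at the vertex to be
joining and the valency to be 4. -/
theorem isCrossingVertex_iff (h : S.IsRationalWith a b c) (v : S.Vertex) :
    S.IsCrossingVertex v ↔ S.flagSystem.IsGlued (S.flagSystem.base v) ∧
      (S.flagTriple a b c (S.flagSystem.base v) 1).coeff 0 = 0 := by
  constructor
  · rintro ⟨e, ⟨he, hj⟩, hv⟩
    obtain ⟨-, hper, htgt, -⟩ := he
    have hj : ∀ i, (S.oriented (e i)).IsJoining := fun i => by
      rw [← Function.Periodic.map_mod_nat hper i]
      exact hj _ (Nat.mod_lt _ (by norm_num))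
    obtain ⟨i, hi⟩ := S.flagSystem.vertex_induction
      (fun c => ∃ i, c = (S.oriented (e i)).src.corner) (by
        rintro f ⟨i, hi⟩
        change ∃ i, (S.mate f).corner = _
        rcases (Flag.corner_eq_iff _ _).1 hi.symm with rfl | rfl
        · refine ⟨i + 3, ?_⟩
          -- By periodicity, i + 3 is the predecessor of i in the cycle.
          have := htgt (i + 3)
          rw [hper] at this
          rw [S.mate_src, this, Flag.corner_swap]
        · refine ⟨i + 1, ?_⟩
          rw [← htgt, S.mate_tgt])
      (S.oriented (e 0)).src.corner (S.flagSystem.corner (S.flagSystem.base v))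
      (by rw [S.flagSystem.vertex_base]; exact hv.symm) ⟨0, rfl⟩
    rcases (Flag.corner_eq_iff _ _).1 hi.symm with e' | e'
    · rw [e']
      refine ⟨(S.isGlued_iff _).2 ⟨_, rfl⟩, ?_⟩
      rw [flagTriple_src, ← isJoining_iff h]
      exact hj i
    · have hg : S.flagSystem.IsGlued (S.oriented (e (i + 1))).src :=
        (S.isGlued_iff _).2 ⟨_, rfl⟩
      have hm : S.flagSystem.base v = S.flagSystem.mate (S.oriented (e (i + 1))).src := by
        rw [e', ← htgt]
        exact (S.mate_src _).symm
      rw [hm]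
      refine ⟨S.flagSystem.isGlued_mate hg, ?_⟩
      rw [S.flagTriple_mate a b c hg, flagTriple_src]
      have := (isJoining_iff h _).1 (hj (i + 1))
      simpa using this
  · rintro ⟨hv, h0⟩
    obtain ⟨e, he, hc⟩ := S.exists_vertexCycle hv
    have hj : ∀ i, (S.oriented (e i)).IsJoining := by
      intro i
      rw [isJoining_iff h, ← flagTriple_src, he]
      exact (joining_base_iff h hv).1 h0 _ (S.flagSystem.vertex_walk v _)
    rw [valency_of_joining h hc hj] at hc
    refine ⟨e, ⟨hc, fun i _ => hj i⟩, ?_⟩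
    rw [he]
    exact (S.flagSystem.vertex_walk v _).symm

/-- The dimension of the space of compatible families of two-jets. -/
theorem finrank_compatibleJets [Fintype K₁] (h : S.IsRationalWith a b c) :
    Module.finrank ℝ (S.flagSystem.compatibleJets (S.flagTriple a b c)) +
      4 * Fintype.card K₁ + 3 * Nat.card {c // S.flagSystem.rank c ≠ 0} =
    6 * Nat.card (Corner S.Ω) + S.numCrossing := by
  have := S.finite_vertex
  have h1 := FlagSystem.finrank_compatibleJets (isCompatible h)
  have h2 := S.two_mul_card_edges
  have h3 : S.numCrossing = Nat.card {v // S.flagSystem.IsGlued (S.flagSystem.base v) ∧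
      (S.flagTriple a b c (S.flagSystem.base v) 1).coeff 0 = 0} :=
    Nat.card_congr (Equiv.subtypeEquivRight fun v => isCrossingVertex_iff h v)
  omega

end G1PolygonalSurface

end

end G1Spline

namespace G1Spline

noncomputable section

variable {K₀ K₁ : Type*}

/-- A product of submodules. -/
def piEquiv {ι : Type*} {M : ι → Type*} [∀ i, AddCommGroup (M i)] [∀ i, Module ℝ (M i)]
    (p : ∀ i, Submodule ℝ (M i)) : Submodule.pi Set.univ p ≃ₗ[ℝ] ∀ i, p i where
  toFun x i := ⟨x.1 i, x.2 i trivial⟩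
  invFun y := ⟨fun i => (y i).1, fun i _ => (y i).2⟩
  map_add' _ _ := rfl
  map_smul' _ _ := rfl

theorem finite_pi {ι : Type*} [Finite ι] {M : ι → Type*} [∀ i, AddCommGroup (M i)]
    [∀ i, Module ℝ (M i)] (p : ∀ i, Submodule ℝ (M i)) [∀ i, Module.Finite ℝ (p i)] :
    Module.Finite ℝ (Submodule.pi Set.univ p) :=
  Module.Finite.equiv (piEquiv p).symm

theorem finrank_pi {ι : Type*} [Fintype ι] {M : ι → Type*} [∀ i, AddCommGroup (M i)]
    [∀ i, Module ℝ (M i)] (p : ∀ i, Submodule ℝ (M i)) [∀ i, Module.Finite ℝ (p i)] :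
    Module.finrank ℝ (Submodule.pi Set.univ p) = ∑ i, Module.finrank ℝ (p i) := by
  rw [(piEquiv p).finrank_eq, Module.finrank_pi_fintype]

/-! ### Values and normal derivatives along the edges -/

namespace Flag

variable {Ω : K₀ → Tile}

theorem pull_swap (f : Flag Ω) : f.swap.pull = swapHom.comp f.pull :=
  (Ω f.tile).pull_swap f.idx f.dir

theorem pull_rev (f : Flag Ω) : f.rev.pull = (revHom (Ω f.tile).rho).comp f.pull :=
  (Ω f.tile).pull_rev f.idx f.dir

/-- The restriction to the edge of a flag. -/
def val (f : Flag Ω) : (K₀ → Bivar) →ₗ[ℝ] ℝ[X] :=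
  axisVal.toLinearMap ∘ₗ f.pull.toLinearMap ∘ₗ LinearMap.proj f.tile

/-- The restriction of `∂/∂v` to the edge of a flag. -/
def nor (f : Flag Ω) : (K₀ → Bivar) →ₗ[ℝ] ℝ[X] :=
  axisNor ∘ₗ f.pull.toLinearMap ∘ₗ LinearMap.proj f.tile

theorem val_apply (f : Flag Ω) (g : K₀ → Bivar) : f.val g = axisVal (f.pull (g f.tile)) := rfl

theorem nor_apply (f : Flag Ω) (g : K₀ → Bivar) : f.nor g = axisNor (f.pull (g f.tile)) := rfl

theorem val_rev (f : Flag Ω) (g : K₀ → Bivar) : f.rev.val g = flip (f.val g) := by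
  rw [val_apply, val_apply, pull_rev, AlgHom.comp_apply, axisVal_revHom]
  rfl

theorem nor_rev (f : Flag Ω) (g : K₀ → Bivar) :
    f.rev.nor g = flip (f.nor g) - C (Ω f.tile).rho * flip (derivative (f.val g)) := by
  rw [nor_apply, nor_apply, val_apply, pull_rev, AlgHom.comp_apply, axisNor_revHom]
  rfl

/-- The two-jets at the corners, in the coordinates given by all flags. -/
def jets (Ω : K₀ → Tile) : (K₀ → Bivar) →ₗ[ℝ] (Flag Ω → Fin 6 → ℝ) :=
  LinearMap.pi fun f => jet ∘ₗ f.pull.toLinearMap ∘ₗ LinearMap.proj f.tile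

theorem jets_apply (g : K₀ → Bivar) (f : Flag Ω) : jets Ω g f = jet (f.pull (g f.tile)) := rfl

theorem jets_swap (g : K₀ → Bivar) (f : Flag Ω) : jets Ω g f.swap = swapJet (jets Ω g f) := by
  rw [jets_apply, jets_apply, pull_swap, AlgHom.comp_apply, jet_swapHom]
  rfl

theorem jets_coeff (g : K₀ → Bivar) (f : Flag Ω) : jets Ω g f 0 = (f.val g).coeff 0 ∧
    jets Ω g f 1 = (f.val g).coeff 1 ∧ jets Ω g f 2 = (f.nor g).coeff 0 ∧
    jets Ω g f 3 = (f.val g).coeff 2 ∧ jets Ω g f 5 = (f.nor g).coeff 1 :=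
  ⟨rfl, rfl, rfl, rfl, rfl⟩

/-- The coefficient of v² is not visible along the edge of the flag; it is the u² coefficient of the
swapped flag. -/
theorem jets_eq_zero {g : K₀ → Bivar} (h : ∀ f : Flag Ω, (∀ i < 3, (f.val g).coeff i = 0) ∧
    ∀ i < 2, (f.nor g).coeff i = 0) : jets Ω g = 0 := by
  ext f i
  obtain ⟨h0, h1, h2, h3, h5⟩ := jets_coeff g f
  have h4 : jets Ω g f 4 = (f.swap.val g).coeff 2 := by
    rw [← (jets_coeff g f.swap).2.2.2.1, jets_swap]
    rfl
  have hv := (h f).1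
  have hn := (h f).2
  have hs := (h f.swap).1 2 (by norm_num)
  fin_cases i
  · exact h0.trans (hv 0 (by norm_num))
  · exact h1.trans (hv 1 (by norm_num))
  · exact h2.trans (hn 0 (by norm_num))
  · exact h3.trans (hv 2 (by norm_num))
  · exact h4.trans hs
  · exact h5.trans (hn 1 (by norm_num))

end Flag

/-! ### Piecewise polynomial functions -/

/-- Families of polynomial functions of degree `k`, without conditions along the edges. -/
def piecewise (Ω : K₀ → Tile) (k : ℕ) : Submodule ℝ (K₀ → Bivar) :=
  Submodule.pi Set.univ fun l => (Ω l).space k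

section piecewise

variable {Ω : K₀ → Tile} {k : ℕ}

theorem mem_piecewise {g : K₀ → Bivar} : g ∈ piecewise Ω k ↔ ∀ l, g l ∈ (Ω l).space k :=
  ⟨fun h l => h l trivial, fun h l _ => h l⟩

theorem pull_mem_polySpace {g : K₀ → Bivar} (hg : g ∈ piecewise Ω k) (f : Flag Ω) :
    f.pull (g f.tile) ∈ (Ω f.tile).polySpace k :=
  ((Ω f.tile).mem_space_iff k f.idx f.dir _).1 (mem_piecewise.1 hg f.tile)

theorem val_mem_degreeLT {g : K₀ → Bivar} (hg : g ∈ piecewise Ω k) (f : Flag Ω) :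
    f.val g ∈ degreeLT ℝ (k + 1) :=
  Tile.axisVal_mem (pull_mem_polySpace hg f)

theorem nor_mem_degreeLT {g : K₀ → Bivar} (hg : g ∈ piecewise Ω k) (f : Flag Ω) :
    f.nor g ∈ degreeLT ℝ (k + (Ω f.tile).r) :=
  Tile.axisNor_mem (pull_mem_polySpace hg f)

instance finite_tileSpace (T : Tile) (k : ℕ) : Module.Finite ℝ (T.space k) :=
  Module.Finite.equiv (T.spaceEquiv k).symm

instance finite_piecewise [Finite K₀] : Module.Finite ℝ (piecewise Ω k) := finite_pi _

theorem finrank_piecewise [Fintype K₀] : 2 * Module.finrank ℝ (piecewise Ω k) =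
    (k + 1) * (k + 2) * Nat.card {l // (Ω l).IsTri} +
      2 * (k + 1) ^ 2 * Nat.card {l // (Ω l).IsRect} := by
  classical
  rw [piecewise, finrank_pi]
  simp only [Nat.card_eq_fintype_card, Fintype.card_subtype, Finset.card_filter, Finset.mul_sum,
    ← Finset.sum_add_distrib]
  refine Finset.sum_congr rfl fun l _ => ?_
  rw [((Ω l).spaceEquiv k).finrank_eq, Tile.finrank_polySpace]
  cases Ω l with
  | triangle p h =>
    rw [mul_comm, Tile.card_exponents_triangle]
    simp [Tile.IsTri, Tile.IsRect]
  | rectangle p h =>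
    rw [Tile.card_exponents_rectangle]
    simp [Tile.IsTri, Tile.IsRect]

theorem exists_trace (hk : 5 ≤ k) (x : Flag Ω) {f q : ℝ[X]} (hf : f ∈ degreeLT ℝ (k - 5))
    (hq : q ∈ degreeLT ℝ (k - 4 + (Ω x.tile).r)) :
    ∃ g ∈ piecewise Ω k, x.val g = X ^ 3 * (1 - X) ^ 3 * f ∧ x.nor g = X ^ 2 * (1 - X) ^ 2 * q ∧
      ∀ y : Flag Ω, y.edge ≠ x.edge → y.val g = 0 ∧ y.nor g = 0 := by
  classical
  obtain ⟨G, hG, h1, h2, h3⟩ := (Ω x.tile).exists_trace hk (x.idx, x.dir) hf hq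
  refine ⟨Pi.single x.tile G, mem_piecewise.2 fun l => ?_, ?_, ?_, fun y hy => ?_⟩
  · by_cases hl : l = x.tile
    · subst hl
      rwa [Pi.single_eq_same]
    · rw [Pi.single_eq_of_ne hl]
      exact Submodule.zero_mem _
  · rw [Flag.val_apply, Pi.single_eq_same]
    exact h1
  · rw [Flag.nor_apply, Pi.single_eq_same]
    exact h2
  · by_cases hl : y.tile = x.tile
    · obtain ⟨l, i, d⟩ := x
      obtain ⟨l', i', d'⟩ := y
      obtain rfl : l' = l := hl
      rw [Flag.val_apply, Flag.nor_apply, Pi.single_eq_same]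
      refine h3 (i', d') fun e => hy ?_
      exact congrArg (Sigma.mk l') e
    · rw [Flag.val_apply, Flag.nor_apply, Pi.single_eq_of_ne hl]
      simp

theorem exists_jets (hk : 5 ≤ k) {J : Flag Ω → Fin 6 → ℝ} (hJ : ∀ f, J f.swap = swapJet (J f)) :
    ∃ g ∈ piecewise Ω k, Flag.jets Ω g = J := by
  classical
  have key : ∀ l, ∃ G ∈ (Ω l).space k, ∀ i, jet ((Ω l).pull i false G) = J ⟨l, i, false⟩ := by
    intro l
    choose G hG h1 h2 using fun i => (Ω l).exists_jet hk i (J ⟨l, i, false⟩)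
    refine ⟨∑ i, G i, Submodule.sum_mem _ fun i _ => hG i, fun i => ?_⟩
    rw [map_sum, map_sum, Finset.sum_eq_single i, h1]
    · exact fun i' _ hi => h2 i' i hi.symm
    · exact fun h => (h (Finset.mem_univ _)).elim
  choose G hG h using key
  refine ⟨G, mem_piecewise.2 hG, ?_⟩
  ext1 f
  obtain ⟨l, i, d⟩ := f
  cases d
  · exact h l i
  · have := Flag.jets_swap (Ω := Ω) G ⟨l, i, false⟩
    rw [show Flag.jets Ω G ⟨l, i, false⟩ = J ⟨l, i, false⟩ from h l i, ← hJ] at this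
    exact this

end piecewise

/-! ### The `G¹` conditions for polynomials -/

theorem edge_relation_mate {z : Fin 3 → ℝ[X]} {p q q' : ℝ[X]}
    (h : z 0 * q = z 1 * derivative p + z 2 * q') : z 2 * q' = -z 1 * derivative p + z 0 * q := by
  rw [h]
  ring

namespace G1PolygonalSurface

variable {S : G1PolygonalSurface K₀ K₁} {a b c : K₁ → ℝ[X]}

/-- Denominators do not vanish on [0, 1], and polynomial identities valid at infinitely many points
hold identically. -/
theorem isG1_iff (h : S.IsRationalWith a b c) (g : K₀ → Bivar) : S.IsG1 g ↔
    ∀ k, (S.gluing k).src.val g = (S.gluing k).tgt.val g ∧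
      a k * (S.gluing k).src.nor g =
        b k * derivative ((S.gluing k).tgt.val g) + c k * (S.gluing k).tgt.nor g := by
  refine forall_congr' fun k => ?_
  have hinf : (Set.Icc (0 : ℝ) 1).Infinite := Set.Icc_infinite one_pos
  have hval : ∀ (f : Flag S.Ω) (t : ℝ),
      MvPolynomial.eval ![t, 0] (f.pull (g f.tile)) = (f.val g).eval t := fun f t =>
    eval_axis t _
  have hder : ∀ (f : Flag S.Ω) (t : ℝ), MvPolynomial.eval ![t, 0]
      (MvPolynomial.pderiv 0 (f.pull (g f.tile))) = (derivative (f.val g)).eval t := fun f t => by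
    rw [eval_axis, axisVal_pderiv_zero]
    rfl
  have hnor : ∀ (f : Flag S.Ω) (t : ℝ), MvPolynomial.eval ![t, 0]
      (MvPolynomial.pderiv 1 (f.pull (g f.tile))) = (f.nor g).eval t := fun f t =>
    eval_axis t _
  simp only [hval, hder, hnor]
  constructor
  · intro H
    constructor
    · exact eq_of_infinite_eval_eq _ _ (hinf.mono fun t ht => (H t ht).1)
    · refine eq_of_infinite_eval_eq _ _ (hinf.mono fun t ht => ?_)
      obtain ⟨h1, h2, h3⟩ := (h k).2 t ht
      have := (H t ht).2
      rw [h2, h3] at this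
      simp only [Set.mem_ofPred_eq, eval_mul, eval_add, this]
      field_simp
  · rintro ⟨H1, H2⟩ t ht
    obtain ⟨h1, h2, h3⟩ := (h k).2 t ht
    refine ⟨by rw [H1], ?_⟩
    have := congrArg (eval t) H2
    simp only [eval_mul, eval_add] at this
    rw [h2, h3]
    field_simp
    linarith

theorem relation_oriented (h : S.IsRationalWith a b c) {g : K₀ → Bivar} (hg : S.IsG1 g)
    (o : K₁ × Bool × Bool) : (S.oriented o).src.val g = (S.oriented o).tgt.val g ∧
      S.triple a b c o 0 * (S.oriented o).src.nor g =
        S.triple a b c o 1 * derivative ((S.oriented o).tgt.val g) +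
          S.triple a b c o 2 * (S.oriented o).tgt.nor g := by
  have key : ∀ k y, (S.oriented (k, false, y)).src.val g = (S.oriented (k, false, y)).tgt.val g ∧
      S.triple a b c (k, false, y) 0 * (S.oriented (k, false, y)).src.nor g =
        S.triple a b c (k, false, y) 1 * derivative ((S.oriented (k, false, y)).tgt.val g) +
          S.triple a b c (k, false, y) 2 * (S.oriented (k, false, y)).tgt.nor g := by
    intro k y
    obtain ⟨h1, h2⟩ := (isG1_iff h g).1 hg k
    cases y
    · exact ⟨h1, h2⟩
    · change (S.gluing k).src.rev.val g = (S.gluing k).tgt.rev.val g ∧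
        flip (a k) * (S.gluing k).src.rev.nor g = (C (S.rho₁ k) * flip (a k) - flip (b k) -
          C (S.rho₂ k) * flip (c k)) * derivative ((S.gluing k).tgt.rev.val g) +
          flip (c k) * (S.gluing k).tgt.rev.nor g
      rw [Flag.val_rev, Flag.val_rev, Flag.nor_rev, Flag.nor_rev, h1, derivative_flip]
      refine ⟨rfl, ?_⟩
      have := congrArg flip h2
      simp only [map_mul, map_add] at this
      rw [rho₁, rho₂]
      linear_combination this
  obtain ⟨k, x, y⟩ := o
  cases x
  · exact key k y
  · obtain ⟨h1, h2⟩ := key k y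
    rw [show true = !false from rfl, S.triple_not, S.tgt_oriented, Bool.not_not,
      ← S.tgt_oriented]
    rw [← h1]
    refine ⟨rfl, ?_⟩
    rw [← h1] at h2
    exact edge_relation_mate h2

/-- The two-jets of a `G¹` function are compatible. -/
theorem jets_mem_compatibleJets (h : S.IsRationalWith a b c) {g : K₀ → Bivar} (hg : S.IsG1 g) :
    Flag.jets S.Ω g ∈ S.flagSystem.compatibleJets (S.flagTriple a b c) := by
  refine ⟨Flag.jets_swap g, fun f hf => ?_⟩
  obtain ⟨o, rfl⟩ := (S.isGlued_iff f).1 hf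
  change edgeCond _ _ (Flag.jets S.Ω g (S.mate _)) = 0
  rw [S.mate_src, flagTriple_src, edgeCond_eq_zero]
  obtain ⟨h1, h2⟩ := relation_oriented h hg o
  obtain ⟨s0, s1, s2, s3, s5⟩ := Flag.jets_coeff g (S.oriented o).src
  obtain ⟨t0, t1, t2, t3, t5⟩ := Flag.jets_coeff g (S.oriented o).tgt
  rw [s0, s1, s2, s3, s5, t0, t1, t2, t3, t5, h1]
  refine ⟨rfl, rfl, rfl, ?_, ?_⟩
  · have := congrArg (fun p => p.coeff 0) h2
    simpa [mul_coeff_zero, coeff_derivative] using this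
  · have := congrArg (fun p => p.coeff 1) h2
    simp only [coeff_add, mul_coeff_one, coeff_derivative] at this
    norm_num at this
    linarith

end G1PolygonalSurface

end

end G1Spline

namespace G1Spline

noncomputable section

variable {K₀ K₁ : Type*}

/-! ### Traces vanishing to high order at the end points of an edge -/

/-- Pairs of a value and a normal derivative along an edge with vanishing two-jets at both
ends. -/
def flatPair (k r : ℕ) : Submodule ℝ (ℝ[X] × ℝ[X]) :=
  LinearMap.range
    (((LinearMap.mulLeft ℝ (X ^ 3 * (1 - X) ^ 3 : ℝ[X])) ∘ₗ (degreeLT ℝ (k - 5)).subtype).prodMap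
      ((LinearMap.mulLeft ℝ (X ^ 2 * (1 - X) ^ 2 : ℝ[X])) ∘ₗ (degreeLT ℝ (k - 4 + r)).subtype))

theorem mem_flatPair {k r : ℕ} {p q : ℝ[X]} : (p, q) ∈ flatPair k r ↔
    (∃ f ∈ degreeLT ℝ (k - 5), X ^ 3 * (1 - X) ^ 3 * f = p) ∧
      ∃ f ∈ degreeLT ℝ (k - 4 + r), X ^ 2 * (1 - X) ^ 2 * f = q := by
  constructor
  · rintro ⟨⟨f, f'⟩, h⟩
    exact ⟨⟨f, f.2, congrArg Prod.fst h⟩, ⟨f', f'.2, congrArg Prod.snd h⟩⟩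
  · rintro ⟨⟨f, hf, rfl⟩, ⟨f', hf', rfl⟩⟩
    exact ⟨(⟨f, hf⟩, ⟨f', hf'⟩), rfl⟩

theorem flatPair_injective (k r : ℕ) : Function.Injective
    (((LinearMap.mulLeft ℝ (X ^ 3 * (1 - X) ^ 3 : ℝ[X])) ∘ₗ (degreeLT ℝ (k - 5)).subtype).prodMap
      ((LinearMap.mulLeft ℝ (X ^ 2 * (1 - X) ^ 2 : ℝ[X])) ∘ₗ
        (degreeLT ℝ (k - 4 + r)).subtype)) := by
  rintro ⟨f, f'⟩ ⟨e, e'⟩ h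
  have h1 := congrArg Prod.fst h
  have h2 := congrArg Prod.snd h
  exact Prod.ext (Subtype.ext (mul_left_cancel₀ (X_pow_mul_ne_zero 3) h1))
    (Subtype.ext (mul_left_cancel₀ (X_pow_mul_ne_zero 2) h2))

instance finite_flatPair (k r : ℕ) : Module.Finite ℝ (flatPair k r) := by
  have := finite_degreeLT (k - 5)
  have := finite_degreeLT (k - 4 + r)
  exact Module.Finite.range _

theorem finrank_flatPair (k r : ℕ) :
    Module.finrank ℝ (flatPair k r) = (k - 5) + (k - 4 + r) := by
  have := finite_degreeLT (k - 5)
  have := finite_degreeLT (k - 4 + r)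
  rw [flatPair, LinearMap.finrank_range_of_inj (flatPair_injective k r), Module.finrank_prod,
    finrank_degreeLT, finrank_degreeLT]

/-- The value `p` and the normal derivative `q` along an edge have the two-jets `j`, `j'` in the
two standard coordinate systems attached to the edge. -/
def HasEndJets (ρ : ℝ) (j j' : Fin 6 → ℝ) (p q : ℝ[X]) : Prop :=
  (p.coeff 0 = j 0 ∧ p.coeff 1 = j 1 ∧ p.coeff 2 = j 3) ∧ (q.coeff 0 = j 2 ∧ q.coeff 1 = j 5) ∧
  ((flip p).coeff 0 = j' 0 ∧ (flip p).coeff 1 = j' 1 ∧ (flip p).coeff 2 = j' 3) ∧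
  (flip q).coeff 0 = j' 2 - ρ * j' 1 ∧ (flip q).coeff 1 = j' 5 - 2 * ρ * j' 3

/-- Equal end jets make the values differ by a polynomial vanishing to order three at both ends, and
the normal derivatives by one vanishing to order two. -/
theorem HasEndJets.sub_mem_flatPair {ρ : ℝ} {j j' : Fin 6 → ℝ} {p q p₁ q₁ : ℝ[X]} {k r : ℕ}
    (hk : 5 ≤ k) (h : HasEndJets ρ j j' p q) (h₁ : HasEndJets ρ j j' p₁ q₁)
    (hp : p ∈ degreeLT ℝ (k + 1)) (hp₁ : p₁ ∈ degreeLT ℝ (k + 1))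
    (hq : q ∈ degreeLT ℝ (k + r)) (hq₁ : q₁ ∈ degreeLT ℝ (k + r)) :
    (p - p₁, q - q₁) ∈ flatPair k r := by
  obtain ⟨⟨a0, a1, a2⟩, ⟨b0, b1⟩, ⟨c0, c1, c2⟩, d0, d1⟩ := h
  obtain ⟨⟨a0', a1', a2'⟩, ⟨b0', b1'⟩, ⟨c0', c1', c2'⟩, d0', d1'⟩ := h₁
  have hd3 : X ^ 3 * (1 - X) ^ 3 ∣ p - p₁ := by
    refine X_pow_mul_dvd_of_coeff (fun i hi => ?_) (fun i hi => ?_)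
    · interval_cases i <;> simp only [coeff_sub, *, sub_self]
    · rw [map_sub]
      interval_cases i <;> simp only [coeff_sub, *, sub_self]
  have hd2 : X ^ 2 * (1 - X) ^ 2 ∣ q - q₁ := by
    refine X_pow_mul_dvd_of_coeff (fun i hi => ?_) (fun i hi => ?_)
    · interval_cases i <;> simp only [coeff_sub, *, sub_self]
    · rw [map_sub]
      interval_cases i <;> simp only [coeff_sub, *, sub_self]
  obtain ⟨f, hf⟩ := hd3
  obtain ⟨f', hf'⟩ := hd2
  refine mem_flatPair.2 ⟨⟨f, (X_pow_mul_mem_degreeLT 3 _ f).1 ?_, hf.symm⟩,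
    ⟨f', (X_pow_mul_mem_degreeLT 2 _ f').1 ?_, hf'.symm⟩⟩
  · rw [← hf, show k - 5 + 2 * 3 = k + 1 by omega]
    exact Submodule.sub_mem _ hp hp₁
  · rw [← hf', show k - 4 + r + 2 * 2 = k + r by omega]
    exact Submodule.sub_mem _ hq hq₁

theorem hasEndJets_zero (ρ : ℝ) : HasEndJets ρ 0 0 0 0 := by
  simp [HasEndJets]

theorem coeff_flip_derivative (p : ℝ[X]) (n : ℕ) :
    (flip (derivative p)).coeff n = -((flip p).coeff (n + 1) * (n + 1)) := by
  rw [← coeff_derivative, derivative_flip, coeff_neg, neg_neg]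

theorem Flag.hasEndJets {Ω : K₀ → Tile} (g : K₀ → Bivar) (f : Flag Ω) :
    HasEndJets (Ω f.tile).rho (Flag.jets Ω g f) (Flag.jets Ω g f.rev) (f.val g) (f.nor g) := by
  obtain ⟨s0, s1, s2, s3, s5⟩ := Flag.jets_coeff g f
  obtain ⟨t0, t1, t2, t3, t5⟩ := Flag.jets_coeff g f.rev
  rw [Flag.val_rev] at t0 t1 t3
  rw [Flag.nor_rev, coeff_sub, coeff_C_mul, coeff_flip_derivative] at t2 t5
  refine ⟨⟨s0.symm, s1.symm, s3.symm⟩, ⟨s2.symm, s5.symm⟩, ⟨t0.symm, t1.symm, t3.symm⟩, ?_, ?_⟩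
  · rw [t2, t1]
    norm_num
  · rw [t5, t3]
    norm_num
    ring

/-- Solutions of the edge conditions with prescribed compatible two-jets at both ends. -/
theorem IsMinimalPair.exists_edge_solution {a b c : ℝ[X]} {r₁ r₂ : ℕ} {Z₁ Z₂ : Fin 3 → ℝ[X]}
    (h : IsMinimalPair a b c r₁ r₂ Z₁ Z₂) (ha : ∀ t ∈ Set.Icc (0 : ℝ) 1, a.eval t ≠ 0)
    (hcop : ∀ p : ℝ[X], p ∣ a → p ∣ b → p ∣ c → IsUnit p) {k : ℕ}
    (hk₁ : 2 * tdeg r₁ r₂ Z₁ + 3 ≤ k) (hk₂ : tdeg r₁ r₂ Z₂ + 4 ≤ k) {ρ₁ ρ₂ : ℝ}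
    {i j i' j' : Fin 6 → ℝ} (h₀ : edgeCond ![a, b, c] i j = 0)
    (h₁ : edgeCond ![flip a, C ρ₁ * flip a - flip b - C ρ₂ * flip c, flip c] i' j' = 0) :
    ∃ p ∈ degreeLT ℝ (k + 1), ∃ q ∈ degreeLT ℝ (k + r₁), ∃ q' ∈ degreeLT ℝ (k + r₂),
      a * q = b * derivative p + c * q' ∧ HasEndJets ρ₁ i i' p q ∧ HasEndJets ρ₂ j j' p q' := by
  obtain ⟨e0, e1, e3, e2, e5⟩ := edgeCond_eq_zero.1 h₀
  obtain ⟨f0, f1, f3, f2, f5⟩ := edgeCond_eq_zero.1 h₁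
  simp only [Matrix.cons_val_zero, Matrix.cons_val_one, Matrix.cons_val, coeff_sub,
    coeff_C_mul] at e2 e5 f2 f5
  -- The syzygy sought is Z = (q, -p', -q'), and p is recovered by integrating its middle component
  -- from the value `j 0` at 0. Its integral must therefore be p(0) - p(1) = `j 0 - j' 0`. At the
  -- far end reflection reverses the sign of p', and ρ corrects the normal derivative.
  obtain ⟨Z, ⟨hZ, hd0, hd1, hd2⟩, hc, hI⟩ := h.exists_interpolation ha hcop hk₁ hk₂
    ![i 2, -j 1, -j 2] ![i 5, -(2 * j 3), -j 5]
    ![i' 2 - ρ₁ * j' 1, j' 1, -(j' 2 - ρ₂ * j' 1)]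
    ![i' 5 - 2 * ρ₁ * j' 3, 2 * j' 3, -(j' 5 - 2 * ρ₂ * j' 3)]
    (by simp; linarith) (by simp; linarith) (by simp; linarith) (by simp; linarith) (j 0 - j' 0)
  obtain ⟨a0, a1, a2, a3⟩ := hc 0
  obtain ⟨b0, b1, b2, b3⟩ := hc 1
  obtain ⟨c0, c1, c2, c3⟩ := hc 2
  simp only [Matrix.cons_val_zero, Matrix.cons_val_one, Matrix.cons_val] at a0 a1 a2 a3 b0 b1 b2 b3 c0 c1 c2 c3
  have hder : derivative (C (j 0) - antider (Z 1)) = -Z 1 := by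
    rw [derivative_sub, derivative_C, derivative_antider, zero_sub]
  have hflip : ∀ n, (flip (C (j 0) - antider (Z 1))).coeff (n + 1) * ((n : ℝ) + 1) =
      (flip (Z 1)).coeff n := fun n => by
    rw [← neg_inj, ← coeff_flip_derivative, hder, map_neg, coeff_neg]
  have p0 : (C (j 0) - antider (Z 1)).coeff 0 = j 0 := by
    rw [coeff_sub, coeff_antider_zero, coeff_C_zero, sub_zero]
  have p1 : (C (j 0) - antider (Z 1)).coeff 1 = j 1 := by
    have := congrArg (fun p => p.coeff 0) hder
    simp only [coeff_derivative, coeff_neg, b0] at this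
    norm_num at this
    simpa using this
  have p2 : (C (j 0) - antider (Z 1)).coeff 2 = j 3 := by
    have := congrArg (fun p => p.coeff 1) hder
    simp only [coeff_derivative, coeff_neg, b1] at this
    norm_num at this
    simpa using (by linarith : _ = j 3)
  have p0' : (flip (C (j 0) - antider (Z 1))).coeff 0 = j' 0 := by
    rw [coeff_zero_eq_eval_zero, eval_flip, sub_zero, eval_sub, eval_C, ← unitIntegral_apply, hI]
    ring
  have p1' : (flip (C (j 0) - antider (Z 1))).coeff 1 = j' 1 := by
    have := hflip 0
    rw [b2] at this
    norm_num at this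
    simpa using this
  have p2' : (flip (C (j 0) - antider (Z 1))).coeff 2 = j' 3 := by
    have := hflip 1
    rw [b3] at this
    norm_num at this
    simpa using (by linarith : _ = j' 3)
  refine ⟨C (j 0) - antider (Z 1), Submodule.sub_mem _ ?_ (antider_mem_degreeLT (mem_degreeLT.2 hd1)),
    Z 0, mem_degreeLT.2 hd0, -Z 2, Submodule.neg_mem _ (mem_degreeLT.2 hd2), ?_,
    ⟨⟨p0.trans e0.symm, p1.trans e1.symm, p2.trans e3.symm⟩, ⟨a0, a1⟩,
      ⟨p0'.trans f0.symm, p1'.trans f1.symm, p2'.trans f3.symm⟩, ?_, ?_⟩,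
    ⟨⟨p0, p1, p2⟩, ⟨?_, ?_⟩, ⟨p0', p1', p2'⟩, ?_, ?_⟩⟩
  · rw [mem_degreeLT]
    exact degree_C_le.trans_lt (by exact_mod_cast Nat.succ_pos k)
  · rw [hder]
    linear_combination mem_syz.1 hZ
  · rw [a2, f1]
  · rw [a3, f3]
  · rw [coeff_neg, c0, neg_neg]
  · rw [coeff_neg, c1, neg_neg]
  · rw [map_neg, coeff_neg, c2, neg_neg]
  · rw [map_neg, coeff_neg, c3, neg_neg]

end

end G1Spline

namespace G1Spline

noncomputable section

variable {K₀ K₁ : Type*}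

namespace GluedSurface

variable (S : GluedSurface K₀ K₁)

/-! ### Traces on the interior edges -/

/-- The two sides of an interior edge. -/
def side (y : K₁ × Bool) : Flag S.Ω := (S.oriented (y.1, y.2, false)).src

theorem side_edge_injective : Function.Injective fun y => (S.side y).edge := by
  rintro ⟨k, x⟩ ⟨k', x'⟩ h
  simp only [side, edge_src_oriented] at h
  have := S.paired_once h
  cases x <;> cases x' <;> simp at this ⊢ <;> exact this

/-- Values and normal derivatives on both sides of all interior edges. -/
def traces : (K₀ → Bivar) →ₗ[ℝ] (K₁ × Bool → ℝ[X] × ℝ[X]) :=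
  LinearMap.pi fun y => (S.side y).val.prod (S.side y).nor

/-- Piecewise polynomial functions with vanishing two-jets at all corners. -/
def flatPiecewise (k : ℕ) : Submodule ℝ (K₀ → Bivar) :=
  piecewise S.Ω k ⊓ LinearMap.ker (Flag.jets S.Ω)

/-- The traces of functions with vanishing two-jets. -/
def flatTraces (k : ℕ) : Submodule ℝ (K₁ × Bool → ℝ[X] × ℝ[X]) :=
  Submodule.pi Set.univ fun y => flatPair k (S.Ω (S.side y).tile).r

theorem traces_mem_flatTraces {k : ℕ} (hk : 5 ≤ k) {g : K₀ → Bivar} (hg : g ∈ S.flatPiecewise k) :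
    S.traces g ∈ S.flatTraces k := by
  intro y _
  have h := Flag.hasEndJets g (S.side y)
  rw [show Flag.jets S.Ω g = 0 from hg.2] at h
  have := h.sub_mem_flatPair (r := (S.Ω (S.side y).tile).r) hk (hasEndJets_zero _)
    (val_mem_degreeLT hg.1 _) (Submodule.zero_mem _) (nor_mem_degreeLT hg.1 _)
    (Submodule.zero_mem _)
  rwa [sub_zero, sub_zero] at this

theorem exists_flat_trace {k : ℕ} (hk : 5 ≤ k) (y : K₁ × Bool) {t : ℝ[X] × ℝ[X]}
    (ht : t ∈ flatPair k (S.Ω (S.side y).tile).r) :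
    ∃ g ∈ S.flatPiecewise k, S.traces g y = t ∧ ∀ y' ≠ y, S.traces g y' = 0 := by
  obtain ⟨⟨f, hf, h1⟩, ⟨q, hq, h2⟩⟩ := mem_flatPair.1 ht
  obtain ⟨g, hg, g1, g2, g3⟩ := exists_trace hk (S.side y) hf hq
  refine ⟨g, ⟨hg, Flag.jets_eq_zero fun x => ?_⟩, Prod.ext (g1.trans h1) (g2.trans h2),
    fun y' hy => ?_⟩
  · by_cases hx : x.edge = (S.side y).edge
    · rcases (Flag.edge_eq_iff _ _).1 hx.symm with rfl | rfl
      · rw [g1, g2]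
        exact ⟨fun i hi => coeff_X_pow_mul_mul_eq_zero hi _,
          fun i hi => coeff_X_pow_mul_mul_eq_zero hi _⟩
      · rw [Flag.val_rev, Flag.nor_rev, g1, g2, flip_X_pow_mul, flip_X_pow_mul]
        refine ⟨fun i hi => coeff_X_pow_mul_mul_eq_zero hi _, fun i hi => ?_⟩
        rw [coeff_sub, coeff_X_pow_mul_mul_eq_zero hi, coeff_C_mul, coeff_flip_derivative,
          flip_X_pow_mul, coeff_X_pow_mul_mul_eq_zero (by omega)]
        simp
    · rw [(g3 x hx).1, (g3 x hx).2]
      simp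
  · obtain ⟨e1, e2⟩ := g3 (S.side y') fun e => hy (S.side_edge_injective e)
    exact Prod.ext e1 e2

/-- A flat trace on one side of one edge extends to a function whose traces on all other sides
vanish, so arbitrary flat traces are obtained by superposition. -/
theorem map_traces_flatPiecewise [Finite K₁] {k : ℕ} (hk : 5 ≤ k) :
    (S.flatPiecewise k).map S.traces = S.flatTraces k := by
  classical
  have := Fintype.ofFinite K₁
  refine le_antisymm (Submodule.map_le_iff_le_comap.2 fun g hg => S.traces_mem_flatTraces hk hg)
    fun t ht => ?_
  choose g hg h1 h2 using fun y => S.exists_flat_trace hk y (ht y trivial)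
  refine ⟨∑ y, g y, Submodule.sum_mem _ fun y _ => hg y, ?_⟩
  ext1 y
  rw [map_sum, Finset.sum_apply, Finset.sum_eq_single y, h1]
  · exact fun y' _ hy => h2 y' y hy.symm
  · exact fun h => (h (Finset.mem_univ _)).elim

theorem finrank_flatTraces [Fintype K₁] {k : ℕ} (hk : 5 ≤ k) :
    Module.finrank ℝ (S.flatTraces k) + 18 * Fintype.card K₁ = 4 * k * Fintype.card K₁ +
      ∑ E, ((S.Ω (S.gluing E).src.tile).r + (S.Ω (S.gluing E).tgt.tile).r) := by
  rw [flatTraces, finrank_pi, Fintype.sum_prod_type]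
  simp only [Fintype.sum_bool, finrank_flatPair]
  have : ∀ n, n * Fintype.card K₁ = ∑ E : K₁, n := fun n => by simp [mul_comm]
  rw [this, this, ← Finset.sum_add_distrib, ← Finset.sum_add_distrib]
  refine Finset.sum_congr rfl fun E _ => ?_
  change k - 5 + (k - 4 + (S.Ω (S.gluing E).tgt.tile).r) +
    (k - 5 + (k - 4 + (S.Ω (S.gluing E).src.tile).r)) + 18 = _
  omega

instance finite_flatPiecewise [Finite K₀] (k : ℕ) : Module.Finite ℝ (S.flatPiecewise k) :=
  Submodule.finiteDimensional_of_le (S₂ := piecewise S.Ω k) inf_le_left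

/-- The dimension of the space of functions with vanishing traces. -/
theorem finrank_flatPiecewise [Finite K₀] [Fintype K₁] {k : ℕ} (hk : 5 ≤ k) :
    Module.finrank ℝ (piecewise S.Ω k) = 6 * Nat.card (Corner S.Ω) +
      (Module.finrank ℝ (S.flatTraces k) +
      Module.finrank ℝ (S.flatPiecewise k ⊓ LinearMap.ker S.traces : Submodule ℝ _)) := by
  have h1 := finrank_map_add_finrank_inf_ker (Flag.jets S.Ω) (piecewise S.Ω k)
  have h2 := finrank_map_add_finrank_inf_ker S.traces (S.flatPiecewise k)
  have h3 : (piecewise S.Ω k).map (Flag.jets S.Ω) = S.flagSystem.jetSpace := by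
    refine le_antisymm (Submodule.map_le_iff_le_comap.2 fun g _ => Flag.jets_swap g)
      fun J hJ => ?_
    obtain ⟨g, hg, h⟩ := exists_jets hk hJ
    exact ⟨g, hg, h⟩
  rw [S.map_traces_flatPiecewise hk] at h2
  rw [h3, FlagSystem.finrank_jetSpace] at h1
  change _ + Module.finrank ℝ (S.flatPiecewise k) = _ at h1
  rw [← h1, h2]

end GluedSurface

/-! ### Two-jets and traces of splines -/

namespace G1PolygonalSurface

variable (S : G1PolygonalSurface K₀ K₁) {a b c : K₁ → ℝ[X]} {k : ℕ}

theorem degreeSpace_eq (l : K₀) : S.degreeSpace k l = (S.Ω l).space k := by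
  have : ∀ T : Tile, (match T with
      | .triangle _ _ => MvPolynomial.restrictTotalDegree (Fin 2) ℝ k
      | .rectangle _ _ => (MvPolynomial.restrictDegree (Fin 2) ℝ k).comap
        (T.pull 0 false).toLinearMap) = T.space k := by
    intro T
    cases T <;> rfl
  exact this (S.Ω l)

variable {S}

theorem mem_splineSpace {g : K₀ → Bivar} :
    g ∈ S.splineSpace k ↔ S.IsG1 g ∧ g ∈ piecewise S.Ω k := by
  refine and_congr_right fun _ => ?_
  rw [mem_piecewise]
  simp only [degreeSpace_eq]

theorem splineSpace_le : S.splineSpace k ≤ piecewise S.Ω k := fun _ hg => (mem_splineSpace.1 hg).2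

instance finite_splineSpace [Finite K₀] : Module.Finite ℝ (S.splineSpace k) :=
  Submodule.finiteDimensional_of_le splineSpace_le

/-- There are minimal pairs of generators for which the degree is large enough. -/
def IsLargeDegree (S : G1PolygonalSurface K₀ K₁) (a b c : K₁ → ℝ[X]) (k : ℕ) : Prop :=
  ∀ E, ∃ Z₁ Z₂, IsMinimalPair (a E) (b E) (c E) (S.r₁ E) (S.r₂ E) Z₁ Z₂ ∧
    2 * tdeg (S.r₁ E) (S.r₂ E) Z₁ + 3 ≤ k ∧ tdeg (S.r₁ E) (S.r₂ E) Z₂ + 4 ≤ k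

theorem isG1_of_traces (h : S.IsRationalWith a b c) {g : K₀ → Bivar} {p q q' : K₁ → ℝ[X]}
    (h1 : ∀ E, S.traces g (E, false) = (p E, q E)) (h2 : ∀ E, S.traces g (E, true) = (p E, q' E))
    (h3 : ∀ E, a E * q E = b E * derivative (p E) + c E * q' E) : S.IsG1 g := by
  rw [isG1_iff h]
  intro E
  have e1 : (S.gluing E).src.val g = p E := congrArg Prod.fst (h1 E)
  have e2 : (S.gluing E).src.nor g = q E := congrArg Prod.snd (h1 E)
  have e3 : (S.gluing E).tgt.val g = p E := congrArg Prod.fst (h2 E)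
  have e4 : (S.gluing E).tgt.nor g = q' E := congrArg Prod.snd (h2 E)
  rw [e1, e2, e3, e4]
  exact ⟨rfl, h3 E⟩

/-- All compatible families of two-jets are attained by splines. -/
theorem map_jets_splineSpace [Finite K₁] (h : S.IsRationalWith a b c)
    (hE : S.IsLargeDegree a b c k) (hk : 5 ≤ k) :
    (S.splineSpace k).map (Flag.jets S.Ω) =
      S.flagSystem.compatibleJets (S.flagTriple a b c) := by
  refine le_antisymm (Submodule.map_le_iff_le_comap.2 fun g hg =>
    jets_mem_compatibleJets h hg.1) fun J hJ => ?_
  -- Any piecewise polynomial with the given jets serves as a start; its gluing along the edges is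
  -- repaired afterwards.
  obtain ⟨g₀, hg₀, rfl⟩ := exists_jets hk hJ.1
  have hcond : ∀ o, edgeCond (S.triple a b c o) (Flag.jets S.Ω g₀ (S.oriented o).src)
      (Flag.jets S.Ω g₀ (S.oriented o).tgt) = 0 := fun o => by
    have := hJ.2 _ ((S.isGlued_iff _).2 ⟨o, rfl⟩)
    rw [flagTriple_src] at this
    rw [← S.mate_src]
    exact this
  have hsol : ∀ E, ∃ p ∈ degreeLT ℝ (k + 1), ∃ q ∈ degreeLT ℝ (k + S.r₁ E),
      ∃ q' ∈ degreeLT ℝ (k + S.r₂ E), a E * q = b E * derivative p + c E * q' ∧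
      HasEndJets (S.rho₁ E) (Flag.jets S.Ω g₀ (S.gluing E).src)
        (Flag.jets S.Ω g₀ (S.gluing E).src.rev) p q ∧
      HasEndJets (S.rho₂ E) (Flag.jets S.Ω g₀ (S.gluing E).tgt)
        (Flag.jets S.Ω g₀ (S.gluing E).tgt.rev) p q' := by
    intro E
    obtain ⟨Z₁, Z₂, hm, hk₁, hk₂⟩ := hE E
    exact hm.exists_edge_solution (fun t ht => ((h E).2 t ht).1) (h E).1 hk₁ hk₂
      (hcond (E, false, false)) (hcond (E, false, true))
  choose p hp q hq q' hq' hrel hs ht using hsol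
  -- The exact edge solutions and the traces of `g₀` have the same end jets, so the difference is a
  -- flat trace, realised by a correction that leaves all two-jets unchanged.
  have htr : (fun y : K₁ × Bool => (p y.1, if y.2 then q' y.1 else q y.1)) - S.traces g₀ ∈
      S.flatTraces k := by
    rintro ⟨E, x⟩ -
    cases x
    · exact (hs E).sub_mem_flatPair hk (Flag.hasEndJets g₀ _) (hp E) (val_mem_degreeLT hg₀ _)
        (hq E) (nor_mem_degreeLT hg₀ _)
    · exact (ht E).sub_mem_flatPair hk (Flag.hasEndJets g₀ _) (hp E) (val_mem_degreeLT hg₀ _)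
        (hq' E) (nor_mem_degreeLT hg₀ _)
  rw [← S.map_traces_flatPiecewise hk] at htr
  obtain ⟨g₁, hg₁, hg₁'⟩ := htr
  have hsum : S.traces (g₀ + g₁) =
      fun y : K₁ × Bool => (p y.1, if y.2 then q' y.1 else q y.1) := by
    rw [map_add, hg₁', add_sub_cancel]
  refine ⟨g₀ + g₁, mem_splineSpace.2 ⟨isG1_of_traces h (p := p) (q := q) (q' := q')
    (fun E => congrFun hsum _) (fun E => congrFun hsum _) hrel,
    Submodule.add_mem _ hg₀ hg₁.1⟩, ?_⟩
  rw [map_add, show Flag.jets S.Ω g₁ = 0 from hg₁.2, add_zero]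

/-- The traces of a spline with vanishing two-jets, given by syzygies. -/
def syzTraces (K₁ : Type*) : (K₁ → Fin 3 → ℝ[X]) →ₗ[ℝ] (K₁ × Bool → ℝ[X] × ℝ[X]) :=
  LinearMap.pi fun y =>
    (-(antider ∘ₗ LinearMap.mulLeft ℝ (X ^ 2 * (1 - X) ^ 2 : ℝ[X]) ∘ₗ LinearMap.proj 1 ∘ₗ
      LinearMap.proj y.1)).prod
    (LinearMap.mulLeft ℝ (X ^ 2 * (1 - X) ^ 2 : ℝ[X]) ∘ₗ
      (if y.2 then -LinearMap.proj 2 else LinearMap.proj 0) ∘ₗ LinearMap.proj y.1)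

theorem syzTraces_false (Z : K₁ → Fin 3 → ℝ[X]) (E : K₁) : syzTraces K₁ Z (E, false) =
    (-antider (X ^ 2 * (1 - X) ^ 2 * Z E 1), X ^ 2 * (1 - X) ^ 2 * Z E 0) := rfl

theorem syzTraces_true (Z : K₁ → Fin 3 → ℝ[X]) (E : K₁) : syzTraces K₁ Z (E, true) =
    (-antider (X ^ 2 * (1 - X) ^ 2 * Z E 1), X ^ 2 * (1 - X) ^ 2 * -Z E 2) := rfl

theorem syzTraces_injective : Function.Injective (syzTraces K₁) := by
  intro Z W h
  ext1 E
  have h1 := congrFun h (E, false)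
  have h2 := congrFun h (E, true)
  rw [syzTraces_false, syzTraces_false] at h1
  rw [syzTraces_true, syzTraces_true] at h2
  have e0 := mul_left_cancel₀ (X_pow_mul_ne_zero 2) (congrArg Prod.snd h1)
  have e2 := neg_injective (mul_left_cancel₀ (X_pow_mul_ne_zero 2) (congrArg Prod.snd h2))
  have e1 := congrArg derivative (neg_injective (congrArg Prod.fst h1))
  rw [derivative_antider, derivative_antider] at e1
  have e1 := mul_left_cancel₀ (X_pow_mul_ne_zero 2) e1
  ext1 i
  fin_cases i
  · exact e0
  · exact e1
  · exact e2

/-- The value along an edge obtained from the second component of a syzygy. -/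
theorem exists_antider_eq {k : ℕ} (hk : 5 ≤ k) {p : ℝ[X]} (hp : p ∈ degreeLT ℝ (k - 4))
    (h0 : unitIntegral (X ^ 2 * (1 - X) ^ 2 * p) = 0) :
    ∃ f ∈ degreeLT ℝ (k - 5), X ^ 3 * (1 - X) ^ 3 * f = -antider (X ^ 2 * (1 - X) ^ 2 * p) := by
  set A := antider (X ^ 2 * (1 - X) ^ 2 * p) with hA
  have hd : derivative A = X ^ 2 * (1 - X) ^ 2 * p := derivative_antider _
  have hflip0 : (flip A).coeff 0 = 0 := by
    rw [coeff_zero_eq_eval_zero, eval_flip, sub_zero, hA, ← unitIntegral_apply, h0]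
  have h1 : ∀ i < 2, A.coeff (i + 1) = 0 := by
    intro i hi
    have := congrArg (fun p => p.coeff i) hd
    simp only [coeff_derivative, coeff_X_pow_mul_mul_eq_zero hi] at this
    rcases mul_eq_zero.1 this with h | h
    · exact h
    · exact absurd h (by positivity)
  have h2 : ∀ i < 2, (flip A).coeff (i + 1) = 0 := by
    intro i hi
    have := coeff_flip_derivative A i
    rw [hd, flip_X_pow_mul, coeff_X_pow_mul_mul_eq_zero hi, zero_eq_neg] at this
    rcases mul_eq_zero.1 this with h | h
    · exact h
    · exact absurd h (by positivity)
  have hdvd : X ^ 3 * (1 - X) ^ 3 ∣ A := by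
    refine X_pow_mul_dvd_of_coeff (fun i hi => ?_) (fun i hi => ?_)
    · cases i with
      | zero => exact coeff_antider_zero _
      | succ i => exact h1 i (by omega)
    · cases i with
      | zero => exact hflip0
      | succ i => exact h2 i (by omega)
  obtain ⟨f, hf⟩ := hdvd
  refine ⟨-f, Submodule.neg_mem _ ((X_pow_mul_mem_degreeLT 3 _ f).1 ?_), by rw [hf]; ring⟩
  rw [← hf, hA]
  have := antider_mem_degreeLT ((X_pow_mul_mem_degreeLT 2 _ p).2 hp)
  rwa [show k - 5 + 2 * 3 = k - 4 + 2 * 2 + 1 by omega]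

/-- For a flat spline, q, p' and q' are all divisible by X²(1 - X)², and the quotients (q, -p', -q')
form a syzygy of twisted degree at most k - 4. The integral condition says that p vanishes at both
ends, and integration recovers p from the syzygy. -/
theorem map_traces_flat_splines [Finite K₁] (h : S.IsRationalWith a b c) (hk : 5 ≤ k) :
    (S.splineSpace k ⊓ LinearMap.ker (Flag.jets S.Ω)).map S.traces =
      (Submodule.pi Set.univ fun E =>
        flatSyz (a E) (b E) (c E) (S.r₁ E) (S.r₂ E) (k - 4)).map (syzTraces K₁) := by
  apply le_antisymm
  · rintro _ ⟨g, ⟨hg, hg0⟩, rfl⟩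
    have hflat := S.traces_mem_flatTraces hk (⟨splineSpace_le hg, hg0⟩ : g ∈ S.flatPiecewise k)
    have hex : ∀ E, ∃ Z ∈ flatSyz (a E) (b E) (c E) (S.r₁ E) (S.r₂ E) (k - 4),
        S.traces g (E, false) =
          (-antider (X ^ 2 * (1 - X) ^ 2 * Z 1), X ^ 2 * (1 - X) ^ 2 * Z 0) ∧
        S.traces g (E, true) =
          (-antider (X ^ 2 * (1 - X) ^ 2 * Z 1), X ^ 2 * (1 - X) ^ 2 * -Z 2) := by
      intro E
      obtain ⟨hv, hr⟩ := (isG1_iff h g).1 hg.1 E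
      obtain ⟨⟨f, hf, e1⟩, ⟨q, hq, e2⟩⟩ := mem_flatPair.1 (hflat (E, false) trivial)
      obtain ⟨-, ⟨q', hq', e3⟩⟩ := mem_flatPair.1 (hflat (E, true) trivial)
      change _ = (S.gluing E).src.val g at e1
      change _ = (S.gluing E).src.nor g at e2
      change _ = (S.gluing E).tgt.nor g at e3
      have hder : derivative ((S.gluing E).src.val g) = X ^ 2 * (1 - X) ^ 2 *
          (3 * ((1 - X) - X) * f + X * (1 - X) * derivative f) := by
        rw [← e1]
        simp only [derivative_mul, derivative_pow, derivative_sub, derivative_one, derivative_X]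
        norm_num [Tile.C_three]
        ring
      set B := 3 * ((1 - X) - X) * f + X * (1 - X) * derivative f with hB
      have hBdeg : B ∈ degreeLT ℝ (k - 4) := by
        rw [← X_pow_mul_mem_degreeLT 2, ← hder, show k - 4 + 2 * 2 = k by omega]
        exact derivative_mem_degreeLT (val_mem_degreeLT (splineSpace_le hg) _)
      have hval0 : ((S.gluing E).src.val g).coeff 0 = 0 := by
        rw [← e1]
        exact coeff_X_pow_mul_mul_eq_zero (by norm_num) _
      have hanti : -antider (X ^ 2 * (1 - X) ^ 2 * -B) = (S.gluing E).src.val g := by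
        rw [mul_neg, map_neg, neg_neg, ← hder, antider_derivative, hval0, C_0, sub_zero]
      refine ⟨![q, -B, -q'], mem_flatSyz.2 ⟨⟨mem_syz.2 ?_, mem_degreeLT.1 hq,
        mem_degreeLT.1 (Submodule.neg_mem _ hBdeg), mem_degreeLT.1 (Submodule.neg_mem _ hq')⟩, ?_⟩,
        ?_, ?_⟩
      · simp only [Matrix.cons_val_zero, Matrix.cons_val_one, Matrix.cons_val]
        rw [← e2, ← hv, hder, ← e3] at hr
        refine mul_left_cancel₀ (X_pow_mul_ne_zero 2) ?_
        linear_combination hr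
      · change unitIntegral (X ^ 2 * (1 - X) ^ 2 * -B) = 0
        rw [mul_neg, ← hder, map_neg, unitIntegral_derivative, ← e1]
        simp
      · exact Prod.ext hanti.symm e2.symm
      · refine Prod.ext (hv.symm.trans hanti.symm) ?_
        change (S.gluing E).tgt.nor g = X ^ 2 * (1 - X) ^ 2 * - -q'
        rw [neg_neg, e3]
    choose Z hZ h1 h2 using hex
    refine ⟨Z, fun E _ => hZ E, ?_⟩
    ext1 ⟨E, x⟩
    cases x
    · rw [syzTraces_false, h1]
    · rw [syzTraces_true, h2]
  · rintro _ ⟨Z, hZ, rfl⟩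
    have hZ : ∀ E, _ := fun E => mem_flatSyz.1 (hZ E trivial)
    have hflat : syzTraces K₁ Z ∈ S.flatTraces k := by
      rintro ⟨E, x⟩ -
      obtain ⟨⟨hsyz, hd0, hd1, hd2⟩, hI⟩ := hZ E
      cases x
      · rw [syzTraces_false]
        exact mem_flatPair.2 ⟨exists_antider_eq hk (mem_degreeLT.2 hd1) hI,
          ⟨_, mem_degreeLT.2 hd0, rfl⟩⟩
      · rw [syzTraces_true]
        exact mem_flatPair.2 ⟨exists_antider_eq hk (mem_degreeLT.2 hd1) hI,
          ⟨_, Submodule.neg_mem _ (mem_degreeLT.2 hd2), rfl⟩⟩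
    rw [← S.map_traces_flatPiecewise hk] at hflat
    obtain ⟨g, hg, hgZ⟩ := hflat
    refine ⟨g, ⟨mem_splineSpace.2 ⟨isG1_of_traces h
      (p := fun E => -antider (X ^ 2 * (1 - X) ^ 2 * Z E 1))
      (q := fun E => X ^ 2 * (1 - X) ^ 2 * Z E 0)
      (q' := fun E => X ^ 2 * (1 - X) ^ 2 * -Z E 2)
      (fun E => by rw [hgZ, syzTraces_false]) (fun E => by rw [hgZ, syzTraces_true])
      fun E => ?_, hg.1⟩, hg.2⟩, hgZ⟩
    rw [derivative_neg, derivative_antider]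
    linear_combination (X ^ 2 * (1 - X) ^ 2) * mem_syz.1 (hZ E).1.1

/-- The dimension of the spline space in terms of the dimension of its two-jets. -/
theorem finrank_splineSpace_add [Finite K₀] [Fintype K₁] (h : S.IsRationalWith a b c)
    (hE : S.IsLargeDegree a b c k) (hk : 5 ≤ k) :
    Module.finrank ℝ (S.splineSpace k) + 6 * Nat.card (Corner S.Ω) + 2 * k * Fintype.card K₁ +
      ∑ E, S.delta a b c E =
    Module.finrank ℝ (piecewise S.Ω k) +
      Module.finrank ℝ (S.flagSystem.compatibleJets (S.flagTriple a b c)) +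
      9 * Fintype.card K₁ := by
  have : ∀ E, Module.Finite ℝ (flatSyz (a E) (b E) (c E) (S.r₁ E) (S.r₂ E) (k - 4)) := fun E => by
    obtain ⟨Z₁, Z₂, hm, -⟩ := hE E
    exact hm.finite_flatSyz _
  have : Module.Finite ℝ (S.splineSpace k ⊓ LinearMap.ker (Flag.jets S.Ω) : Submodule ℝ _) :=
    Submodule.finiteDimensional_of_le (S₂ := S.splineSpace k) inf_le_left
  have h1 := finrank_map_add_finrank_inf_ker (Flag.jets S.Ω) (S.splineSpace k)
  have h2 := finrank_map_add_finrank_inf_ker S.traces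
    (S.splineSpace k ⊓ LinearMap.ker (Flag.jets S.Ω))
  have h3 := S.finrank_flatPiecewise (k := k) hk
  have h4 := S.finrank_flatTraces (k := k) hk
  -- With zero traces on both sides, every gluing condition reads 0 = 0.
  have hker : S.splineSpace k ⊓ LinearMap.ker (Flag.jets S.Ω) ⊓ LinearMap.ker S.traces =
      S.flatPiecewise k ⊓ LinearMap.ker S.traces := by
    ext g
    constructor
    · rintro ⟨⟨hg, hg0⟩, hg1⟩
      exact ⟨⟨splineSpace_le hg, hg0⟩, hg1⟩
    · rintro ⟨⟨hg, hg0⟩, hg1⟩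
      have hg2 : S.traces g = 0 := hg1
      refine ⟨⟨mem_splineSpace.2 ⟨isG1_of_traces h (p := 0) (q := 0) (q' := 0)
        (fun E => by rw [hg2]; rfl) (fun E => by rw [hg2]; rfl) (fun E => by simp), hg⟩, hg0⟩, hg1⟩
  rw [map_jets_splineSpace h hE hk] at h1
  change _ + _ = Module.finrank ℝ (S.splineSpace k) at h1
  rw [map_traces_flat_splines h hk, hker,
    ← (Submodule.equivMapOfInjective _ syzTraces_injective _).finrank_eq, finrank_pi] at h2
  have h5 : ∑ E, Module.finrank ℝ (flatSyz (a E) (b E) (c E) (S.r₁ E) (S.r₂ E) (k - 4)) +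
      ∑ E, S.delta a b c E + 9 * Fintype.card K₁ = 2 * k * Fintype.card K₁ +
      ∑ E, ((S.Ω (S.gluing E).src.tile).r + (S.Ω (S.gluing E).tgt.tile).r) := by
    have : ∀ n, n * Fintype.card K₁ = ∑ E : K₁, n := fun n => by simp [mul_comm]
    rw [this, this, ← Finset.sum_add_distrib, ← Finset.sum_add_distrib, ← Finset.sum_add_distrib]
    refine Finset.sum_congr rfl fun E _ => ?_
    obtain ⟨Z₁, Z₂, hm, hk₁, hk₂⟩ := hE E
    have hc : c E ≠ 0 := fun h0 => (triple_spec_zero h (E, true, false)).1 (by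
      change (c E).coeff 0 = 0
      rw [h0, coeff_zero])
    have := hm.finrank_flatSyz (fun t ht => ((h E).2 t ht).1) hc (h E).1 hk₁ hk₂
    change _ + S.delta a b c E + 9 = 2 * k + S.r₁ E + S.r₂ E at this
    change _ = 2 * k + (S.r₁ E + S.r₂ E)
    omega
  have h6 : 4 * k * Fintype.card K₁ = 2 * k * Fintype.card K₁ + 2 * k * Fintype.card K₁ := by ring
  -- The space with zero two-jets and zero traces occurs both in the filtration of the splines and
  -- in that of the piecewise polynomials, and is eliminated between them.
  omega

end G1PolygonalSurface

end

end G1Spline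

namespace G1Spline

noncomputable section

variable {K₀ K₁ : Type*}

/-! ### Combination of the dimension counts -/

namespace G1PolygonalSurface

variable {S : G1PolygonalSurface K₀ K₁} {a b c : K₁ → ℝ[X]} {k : ℕ}

theorem r_le_one (T : Tile) : T.r ≤ 1 := by
  cases T <;> simp [Tile.r]

/-- The degree hypothesis quantifies over all minimal pairs; the existence of one keeps it from
being vacuous and yields the concrete bounds. -/
theorem isLargeDegree (h : S.IsRationalWith a b c)
    (hk : ∀ (E : K₁) (Z₁ Z₂ : Fin 3 → ℝ[X]),
      IsMinimalPair (a E) (b E) (c E) (S.r₁ E) (S.r₂ E) Z₁ Z₂ →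
      tdeg (S.r₁ E) (S.r₂ E) Z₁ ≤ tdeg (S.r₁ E) (S.r₂ E) Z₂ →
      max (2 * tdeg (S.r₁ E) (S.r₂ E) Z₁ + 3) (tdeg (S.r₁ E) (S.r₂ E) Z₂ + 4) ≤ k) :
    S.IsLargeDegree a b c k ∧ (Nonempty K₁ → 5 ≤ k) := by
  have hac : ∀ E, a E ≠ 0 ∧ c E ≠ 0 := fun E =>
    ⟨fun h0 => (triple_spec_zero h (E, false, false)).1 (by
      change (a E).coeff 0 = 0
      rw [h0, coeff_zero]), fun h0 => (triple_spec_zero h (E, true, false)).1 (by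
      change (c E).coeff 0 = 0
      rw [h0, coeff_zero])⟩
  refine ⟨fun E => ?_, fun ⟨E⟩ => ?_⟩
  · obtain ⟨Z₁, Z₂, hm, hle⟩ := exists_isMinimalPair (b := b E) (r_le_one _ : S.r₁ E ≤ 1)
      (r_le_one _ : S.r₂ E ≤ 1) (hac E).1 (hac E).2
    have := hk E Z₁ Z₂ hm hle
    exact ⟨Z₁, Z₂, hm, (le_max_left _ _).trans this, (le_max_right _ _).trans this⟩
  · obtain ⟨Z₁, Z₂, hm, hle⟩ := exists_isMinimalPair (b := b E) (r_le_one _ : S.r₁ E ≤ 1)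
      (r_le_one _ : S.r₂ E ≤ 1) (hac E).1 (hac E).2
    have h1 : 1 ≤ tdeg (S.r₁ E) (S.r₂ E) Z₂ := hm.one_le_tdeg_right (hac E).1 (h E).1 hle
    have h2 := (le_max_right _ _).trans (hk E Z₁ Z₂ hm hle)
    omega

/-- The dimension of the spline space, before eliminating the numbers of corners and edges. -/
theorem finrank_splineSpace [Finite K₀] [Fintype K₁] (h : S.IsRationalWith a b c)
    (hE : S.IsLargeDegree a b c k) (hk : Nonempty K₁ → 5 ≤ k) :
    Module.finrank ℝ (S.splineSpace k) + 3 * Nat.card {c // S.flagSystem.rank c ≠ 0} +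
      2 * k * Fintype.card K₁ + ∑ E, S.delta a b c E =
    Module.finrank ℝ (piecewise S.Ω k) + S.numCrossing + 5 * Fintype.card K₁ := by
  have h2 := S.two_mul_card_edges
  -- Without interior edges k may be small, but every piecewise polynomial is then a spline and no
  -- crossing vertex exists.
  rcases isEmpty_or_nonempty K₁ with hK | hK
  · have h3 : S.splineSpace k = piecewise S.Ω k := le_antisymm splineSpace_le fun g hg =>
      mem_splineSpace.2 ⟨fun E => hK.elim E, hg⟩
    have h4 : S.numCrossing = 0 := by
      have : IsEmpty {v // S.IsCrossingVertex v} := ⟨fun ⟨_, e, _⟩ => hK.elim (e 0).1⟩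
      exact Nat.card_of_isEmpty
    rw [Fintype.card_eq_zero] at h2 ⊢
    have h5 : Module.finrank ℝ (S.splineSpace k) = Module.finrank ℝ (piecewise S.Ω k) := by
      rw [← h3]
    rw [h5, h4, Finset.univ_eq_empty, Finset.sum_empty]
    omega
  · have h3 := finrank_splineSpace_add h hE (hk hK)
    have h4 := finrank_compatibleJets h
    omega

end G1PolygonalSurface

end

end G1Spline

theorem theorem5p1 {K₀ K₁ : Type*} [Fintype K₀] [Fintype K₁]
    (S : G1Spline.G1PolygonalSurface K₀ K₁)
    (a b c : K₁ → Polynomial ℝ) (hrat : S.IsRationalWith a b c)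
    (k : ℕ)
    (hk : ∀ (E : K₁) (Z₁ Z₂ : Fin 3 → Polynomial ℝ),
      G1Spline.IsMinimalPair (a E) (b E) (c E) (S.r₁ E) (S.r₂ E) Z₁ Z₂ →
      G1Spline.tdeg (S.r₁ E) (S.r₂ E) Z₁ ≤ G1Spline.tdeg (S.r₁ E) (S.r₂ E) Z₂ →
      max (2 * G1Spline.tdeg (S.r₁ E) (S.r₂ E) Z₁ + 3)
        (G1Spline.tdeg (S.r₁ E) (S.r₂ E) Z₂ + 4) ≤ k) :
    Module.Finite ℝ (S.splineSpace k) ∧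
    (Module.finrank ℝ (S.splineSpace k) : ℝ) =
      3 * S.numVertices + S.numCrossing - ((∑ E : K₁, S.delta a b c E : ℕ) : ℝ)
      + ((k : ℝ) - 5 / 2) * S.numBoundaryEdges
      + ((k : ℝ) ^ 2 - 2 * k - 1) * S.numRectangles
      + ((k : ℝ) ^ 2 - 3 * k - 1) / 2 * S.numTriangles := by
  refine ⟨inferInstance, ?_⟩
  obtain ⟨hE, hk5⟩ := G1Spline.G1PolygonalSurface.isLargeDegree hrat hk
  have h1 := G1Spline.G1PolygonalSurface.finrank_splineSpace hrat hE hk5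
  have h2 := S.card_corners
  have h3 := G1Spline.card_corner_eq S.Ω
  have h4 := S.flagSystem.card_corner
  have h5 := G1Spline.finrank_piecewise (Ω := S.Ω) (k := k)
  change _ = S.numVertices + _ at h4
  change _ = _ + S.numBoundaryEdges at h2
  change _ = 3 * S.numTriangles + 4 * S.numRectangles at h3
  change _ = _ * S.numTriangles + _ * S.numRectangles at h5
  generalize Nat.card {c // S.flagSystem.rank c ≠ 0} = R at h1 h4
  generalize ∑ E, S.delta a b c E = D at h1 ⊢
  rify at h1 h2 h3 h4 h5 ⊢
  -- The number of non-root corners is the number of corners minus the number of vertices, and twice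
  -- the number of interior edges is the number of corners minus the number of boundary edges;
  -- substitution turns the count into the stated formula.
  have hC : (R : ℝ) =
      3 * S.numTriangles + 4 * S.numRectangles - S.numVertices := by linarith
  have hK : (Fintype.card K₁ : ℝ) =
      (3 * S.numTriangles + 4 * S.numRectangles - S.numBoundaryEdges) / 2 := by linarith
  rw [hC, hK] at h1
  linear_combination h1 + h5 / 2
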